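/- Let $p\ge 0$ and $m\ge 1$ be fixed integers. For each sample size $n$, let $x_{1-p},\dots,x_0,x_1,\dots,x_n$ (a triangular array; the dependence on $n$ is suppressed) satisfy, for $1\le t\le n$, $$x_t=a_{01}x_{t-1}+\dots+a_{0p}x_{t-p}+u_t,\qquad u_t=\tilde h_t\epsilon_t,\qquad \tilde h_t^2=h_t^2+\alpha_{01}u_{t-1}^2+\dots+\alpha_{0m}u_{t-m}^2,$$ with $\alpha_{0i}\ge 0$, $\tilde h_t\ge 0$, where the $a_{0i}$ are real with $1-\sum_{i=1}^p a_{0i}z^i\ne 0$ for all complex $|z|\le 1$, and where the initial values $x_{1-p},\dots,x_0$ are random variables bounded in probability uniformly in $n$. Assume: (A1) $h_t=g(t/n)$, where $g:(0,1]\to\mathbb R$ is deterministic, measurable, bounded, bounded away from zero ($\inf_{r\in(0,1]} g(r)>0$) and piecewise Lipschitz: $(0,1]$ is a finite union of mutually disjoint intervals on each of which $g$ is Lipschitz. The $\epsilon_t$, $t\in\mathbb Z$, are independent and identically distributed (as a generic variable $\epsilon$) with $E(\epsilon)=0$, $E(\epsilon^2)=1$, $E(|\epsilon|^s)<\infty$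 for some $s>8$, and $E(\epsilon^4)>1$. ($H_0$) $\alpha_{0i}=0$ for all $1\le i\le m$. For $\theta\in\mathbb R^p$ and $\vartheta=(\alpha_1,\dots,\alpha_m)'\in\mathbb R^m$ put $u_t(\theta)=x_t-\theta_1x_{t-1}-\dots-\theta_px_{t-p}$ for $t\ge 1$, $u_t(\theta)=0$ for $t\le 0$, $\tilde h_t^2(\theta,\vartheta)=h_t^2+\sum_{i=1}^m\alpha_iu_{t-i}^2(\theta)$, and $$\mathcal L(\theta,\vartheta)=-\frac12\sum_{t=1}^n\Big\{\frac{u_t^2(\theta)}{\tilde h_t^2(\theta,\vartheta)}+\log \tilde h_t^2(\theta,\vartheta)\Big\},\qquad \mathcal S(\theta)=\frac1{\sqrt n}\frac{\partial\mathcal L}{\partial\vartheta}(\theta,0)=\frac{1}{2\sqrt n}\sum_{t=1}^n\Big(\frac{u_t^2(\theta)}{h_t^2}-1\Big)\Big(\frac{u_{t-1}^2(\theta)}{h_t^2},\dots,\frac{u_{t-m}^2(\theta)}{h_t^2}\Big)'.$$ With $\underline x_t=(x_t,\dots,x_{t-p+1})'$ let $$\hat\theta'=\Big\{\sum_{t=1}^nh_t^{-2}x_t\underline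 x_{t-1}'\Big\}\Big\{\sum_{t=1}^nh_t^{-2}\underline x_{t-1}\underline x_{t-1}'\Big\}^{-1}$$ be the generalized least-squares estimator. For $v,e\in\mathbb R$ let $\Sigma(v,e)$ be the $m\times m$ matrix with diagonal entries $ve/4$ and off-diagonal entries $v/4$, and let $\Sigma=\Sigma(\mathrm{Var}(\epsilon^2),E(\epsilon^4))$. (The inverse of a singular matrix may be given the value $0$; the matrices inverted here are non-singular with probability tending to one.) Then, as $n\to\infty$, the statistic $$Q_{GLS}=\mathcal S(\hat\theta)'\hat\Sigma^{-1}\mathcal S(\hat\theta)$$ converges in law to the $\chi^2_m$ distribution, for every sequence of random matrices $\hat\Sigma$ which converges in probability to $\Sigma$. Moreover this convergence holds for $\hat\Sigma=\Sigma\big(\widehat{\mathrm{Var}}(\epsilon^2),\widehat E(\epsilon^4)\big)$ with $$\widehat E(\epsilon^4)=\frac1n\sum_{t=1}^n\frac{u_t^4(\hat\theta)}{h_t^4}$$ and either of the two choices $$\widehat{\mathrm{Var}}(\epsilon^2)=\frac1n\sum_{t=1}^n\frac{u_t^4(\hat\theta)}{h_t^4}-1,\qquad \widehat{\mathrm{Var}}(\epsilon^2)=\frac1n\sum_{t=1}^n\frac{u_t^4(\hat\theta)}{h_t^4}-\Big(\frac1n\sum_{t=1}^n\frac{u_t^2(\hat\theta)}{h_t^2}\Big)^2.$$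 -/

import Mathlib

open MeasureTheory ProbabilityTheory Filter Topology

noncomputable section

namespace ArchLM

/-! ### The model -/

/-- Piecewise Lipschitz condition on `(0,1]`: `(0,1]` is a finite union of mutually disjoint
intervals, on each of which `g` is Lipschitz. -/
def PiecewiseLipschitz (g : ℝ → ℝ) : Prop :=
  ∃ (k : ℕ) (I : Fin k → Set ℝ),
    (∀ l, (I l).OrdConnected) ∧ Pairwise (fun l l' => Disjoint (I l) (I l')) ∧
    (⋃ l, I l) = Set.Ioc (0 : ℝ) 1 ∧ ∀ l, ∃ K : NNReal, LipschitzOnWith K g (I l)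

/-- Conditions on the volatility function `g` on `(0,1]` (its values elsewhere are irrelevant). -/
structure VolatilityFunction (g : ℝ → ℝ) : Prop where
  measurable : Measurable ((Set.Ioc (0 : ℝ) 1).domRestrict g)
  bounded : BddAbove (g '' Set.Ioc (0 : ℝ) 1)
  bounded_below : ∃ c : ℝ, 0 < c ∧ ∀ r ∈ Set.Ioc (0 : ℝ) 1, c ≤ g r
  piecewiseLipschitz : PiecewiseLipschitz g

/-- Conditions on the noise: iid, centred, unit variance, a finite moment of some order `s > 8`,
and `E(ε⁴) > 1` (that is, `ε²` is not almost surely constant). -/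
structure Noise {Ω : Type*} [MeasurableSpace Ω] (μ : Measure Ω) (ε : ℤ → Ω → ℝ) : Prop where
  measurable : ∀ t, Measurable (ε t)
  indep : iIndepFun ε μ
  identDistrib : ∀ t, IdentDistrib (ε t) (ε 0) μ μ
  mean_zero : μ[ε 0] = 0
  unit_variance : variance (ε 0) μ = 1
  moment : ∃ s : ℝ, 8 < s ∧ Integrable (fun ω => |ε 0 ω| ^ s) μ
  kurtosis : 1 < ∫ ω, (ε 0 ω) ^ 4 ∂μ

/-- The autoregressive polynomial `1 - a₁ z - ⋯ - a_p z^p` has no zero in the closed unit disc. -/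
def Stable {p : ℕ} (a : Fin p → ℝ) : Prop :=
  ∀ z : ℂ, ‖z‖ ≤ 1 → 1 - ∑ i : Fin p, (a i : ℂ) * z ^ ((i : ℕ) + 1) ≠ 0

/-- `h_t = g(t/n)` for the sample size `n`. -/
def vol (g : ℝ → ℝ) (n : ℕ) (t : ℤ) : ℝ := g ((t : ℝ) / (n : ℝ))

/-- `x̲_t = (x_t, …, x_{t-p+1})`. -/
def lagVec (p : ℕ) (x : ℤ → ℝ) (t : ℤ) : Fin p → ℝ := fun i => x (t - (i : ℕ))

/-- The AR(`p`) model with ARCH(`m`) effects around the time-varying volatility `h_t = g(t/n)`: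
for every sample size `n` and `1 ≤ t ≤ n`,
`x_t = a₁ x_{t-1} + ⋯ + a_p x_{t-p} + u_t`, `u_t = h̃_t ε_t`,
`h̃_t² = h_t² + α₁ u_{t-1}² + ⋯ + α_m u_{t-m}²`.
The initial values `x_{1-p}, …, x_0` are random variables which are bounded in probability
(they may depend on the sample size `n`). -/
structure ARCHModel {Ω : Type*} [MeasurableSpace Ω] (μ : Measure Ω) {p m : ℕ} (a : Fin p → ℝ)
    (α : Fin m → ℝ) (g : ℝ → ℝ) (ε : ℤ → Ω → ℝ) (u x : ℕ → ℤ → Ω → ℝ) : Prop where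
  alpha_nonneg : ∀ i, 0 ≤ α i
  ar : ∀ (n : ℕ) (t : ℤ), 1 ≤ t → t ≤ n → ∀ ω,
    x n t ω = a ⬝ᵥ lagVec p (fun s => x n s ω) (t - 1) + u n t ω
  arch : ∀ (n : ℕ) (t : ℤ), 1 ≤ t → t ≤ n → ∀ ω,
    u n t ω = √(vol g n t ^ 2 + ∑ i : Fin m, α i * u n (t - ((i : ℕ) + 1)) ω ^ 2) * ε t ω
  init_measurable : ∀ (n : ℕ) (t : ℤ), -(p : ℤ) < t → t ≤ 0 → Measurable (x n t)
  init_bounded : ∀ δ : ℝ, 0 < δ → ∃ M : ℝ, ∀ (n : ℕ) (t : ℤ), -(p : ℤ) < t → t ≤ 0 →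
    μ.real {ω | M < |x n t ω|} ≤ δ

/-! ### The statistics, as functions of the sample size `n`, the volatilities `h`, and a
trajectory `x` -/

/-- `u_t(θ) = x_t - θ₁ x_{t-1} - ⋯ - θ_p x_{t-p}` for `t ≥ 1`, and `u_t(θ) = 0` for `t ≤ 0`. -/
def residual {p : ℕ} (x : ℤ → ℝ) (θ : Fin p → ℝ) (t : ℤ) : ℝ :=
  if t ≤ 0 then 0 else x t - θ ⬝ᵥ lagVec p x (t - 1)

/-- `h̃_t²(θ, ϑ) = h_t² + α₁ u_{t-1}²(θ) + ⋯ + α_m u_{t-m}²(θ)`, with `ϑ = (α₁, …, α_m)`. -/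
def condVar {p m : ℕ} (h x : ℤ → ℝ) (θ : Fin p → ℝ) (ϑ : Fin m → ℝ) (t : ℤ) : ℝ :=
  h t ^ 2 + ∑ i : Fin m, ϑ i * residual x θ (t - ((i : ℕ) + 1)) ^ 2

/-- The Gaussian quasi log-likelihood (up to a constant). -/
def quasiLogLik {p m : ℕ} (n : ℕ) (h x : ℤ → ℝ) (θ : Fin p → ℝ) (ϑ : Fin m → ℝ) : ℝ :=
  -(1 / 2) * ∑ t ∈ Finset.Icc (1 : ℤ) n,
    (residual x θ t ^ 2 / condVar h x θ ϑ t + Real.log (condVar h x θ ϑ t))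

/-- The normalized score `S(θ) = n^{-1/2} ∂L/∂ϑ` at `(θ, ϑ) = (θ, 0)`. -/
def score {p : ℕ} (m n : ℕ) (h x : ℤ → ℝ) (θ : Fin p → ℝ) : Fin m → ℝ := fun i =>
  1 / √(n : ℝ) * deriv (fun s : ℝ => quasiLogLik n h x θ (Pi.single i s : Fin m → ℝ)) 0

/-- The explicit form of the score. -/
theorem score_eq {p m n : ℕ} (h x : ℤ → ℝ) (θ : Fin p → ℝ)
    (hh : ∀ t ∈ Finset.Icc (1 : ℤ) n, h t ≠ 0) (i : Fin m) :
    score m n h x θ i = 1 / (2 * √(n : ℝ)) * ∑ t ∈ Finset.Icc (1 : ℤ) n,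
      (residual x θ t ^ 2 / h t ^ 2 - 1) *
        (residual x θ (t - ((i : ℕ) + 1)) ^ 2 / h t ^ 2) := by
  have key : HasDerivAt (fun s : ℝ => quasiLogLik n h x θ (Pi.single i s : Fin m → ℝ))
      (-(1 / 2) * ∑ t ∈ Finset.Icc (1 : ℤ) n,
        (-(residual x θ t ^ 2 * residual x θ (t - ((i : ℕ) + 1)) ^ 2) / (h t ^ 2) ^ 2
          + residual x θ (t - ((i : ℕ) + 1)) ^ 2 / h t ^ 2)) 0 := by
    unfold quasiLogLik
    refine HasDerivAt.const_mul _ (HasDerivAt.fun_sum fun t ht => ?_)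
    have hc : ∀ s : ℝ, condVar h x θ (Pi.single i s : Fin m → ℝ) t
        = h t ^ 2 + s * residual x θ (t - ((i : ℕ) + 1)) ^ 2 := by
      intro s
      simp [condVar, Pi.single_apply]
    simp only [hc]
    have h0 : h t ≠ 0 := hh t ht
    have hd : HasDerivAt (fun s : ℝ => h t ^ 2 + s * residual x θ (t - ((i : ℕ) + 1)) ^ 2)
        (residual x θ (t - ((i : ℕ) + 1)) ^ 2) 0 := by
      simpa using ((hasDerivAt_id (0 : ℝ)).mul_const
        (residual x θ (t - ((i : ℕ) + 1)) ^ 2)).const_add (h t ^ 2)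
    have hne : h t ^ 2 + 0 * residual x θ (t - ((i : ℕ) + 1)) ^ 2 ≠ 0 := by simpa using h0
    have h1 := (hasDerivAt_const (0 : ℝ) (residual x θ t ^ 2)).fun_div hd hne
    have h2 := hd.log hne
    simpa using h1.fun_add h2
  unfold score
  rw [key.deriv, Finset.mul_sum, Finset.mul_sum, Finset.mul_sum]
  refine Finset.sum_congr rfl fun t ht => ?_
  have h0 : h t ≠ 0 := hh t ht
  rcases eq_or_ne (√(n : ℝ)) 0 with hs | hs
  · simp [hs]
  · field_simp
    ring

/-- The generalized least-squares estimator
`θ̂ = {∑ h_t⁻² x_t x̲_{t-1}} {∑ h_t⁻² x̲_{t-1} x̲_{t-1}'}⁻¹`. -/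
def gls (p n : ℕ) (h x : ℤ → ℝ) : Fin p → ℝ :=
  Matrix.vecMul
    (∑ t ∈ Finset.Icc (1 : ℤ) n, ((h t ^ 2)⁻¹ * x t) • lagVec p x (t - 1))
    (∑ t ∈ Finset.Icc (1 : ℤ) n,
      (h t ^ 2)⁻¹ • Matrix.vecMulVec (lagVec p x (t - 1)) (lagVec p x (t - 1)))⁻¹

/-- The `m × m` matrix `(v/4) M`, where `M` has `e` on the diagonal and `1` elsewhere. -/
def covMatrix (m : ℕ) (v e : ℝ) : Matrix (Fin m) (Fin m) ℝ :=
  Matrix.of fun i j => v / 4 * (if i = j then e else 1)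

/-- `n⁻¹ ∑ u_t^k(θ̂) / h_t^k`; for `k = 4` this is the estimator of `E(ε⁴)`. -/
def empMoment (p n k : ℕ) (h x : ℤ → ℝ) : ℝ :=
  1 / (n : ℝ) * ∑ t ∈ Finset.Icc (1 : ℤ) n, residual x (gls p n h x) t ^ k / h t ^ k

/-- First estimator of `Σ`: `Var(ε²)` is estimated by `n⁻¹ ∑ u_t⁴(θ̂)/h_t⁴ - 1`. -/
def sigmaHat₁ (p m n : ℕ) (h x : ℤ → ℝ) : Matrix (Fin m) (Fin m) ℝ :=
  covMatrix m (empMoment p n 4 h x - 1) (empMoment p n 4 h x)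

/-- Second estimator of `Σ`: `Var(ε²)` is estimated by
`n⁻¹ ∑ u_t⁴(θ̂)/h_t⁴ - (n⁻¹ ∑ u_t²(θ̂)/h_t²)²`. -/
def sigmaHat₂ (p m n : ℕ) (h x : ℤ → ℝ) : Matrix (Fin m) (Fin m) ℝ :=
  covMatrix m (empMoment p n 4 h x - empMoment p n 2 h x ^ 2) (empMoment p n 4 h x)

/-- `Q_GLS = S(θ̂)' Σ̂⁻¹ S(θ̂)`. -/
def qGLS (p m n : ℕ) (h x : ℤ → ℝ) (sigmaHat : Matrix (Fin m) (Fin m) ℝ) : ℝ :=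
  score m n h x (gls p n h x) ⬝ᵥ Matrix.mulVec sigmaHat⁻¹ (score m n h x (gls p n h x))

/-! ### The limit law -/

/-- The chi-squared law with `m` degrees of freedom: the law of `Z₁² + ⋯ + Z_m²` for independent
standard normal `Z₁, …, Z_m`. -/
def chiSquared (m : ℕ) : Measure ℝ :=
  (Measure.pi fun _ : Fin m => gaussianReal 0 1).map fun z => ∑ i, z i ^ 2

instance (m : ℕ) : IsProbabilityMeasure (chiSquared m) :=
  Measure.isProbabilityMeasure_map (Measurable.aemeasurable (by fun_prop))

/-- Convergence in law to the chi-squared law with `m` degrees of freedom. -/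
def AsympChiSquared {Ω : Type*} [MeasurableSpace Ω] (μ : Measure Ω) [IsProbabilityMeasure μ]
    (m : ℕ) (Q : ℕ → Ω → ℝ) : Prop :=
  TendstoInDistribution Q atTop (id : ℝ → ℝ) (fun _ => μ) (chiSquared m)

/-- The random matrices `sigmaHat n` are a consistent estimator of
`Σ = (Var(ε²)/4) M`, where `M` has `E(ε⁴)` on the diagonal and `1` elsewhere. -/
structure ConsistentSigma {Ω : Type*} [MeasurableSpace Ω] (μ : Measure Ω) (ε : ℤ → Ω → ℝ) {m : ℕ}
    (sigmaHat : ℕ → Ω → Matrix (Fin m) (Fin m) ℝ) : Prop where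
  aemeasurable : ∀ n i j, AEMeasurable (fun ω => sigmaHat n ω i j) μ
  consistent : ∀ i j, TendstoInMeasure μ (fun n ω => sigmaHat n ω i j) atTop
    (fun _ => covMatrix m (variance (fun ω => ε 0 ω ^ 2) μ) (∫ ω, (ε 0 ω) ^ 4 ∂μ) i j)

end ArchLM

end

open MeasureTheory ProbabilityTheory Filter Topology

noncomputable section

namespace ArchLM

/-! ### Boundedness in probability -/

section BddInProb

variable {Ω : Type*} [MeasurableSpace Ω] {μ : Measure Ω}

/-! Under the null hypothesis the innovations are h_t ε_t, so the residual at θ̂ is h_t ε_t −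
δ·x̲_{t−1} with δ = θ̂ − a, and S(θ̂) is a polynomial in δ. Its constant term is (2√n)⁻¹ ∑ (ε_t² −
1)(h_{t−i}²/h_t²) ε_{t−i}². Before the factor (2√n)⁻¹, the coefficients of δ are sums of martingale
differences, hence O_P(√n), and the remainder is δ²·O_P(n). Since √n δ = O_P(1)
(`bddInProb_sqrt_mul_norm_gls_sub`), the score differs from its constant term by O_P(n^{-1/2})
(`tendstoInMeasure_score_sub`).

The volatility ratio can be replaced by 1: it is 1 + O(1/n) unless t/n and (t−i)/n lie in different
Lipschitz pieces, which happens for boundedly many t (`exists_sum_ratio_sub_one_sq_le`,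
`tendstoInMeasure_weighted_sub`). What remains depends on the noise alone. For every direction v it
is a normalized sum of martingale differences of finite range, with variance v·Σv; a recursion for
characteristic functions gives its normal limit (`tendsto_integral_cexp`). Writing Σ = R Rᵀ, the
score tends in law to R Z with Z standard normal, and since (Rz)·Σ⁻¹(Rz) = z·z, Slutsky's lemma
yields the chi-squared law (`ARCHModel.asympChiSquared`). The plug-in estimators are consistent
because the same expansion applies to the empirical moments (`tendstoInMeasure_empMoment`).

The rate of θ̂ needs no limit for the Gram matrix, only a lower bound of order n. Substituting the
autoregression into ∑ (l·x̲_{t−1})² releases (l·e₁)² ∑ u_t² and leaves the same form at Mᵀl, where M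
is the companion matrix; p substitutions produce ∑_{k<p} (l·Mᵏe₁)² ∑ u_t², and the vectors Mᵏe₁ span
(`sum_sq_dotProduct_ge`).

The initial values are only bounded in probability and may depend on the noise. They are therefore
split off from the state: their contribution decays geometrically and is bounded pathwise, while
moments and orthogonality are applied only to the part driven by the noise. -/

/-- The sequence `X` is (eventually) bounded in probability. -/
def BddInProb (μ : Measure Ω) (X : ℕ → Ω → ℝ) : Prop :=
  ∀ δ : ℝ, 0 < δ → ∃ M : ℝ, 0 ≤ M ∧ ∀ᶠ n in atTop, μ.real {ω | M < |X n ω|} ≤ δ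

/-- The domination may fail on an event of vanishing probability. This form is needed for the
least-squares estimator, which is controlled only where the Gram matrix is large. -/
theorem BddInProb.mono_whp [IsFiniteMeasure μ] {X Y : ℕ → Ω → ℝ} (hY : BddInProb μ Y)
    (h : Tendsto (fun n => μ.real {ω | ¬ |X n ω| ≤ |Y n ω|}) atTop (𝓝 0)) : BddInProb μ X := by
  intro δ hδ
  obtain ⟨M, hM, hev⟩ := hY (δ / 2) (half_pos hδ)
  refine ⟨M, hM, ?_⟩
  filter_upwards [hev, h.eventually (gt_mem_nhds (half_pos hδ))] with n hn hn'
  have hsub : {ω | M < |X n ω|} ⊆ {ω | M < |Y n ω|} ∪ {ω | ¬ |X n ω| ≤ |Y n ω|} := by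
    intro ω hω
    by_cases hc : |X n ω| ≤ |Y n ω|
    · exact Or.inl (lt_of_lt_of_le hω hc)
    · exact Or.inr hc
  have := (measureReal_mono (μ := μ) hsub).trans (measureReal_union_le _ _)
  linarith

theorem BddInProb.mono [IsFiniteMeasure μ] {X Y : ℕ → Ω → ℝ} (hY : BddInProb μ Y)
    (h : ∀ᶠ n in atTop, ∀ ω, |X n ω| ≤ |Y n ω|) : BddInProb μ X := by
  refine hY.mono_whp (tendsto_const_nhds.congr' ?_)
  filter_upwards [h] with n hn
  simp [hn]

theorem BddInProb.add [IsFiniteMeasure μ] {X Y : ℕ → Ω → ℝ} (hX : BddInProb μ X)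
    (hY : BddInProb μ Y) : BddInProb μ (fun n ω => X n ω + Y n ω) := by
  intro δ hδ
  obtain ⟨M, hM, hev⟩ := hX (δ / 2) (half_pos hδ)
  obtain ⟨N, hN, hev'⟩ := hY (δ / 2) (half_pos hδ)
  refine ⟨M + N, by positivity, ?_⟩
  filter_upwards [hev, hev'] with n hn hn'
  have hsub : {ω | M + N < |X n ω + Y n ω|} ⊆ {ω | M < |X n ω|} ∪ {ω | N < |Y n ω|} := by
    intro ω hω
    by_contra hc
    simp only [Set.mem_union, Set.mem_ofPred_eq, not_or, not_lt] at hc hω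
    linarith [abs_add_le (X n ω) (Y n ω)]
  have := (measureReal_mono (μ := μ) hsub).trans (measureReal_union_le _ _)
  linarith

theorem BddInProb.mul [IsFiniteMeasure μ] {X Y : ℕ → Ω → ℝ} (hX : BddInProb μ X)
    (hY : BddInProb μ Y) : BddInProb μ (fun n ω => X n ω * Y n ω) := by
  intro δ hδ
  obtain ⟨M, hM, hev⟩ := hX (δ / 2) (half_pos hδ)
  obtain ⟨N, hN, hev'⟩ := hY (δ / 2) (half_pos hδ)
  refine ⟨M * N, by positivity, ?_⟩
  filter_upwards [hev, hev'] with n hn hn'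
  have hsub : {ω | M * N < |X n ω * Y n ω|} ⊆ {ω | M < |X n ω|} ∪ {ω | N < |Y n ω|} := by
    intro ω hω
    by_contra hc
    simp only [Set.mem_union, Set.mem_ofPred_eq, not_or, not_lt, abs_mul] at hc hω
    have := mul_le_mul hc.1 hc.2 (abs_nonneg _) hM
    linarith
  have := (measureReal_mono (μ := μ) hsub).trans (measureReal_union_le _ _)
  linarith

theorem BddInProb.const (c : ℝ) : BddInProb μ (fun _ _ => c) := fun δ hδ =>
  ⟨|c|, abs_nonneg c, Eventually.of_forall fun _ => by simpa using hδ.le⟩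

theorem BddInProb.const_mul [IsFiniteMeasure μ] {X : ℕ → Ω → ℝ} (c : ℝ) (hX : BddInProb μ X) :
    BddInProb μ (fun n ω => c * X n ω) :=
  (BddInProb.const c).mul hX

theorem BddInProb.pow [IsFiniteMeasure μ] {X : ℕ → Ω → ℝ} (hX : BddInProb μ X) (k : ℕ) :
    BddInProb μ (fun n ω => X n ω ^ k) := by
  induction k with
  | zero => simpa using BddInProb.const 1
  | succ k ih => simpa only [pow_succ] using ih.mul hX

theorem BddInProb.sum [IsFiniteMeasure μ] {ι : Type*} (s : Finset ι) {X : ι → ℕ → Ω → ℝ}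
    (hX : ∀ i ∈ s, BddInProb μ (X i)) : BddInProb μ (fun n ω => ∑ i ∈ s, X i n ω) := by
  classical
  induction s using Finset.induction_on with
  | empty => simpa using BddInProb.const 0
  | insert i s hi ih =>
    simp only [Finset.sum_insert hi]
    exact (hX i (by simp)).add (ih fun j hj => hX j (by simp [hj]))

theorem BddInProb.abs {X : ℕ → Ω → ℝ} (hX : BddInProb μ X) :
    BddInProb μ (fun n ω => |X n ω|) := by
  simpa only [BddInProb, abs_abs] using hX

theorem BddInProb.of_integral_abs_le [IsFiniteMeasure μ] {X : ℕ → Ω → ℝ} (K : ℝ)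
    (hint : ∀ᶠ n in atTop, Integrable (X n) μ)
    (hK : ∀ᶠ n in atTop, ∫ ω, |X n ω| ∂μ ≤ K) : BddInProb μ X := by
  intro δ hδ
  refine ⟨|K| / δ + 1, by positivity, ?_⟩
  filter_upwards [hint, hK] with n hn hKn
  have hpos : 0 < |K| / δ + 1 := by positivity
  have hmark := mul_meas_ge_le_integral_of_nonneg (μ := μ) (f := fun ω => |X n ω|)
    (Eventually.of_forall fun ω => abs_nonneg _) hn.abs (|K| / δ + 1)
  have hsub : {ω | |K| / δ + 1 < |X n ω|} ⊆ {ω | |K| / δ + 1 ≤ |X n ω|} := by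
    intro ω hω
    simp only [Set.mem_ofPred_eq] at hω ⊢
    exact hω.le
  have h1 := measureReal_mono (μ := μ) hsub
  have h2 : (|K| / δ + 1) * μ.real {ω | |K| / δ + 1 ≤ |X n ω|} ≤ |K| :=
    (hmark.trans hKn).trans (le_abs_self K)
  have h3 : |K| ≤ (|K| / δ + 1) * δ := by
    have : |K| / δ * δ = |K| := by field_simp
    nlinarith
  have h4 := le_of_mul_le_mul_left (h2.trans h3) hpos
  exact h1.trans h4

theorem BddInProb.of_integral_sq_le [IsFiniteMeasure μ] {X : ℕ → Ω → ℝ} (K : ℝ)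
    (hint : ∀ᶠ n in atTop, MemLp (X n) 2 μ)
    (hK : ∀ᶠ n in atTop, ∫ ω, X n ω ^ 2 ∂μ ≤ K) : BddInProb μ X := by
  have h : BddInProb μ (fun n ω => 1 + X n ω ^ 2) := by
    refine (BddInProb.const 1).add (.of_integral_abs_le K ?_ ?_)
    · filter_upwards [hint] with n hn using hn.integrable_sq
    · filter_upwards [hK] with n hn
      simpa only [abs_pow, sq_abs] using hn
  refine h.mono (Eventually.of_forall fun n ω => ?_)
  rw [abs_of_nonneg (a := 1 + X n ω ^ 2) (by positivity), abs_le]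
  constructor <;> nlinarith [sq_nonneg (X n ω - 1), sq_nonneg (X n ω + 1)]

theorem BddInProb.tendsto_measureReal_ge [IsFiniteMeasure μ] {X : ℕ → Ω → ℝ}
    (hX : BddInProb μ X) {c : ℕ → ℝ} (hc : Tendsto c atTop atTop) :
    Tendsto (fun n => μ.real {ω | c n ≤ |X n ω|}) atTop (𝓝 0) := by
  rw [Metric.tendsto_nhds]
  intro δ hδ
  obtain ⟨M, hM, hev⟩ := hX (δ / 2) (half_pos hδ)
  filter_upwards [hev, hc.eventually_gt_atTop M] with n hn hn'
  have hsub : {ω | c n ≤ |X n ω|} ⊆ {ω | M < |X n ω|} := fun ω hω => lt_of_lt_of_le hn' hω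
  have := measureReal_mono (μ := μ) hsub
  rw [Real.dist_eq, sub_zero, abs_of_nonneg measureReal_nonneg]
  linarith

theorem BddInProb.tendstoInMeasure_zero [IsFiniteMeasure μ] {X Y : ℕ → Ω → ℝ}
    (hX : BddInProb μ X) {c : ℕ → ℝ} (hc : Tendsto c atTop (𝓝 0))
    (h : ∀ᶠ n in atTop, ∀ ω, |Y n ω| ≤ c n * |X n ω|) :
    TendstoInMeasure μ Y atTop (fun _ => 0) := by
  rw [tendstoInMeasure_iff_measureReal_norm]
  intro η hη
  -- The summand 1/(n+1) keeps the divisor positive, since `c n` may vanish.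
  have hc' : Tendsto (fun n => η / (|c n| + 1 / ((n : ℝ) + 1))) atTop atTop := by
    refine Tendsto.const_mul_atTop hη (Tendsto.inv_tendsto_nhdsGT_zero ?_)
    refine tendsto_nhdsWithin_iff.2 ⟨?_, Eventually.of_forall fun n => ?_⟩
    · simpa using hc.abs.add tendsto_one_div_add_atTop_nhds_zero_nat
    · have : (0 : ℝ) < 1 / ((n : ℝ) + 1) := by positivity
      exact Set.mem_Ioi.2 (by positivity)
  refine squeeze_zero' (Eventually.of_forall fun n => measureReal_nonneg) ?_
    (hX.tendsto_measureReal_ge hc')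
  filter_upwards [h] with n hn
  refine measureReal_mono fun ω hω => ?_
  have h0 : (0 : ℝ) < 1 / ((n : ℝ) + 1) := by positivity
  have h1 : 0 < |c n| + 1 / ((n : ℝ) + 1) := by positivity
  simp only [sub_zero, Real.norm_eq_abs, Set.mem_ofPred_eq] at hω ⊢
  rw [div_le_iff₀ h1]
  have h2 := hn ω
  have h3 : c n * |X n ω| ≤ (|c n| + 1 / ((n : ℝ) + 1)) * |X n ω| := by
    gcongr
    linarith [le_abs_self (c n)]
  linarith

theorem tendstoInMeasure_add {X Y : ℕ → Ω → ℝ} {a b : ℝ} [IsFiniteMeasure μ]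
    (hX : TendstoInMeasure μ X atTop (fun _ => a)) (hY : TendstoInMeasure μ Y atTop (fun _ => b)) :
    TendstoInMeasure μ (fun n ω => X n ω + Y n ω) atTop (fun _ => a + b) := by
  rw [tendstoInMeasure_iff_measureReal_norm] at *
  intro η hη
  have h := (hX (η / 2) (half_pos hη)).add (hY (η / 2) (half_pos hη))
  rw [add_zero] at h
  refine squeeze_zero (fun n => measureReal_nonneg) (fun n => ?_) h
  refine le_trans (measureReal_mono fun ω hω => ?_) (measureReal_union_le _ _)
  by_contra hc
  simp only [Set.mem_union, Set.mem_ofPred_eq, not_or, not_le, Real.norm_eq_abs] at hc hω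
  have := abs_add_le (X n ω - a) (Y n ω - b)
  rw [show X n ω - a + (Y n ω - b) = X n ω + Y n ω - (a + b) by ring] at this
  linarith

/-- Convergence in probability to a constant is preserved by maps continuous at that constant. -/
theorem tendstoInMeasure_comp_of_continuousAt {E F : Type*} [PseudoMetricSpace E]
    [PseudoMetricSpace F] [IsFiniteMeasure μ] {X : ℕ → Ω → E} {c : E} {f : E → F}
    (hX : TendstoInMeasure μ X atTop (fun _ => c)) (hf : ContinuousAt f c) :
    TendstoInMeasure μ (fun n ω => f (X n ω)) atTop (fun _ => f c) := by
  rw [tendstoInMeasure_iff_measureReal_dist] at *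
  intro η hη
  obtain ⟨δ, hδ, hball⟩ := Metric.continuousAt_iff.1 hf η hη
  refine squeeze_zero (fun n => measureReal_nonneg) (fun n => ?_) (hX δ hδ)
  refine measureReal_mono fun ω hω => ?_
  by_contra hc
  exact absurd (hball (not_le.1 hc)) (not_lt.2 hω)

theorem tendstoInMeasure_pi {ι : Type*} [Fintype ι] {E : ι → Type*} [∀ i, PseudoMetricSpace (E i)]
    [IsFiniteMeasure μ] {X : ℕ → Ω → ∀ i, E i} {c : ∀ i, E i}
    (hX : ∀ i, TendstoInMeasure μ (fun n ω => X n ω i) atTop (fun _ => c i)) :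
    TendstoInMeasure μ X atTop (fun _ => c) := by
  simp only [tendstoInMeasure_iff_measureReal_dist] at *
  intro η hη
  have h := tendsto_finsetSum Finset.univ fun i _ => hX i η hη
  rw [Finset.sum_const_zero] at h
  refine squeeze_zero (fun n => measureReal_nonneg) (fun n => ?_) h
  refine le_trans (measureReal_mono (s₂ := ⋃ i ∈ Finset.univ, {ω | η ≤ dist (X n ω i) (c i)})
    (fun ω hω => ?_) (measure_ne_top _ _)) (measureReal_biUnion_finset_le _ _)
  by_contra hc
  simp only [Finset.mem_univ, Set.iUnion_true, Set.mem_iUnion, Set.mem_ofPred_eq, not_exists,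
    not_le] at hc hω
  exact absurd ((dist_pi_lt_iff hη).2 hc) (not_lt.2 hω)

end BddInProb

/-! ### Geometric decay of the powers of the companion matrix -/

section Companion

attribute [local instance] Matrix.linftyOpNormedRing Matrix.linftyOpNormedAlgebra

/-- The companion matrix of the autoregression with coefficients `a`. -/
def companion {R : Type*} [Zero R] [One R] {p : ℕ} (a : Fin p → R) : Matrix (Fin p) (Fin p) R :=
  Matrix.of fun i j => if (i : ℕ) = 0 then a j else if (j : ℕ) + 1 = i then 1 else 0

theorem companion_mulVec_zero {R : Type*} [CommRing R] {p : ℕ} (a v : Fin p → R) (i : Fin p)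
    (hi : (i : ℕ) = 0) : (companion a).mulVec v i = a ⬝ᵥ v := by
  simp [Matrix.mulVec, companion, hi, dotProduct]

theorem companion_mulVec_succ {R : Type*} [CommRing R] {p : ℕ} (a v : Fin p → R) (i j : Fin p)
    (hi : (j : ℕ) + 1 = i) : (companion a).mulVec v i = v j := by
  have hi0 : (i : ℕ) ≠ 0 := by omega
  simp only [Matrix.mulVec, companion, dotProduct, Matrix.of_apply, if_neg hi0]
  rw [Finset.sum_eq_single j]
  · simp [hi]
  · intro b _ hb
    have : ¬ (b : ℕ) + 1 = i := fun h => hb (Fin.ext (by omega))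
    simp [this]
  · simp

/-- The lower rows force an eigenvector for z to be (1, z⁻¹, z⁻², …) up to scale, and the first row
then says that z⁻¹ is a root of the autoregressive polynomial. If ‖z‖ ≥ 1 this root lies in the
closed unit disc. -/
theorem norm_lt_one_of_mem_spectrum_companion {p : ℕ} {a : Fin p → ℝ} (ha : Stable a) {z : ℂ}
    (hz : z ∈ spectrum ℂ (companion fun i => (a i : ℂ))) : ‖z‖ < 1 := by
  by_contra hcon
  have hz1 : 1 ≤ ‖z‖ := not_lt.1 hcon
  have hz0 : z ≠ 0 := fun h => by simp [h] at hz1; linarith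
  rw [spectrum.mem_iff, Matrix.isUnit_iff_isUnit_det, isUnit_iff_ne_zero, not_not,
    ← Matrix.exists_mulVec_eq_zero_iff] at hz
  obtain ⟨v, hv, hzv⟩ := hz
  have hev : (companion fun i => (a i : ℂ)).mulVec v = z • v := by
    rw [Matrix.sub_mulVec, sub_eq_zero, Algebra.algebraMap_eq_smul_one] at hzv
    simpa [Matrix.smul_mulVec] using hzv.symm
  obtain ⟨i₀, hi₀⟩ := Function.ne_iff.1 hv
  have hp : 0 < p := i₀.pos
  let o : Fin p := ⟨0, hp⟩
  have hgeom : ∀ (k : ℕ) (hk : k < p), v ⟨k, hk⟩ = z⁻¹ ^ k * v o := by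
    intro k
    induction k with
    | zero => intro hk; simp [o]
    | succ k ih =>
      intro hk
      have h1 := companion_mulVec_succ (fun i => (a i : ℂ)) v ⟨k + 1, hk⟩
        ⟨k, by omega⟩ rfl
      rw [hev, ih, Pi.smul_apply, smul_eq_mul] at h1
      rw [pow_succ']
      field_simp at h1 ⊢
      linear_combination h1
  have hvo : v o ≠ 0 := by
    intro h
    apply hi₀
    rw [hgeom i₀ i₀.2, h]
    simp
  have h0 := companion_mulVec_zero (fun i => (a i : ℂ)) v o rfl
  rw [hev, Pi.smul_apply, smul_eq_mul, dotProduct] at h0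
  have hinv : ‖z⁻¹‖ ≤ 1 := by
    rw [norm_inv]
    exact inv_le_one_of_one_le₀ hz1
  apply ha z⁻¹ hinv
  have h2 : ∑ i : Fin p, (a i : ℂ) * z⁻¹ ^ ((i : ℕ) + 1) = z⁻¹ * (z * v o) * (v o)⁻¹ := by
    rw [h0, Finset.mul_sum, Finset.sum_mul]
    refine Finset.sum_congr rfl fun i _ => ?_
    rw [show v i = z⁻¹ ^ (i : ℕ) * v o from hgeom i i.2, pow_succ]
    field_simp
  rw [h2]
  field_simp
  simp

/-- Gelfand's formula: any ρ strictly between the spectral radius and 1 bounds ‖Aᵏ‖ by ρᵏ for large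
k, and the finitely many remaining powers are absorbed into C. -/
theorem exists_norm_pow_le_of_spectrum {p : ℕ} (A : Matrix (Fin p) (Fin p) ℂ)
    (hA : ∀ z ∈ spectrum ℂ A, ‖z‖ < 1) :
    ∃ C ρ : ℝ, 0 ≤ C ∧ 0 < ρ ∧ ρ < 1 ∧ ∀ k : ℕ, ‖A ^ k‖ ≤ C * ρ ^ k := by
  -- For p = 0 the matrix ring is trivial and spectral theory does not apply.
  rcases isEmpty_or_nonempty (Fin p) with hp | hp
  · refine ⟨0, 1 / 2, le_rfl, by norm_num, by norm_num, fun k => ?_⟩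
    rw [Subsingleton.elim (A ^ k) 0]
    simp
  have hcomplete : CompleteSpace (Matrix (Fin p) (Fin p) ℂ) := FiniteDimensional.complete ℂ _
  have hlt : spectralRadius ℂ A < ((1 : NNReal) : ENNReal) :=
    spectrum.spectralRadius_lt_of_forall_lt A fun z hz => by
      rw [← NNReal.coe_lt_coe]
      simpa using hA z hz
  obtain ⟨r, hr, hr1⟩ := ENNReal.lt_iff_exists_nnreal_btwn.1 hlt
  have hr1' : r < 1 := by exact_mod_cast hr1
  have hr0 : 0 < r := by
    rcases eq_zero_or_pos r with h | h
    · rw [h] at hr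
      simp at hr
    · exact h
  have hlim := spectrum.pow_nnnorm_pow_one_div_tendsto_nhds_spectralRadius A
  obtain ⟨N, hN⟩ := eventually_atTop.1 (hlim.eventually (gt_mem_nhds hr))
  have hbig : ∀ k, N + 1 ≤ k → ‖A ^ k‖ ≤ (r : ℝ) ^ k := by
    intro k hk
    have hk0 : (0 : ℝ) < k := by exact_mod_cast (by omega : 0 < k)
    have h1 := (hN k (by omega)).le
    have h2 := ENNReal.rpow_le_rpow h1 hk0.le
    rw [← ENNReal.rpow_mul, one_div, inv_mul_cancel₀ hk0.ne', ENNReal.rpow_one,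
      ENNReal.rpow_natCast, ← ENNReal.coe_pow, ENNReal.coe_le_coe] at h2
    exact_mod_cast h2
  have hterm : ∀ k, 0 ≤ ‖A ^ k‖ / (r : ℝ) ^ k := fun k => by positivity
  refine ⟨1 + ∑ k ∈ Finset.range (N + 1), ‖A ^ k‖ / (r : ℝ) ^ k,
    r, add_nonneg zero_le_one (Finset.sum_nonneg fun k _ => hterm k), by exact_mod_cast hr0,
    by exact_mod_cast hr1', fun k => ?_⟩
  have hrk : (0 : ℝ) < (r : ℝ) ^ k := pow_pos (by exact_mod_cast hr0) k
  rcases lt_or_ge k (N + 1) with hk | hk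
  · have h1 := Finset.single_le_sum (f := fun k => ‖A ^ k‖ / (r : ℝ) ^ k) (fun k _ => hterm k)
      (Finset.mem_range.2 hk)
    have h2 : ‖A ^ k‖ = ‖A ^ k‖ / (r : ℝ) ^ k * (r : ℝ) ^ k := by field_simp
    rw [h2]
    refine mul_le_mul_of_nonneg_right ?_ hrk.le
    linarith
  · refine (hbig k hk).trans (le_mul_of_one_le_left hrk.le ?_)
    linarith [Finset.sum_nonneg fun k (_ : k ∈ Finset.range (N + 1)) => hterm k]

/-- Under stability, the powers of the companion matrix decay geometrically. -/
theorem Stable.exists_norm_companion_pow_mulVec_le {p : ℕ} {a : Fin p → ℝ} (ha : Stable a) :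
    ∃ C ρ : ℝ, 0 ≤ C ∧ 0 < ρ ∧ ρ < 1 ∧
      ∀ (k : ℕ) (v : Fin p → ℝ), ‖((companion a) ^ k).mulVec v‖ ≤ C * ρ ^ k * ‖v‖ := by
  obtain ⟨C, ρ, hC, hρ, hρ1, h⟩ := exists_norm_pow_le_of_spectrum _
    fun z hz => norm_lt_one_of_mem_spectrum_companion ha hz
  refine ⟨C, ρ, hC, hρ, hρ1, fun k v => ?_⟩
  -- The spectral argument lives over ℂ; it transfers because the inclusion of ℝ preserves the sup
  -- norm of vectors and commutes with matrix powers.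
  have hmap : (companion fun i => (a i : ℂ)) = (companion a).map Complex.ofRealHom := by
    ext i j
    simp only [companion, Matrix.of_apply, Matrix.map_apply]
    split_ifs <;> simp
  have hnorm : ∀ w : Fin p → ℝ, ‖(Complex.ofRealHom ∘ w : Fin p → ℂ)‖ = ‖w‖ := by
    intro w
    simp only [Pi.norm_def, Function.comp_apply, Complex.ofRealHom_eq_coe, Complex.nnnorm_real]
  have hvec : ((companion fun i => (a i : ℂ)) ^ k).mulVec (Complex.ofRealHom ∘ v)
      = Complex.ofRealHom ∘ (((companion a) ^ k).mulVec v) := by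
    rw [hmap, ← Matrix.map_pow]
    ext i
    simp [Matrix.mulVec, dotProduct]
  rw [← hnorm, ← hvec, ← hnorm v]
  refine (Matrix.linfty_opNorm_mulVec _ _).trans ?_
  exact mul_le_mul_of_nonneg_right (h k) (norm_nonneg _)

end Companion

/-! ### Algebra of a trajectory of the autoregression -/

section Trajectory

variable {p : ℕ}

theorem abs_dotProduct_le (v w : Fin p → ℝ) : |v ⬝ᵥ w| ≤ p * ‖v‖ * ‖w‖ := by
  unfold dotProduct
  refine (Finset.abs_sum_le_sum_abs _ _).trans ?_
  have h : ∀ i ∈ Finset.univ, |v i * w i| ≤ ‖v‖ * ‖w‖ := fun i _ => by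
    rw [abs_mul]
    exact mul_le_mul (norm_le_pi_norm v i) (norm_le_pi_norm w i) (abs_nonneg _) (norm_nonneg _)
  simpa [mul_assoc] using Finset.sum_le_card_nsmul _ _ _ h

theorem abs_dotProduct_le_sum (v w : Fin p → ℝ) : |v ⬝ᵥ w| ≤ ‖v‖ * ∑ i, |w i| := by
  unfold dotProduct
  refine (Finset.abs_sum_le_sum_abs _ _).trans ?_
  rw [Finset.mul_sum]
  refine Finset.sum_le_sum fun i _ => ?_
  rw [abs_mul]
  exact mul_le_mul_of_nonneg_right (norm_le_pi_norm v i) (abs_nonneg _)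

/-- The first basis vector of `ℝ^p` (which is `0` for `p = 0`). -/
def firstUnit (p : ℕ) : Fin p → ℝ := fun i => if (i : ℕ) = 0 then 1 else 0

theorem norm_firstUnit_le : ‖firstUnit p‖ ≤ 1 := by
  refine (pi_norm_le_iff_of_nonneg zero_le_one).2 fun i => ?_
  unfold firstUnit
  split_ifs <;> simp

theorem lagVec_eq_companion {a : Fin p → ℝ} {x : ℤ → ℝ} {v : ℝ} {t : ℤ}
    (h : x t = a ⬝ᵥ lagVec p x (t - 1) + v) :
    lagVec p x t = (companion a).mulVec (lagVec p x (t - 1)) + v • firstUnit p := by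
  ext i
  rcases eq_or_ne (i : ℕ) 0 with hi | hi
  · rw [Pi.add_apply, companion_mulVec_zero _ _ _ hi]
    simp [lagVec, firstUnit, hi, h]
  · have hj : (i : ℕ) - 1 < p := by omega
    rw [Pi.add_apply, companion_mulVec_succ a _ i ⟨(i : ℕ) - 1, hj⟩ (by simp; omega)]
    simp only [lagVec, firstUnit, hi, Pi.smul_apply, if_false, smul_zero, add_zero]
    congr 1
    omega

/-- Each application of the companion matrix moves the entries down by one place, so Mᵏe₁ ends with
a 1 in position k followed by zeros. Stacked for k < p, these vectors form a unitriangular matrix.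
-/
theorem companion_pow_firstUnit (a : Fin p → ℝ) (k : ℕ) (i : Fin p) (hk : k ≤ i) :
    ((companion a) ^ k).mulVec (firstUnit p) i = if (i : ℕ) = k then 1 else 0 := by
  induction k generalizing i with
  | zero => simp [firstUnit]
  | succ k ih =>
    rw [pow_succ', ← Matrix.mulVec_mulVec,
      companion_mulVec_succ a _ i ⟨(i : ℕ) - 1, by omega⟩ (by simp; omega), ih _ (by simp; omega)]
    simp only
    congr 1
    exact propext ⟨fun h => by omega, fun h => by omega⟩

/-- The vectors `Mᵏ e₁`, for `k < p`, span `ℝ^p`, in a quantitative form. -/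
theorem exists_norm_sq_le_sum_companion (a : Fin p → ℝ) :
    ∃ c : ℝ, 0 < c ∧ ∀ l : Fin p → ℝ,
      c * ‖l‖ ^ 2 ≤ ∑ k ∈ Finset.range p, (l ⬝ᵥ ((companion a) ^ k).mulVec (firstUnit p)) ^ 2 := by
  let W : Matrix (Fin p) (Fin p) ℝ :=
    Matrix.of fun k i => ((companion a) ^ (k : ℕ)).mulVec (firstUnit p) i
  have hdet : W.det = 1 := by
    rw [Matrix.det_of_isLowerTriangular]
    · refine Finset.prod_eq_one fun i _ => ?_
      simp [W, companion_pow_firstUnit a i i le_rfl]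
    · intro i j hij
      have hij' : (i : ℕ) < j := by simpa using hij
      simp only [W, Matrix.of_apply]
      rw [companion_pow_firstUnit a i j hij'.le, if_neg hij'.ne']
  have hinj : LinearMap.ker W.mulVecLin = ⊥ := by
    rw [LinearMap.ker_eq_bot]
    exact Matrix.mulVec_injective_of_isUnit
      ((Matrix.isUnit_iff_isUnit_det _).2 (by rw [hdet]; exact isUnit_one))
  -- An injective linear map in finite dimension is antilipschitz; its constant K gives c = 1/K².
  obtain ⟨K, hK, hanti⟩ := W.mulVecLin.exists_antilipschitzWith hinj
  have hK' : (0 : ℝ) < K := by exact_mod_cast hK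
  refine ⟨1 / (K : ℝ) ^ 2, by positivity, fun l => ?_⟩
  have h1 : ‖l‖ ≤ K * ‖W.mulVec l‖ := by
    simpa using hanti.le_mul_dist l 0
  have h2 : ‖W.mulVec l‖ ^ 2
      ≤ ∑ k ∈ Finset.range p, (l ⬝ᵥ ((companion a) ^ k).mulVec (firstUnit p)) ^ 2 := by
    rw [Finset.sum_range]
    have hnn : 0 ≤ ∑ k : Fin p, (l ⬝ᵥ ((companion a) ^ (k : ℕ)).mulVec (firstUnit p)) ^ 2 :=
      Finset.sum_nonneg fun k _ => sq_nonneg _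
    have h3 : ‖W.mulVec l‖
        ≤ √(∑ k : Fin p, (l ⬝ᵥ ((companion a) ^ (k : ℕ)).mulVec (firstUnit p)) ^ 2) := by
      refine (pi_norm_le_iff_of_nonneg (Real.sqrt_nonneg _)).2 fun i => ?_
      rw [Real.norm_eq_abs]
      refine Real.abs_le_sqrt ?_
      have h4 : W.mulVec l i = l ⬝ᵥ ((companion a) ^ (i : ℕ)).mulVec (firstUnit p) := by
        rw [dotProduct_comm]
        rfl
      rw [h4]
      exact Finset.single_le_sum
        (f := fun k : Fin p => (l ⬝ᵥ ((companion a) ^ (k : ℕ)).mulVec (firstUnit p)) ^ 2)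
        (fun k _ => sq_nonneg _) (Finset.mem_univ i)
    calc ‖W.mulVec l‖ ^ 2 ≤ _ := pow_le_pow_left₀ (norm_nonneg _) h3 2
      _ = _ := Real.sq_sqrt hnn
  have h5 : ‖l‖ ^ 2 ≤ (K * ‖W.mulVec l‖) ^ 2 := pow_le_pow_left₀ (norm_nonneg _) h1 2
  calc 1 / (K : ℝ) ^ 2 * ‖l‖ ^ 2 ≤ 1 / (K : ℝ) ^ 2 * (K * ‖W.mulVec l‖) ^ 2 := by gcongr
    _ = ‖W.mulVec l‖ ^ 2 := by field_simp
    _ ≤ _ := h2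

theorem sum_Icc_sub_one_eq (f : ℤ → ℝ) (n : ℕ) :
    ∑ t ∈ Finset.Icc (1 : ℤ) n, f (t - 1) = ∑ t ∈ Finset.Icc (1 : ℤ) n, f t + f 0 - f n := by
  induction n with
  | zero => simp
  | succ n ih =>
    have h : Finset.Icc (1 : ℤ) ((n + 1 : ℕ) : ℤ)
        = insert ((n + 1 : ℕ) : ℤ) (Finset.Icc (1 : ℤ) n) := by
      ext t
      simp only [Finset.mem_Icc, Finset.mem_insert]
      omega
    have hn : ((n + 1 : ℕ) : ℤ) ∉ Finset.Icc (1 : ℤ) n := by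
      simp
    rw [h, Finset.sum_insert hn, Finset.sum_insert hn, ih]
    push_cast
    simp
    ring

theorem exists_vecMul_companion_norm_le (a : Fin p → ℝ) :
    ∃ β : ℝ, 0 ≤ β ∧ ∀ l : Fin p → ℝ, ‖Matrix.vecMul l (companion a)‖ ≤ β * ‖l‖ := by
  obtain ⟨β, hβ, h⟩ := (LinearMap.toContinuousLinearMap (companion a).vecMulLinear).bound
  exact ⟨β, hβ.le, h⟩

/-- One step of the recursion for the quadratic form `∑ (l ⬝ x̲_{t-1})²`. -/
theorem sum_sq_dotProduct_ge_step (a : Fin p → ℝ) :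
    ∃ C : ℝ, 0 ≤ C ∧ ∀ (n : ℕ) (x u : ℤ → ℝ) (κ : ℝ),
      (∀ t, 1 ≤ t → t ≤ (n : ℤ) → x t = a ⬝ᵥ lagVec p x (t - 1) + u t) →
      (∀ j, |∑ t ∈ Finset.Icc (1 : ℤ) n, u t * lagVec p x (t - 1) j| ≤ κ) →
      ‖lagVec p x n‖ ^ 2 ≤ κ → ∀ l : Fin p → ℝ,
        (l ⬝ᵥ firstUnit p) ^ 2 * ∑ t ∈ Finset.Icc (1 : ℤ) n, u t ^ 2
          + ∑ t ∈ Finset.Icc (1 : ℤ) n, (Matrix.vecMul l (companion a) ⬝ᵥ lagVec p x (t - 1)) ^ 2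
          - C * κ * ‖l‖ ^ 2
        ≤ ∑ t ∈ Finset.Icc (1 : ℤ) n, (l ⬝ᵥ lagVec p x (t - 1)) ^ 2 := by
  obtain ⟨β, hβ, hβl⟩ := exists_vecMul_companion_norm_le a
  -- The first term pays for the cross term 2(l·e₁)∑ u_t (Mᵀl·x̲_{t−1}), the second for the boundary
  -- term (l·x̲_n)².
  refine ⟨2 * p * (β * p) + (p : ℝ) ^ 2, by positivity, ?_⟩
  intro n x u κ har hb hn l
  have hκ : 0 ≤ κ := le_trans (by positivity) hn
  set B := Matrix.vecMul l (companion a) with hB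
  have hstep : ∀ t ∈ Finset.Icc (1 : ℤ) n, (l ⬝ᵥ lagVec p x t) ^ 2
      = (l ⬝ᵥ firstUnit p) ^ 2 * u t ^ 2 + 2 * (l ⬝ᵥ firstUnit p) * (u t * (B ⬝ᵥ lagVec p x (t - 1)))
        + (B ⬝ᵥ lagVec p x (t - 1)) ^ 2 := by
    intro t ht
    rw [Finset.mem_Icc] at ht
    rw [lagVec_eq_companion (har t ht.1 ht.2), dotProduct_add, Matrix.dotProduct_mulVec,
      dotProduct_smul, ← hB, smul_eq_mul]
    ring
  -- Shifting the time index makes the recursion applicable. Of the two boundary terms, (l·x̲_0)²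
  -- has the favourable sign and is dropped; (l·x̲_n)² is bounded through κ.
  have hsum := sum_Icc_sub_one_eq (fun t => (l ⬝ᵥ lagVec p x t) ^ 2) n
  rw [hsum, Finset.sum_congr rfl hstep, Finset.sum_add_distrib, Finset.sum_add_distrib,
    ← Finset.mul_sum, ← Finset.mul_sum]
  have hcross : ∑ t ∈ Finset.Icc (1 : ℤ) n, u t * (B ⬝ᵥ lagVec p x (t - 1))
      = B ⬝ᵥ fun j => ∑ t ∈ Finset.Icc (1 : ℤ) n, u t * lagVec p x (t - 1) j := by
    simp only [dotProduct, Finset.mul_sum]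
    rw [Finset.sum_comm]
    refine Finset.sum_congr rfl fun j _ => Finset.sum_congr rfl fun t _ => by ring
  have h1 : |B ⬝ᵥ fun j => ∑ t ∈ Finset.Icc (1 : ℤ) n, u t * lagVec p x (t - 1) j|
      ≤ (β * p) * ‖l‖ * κ := by
    refine (abs_dotProduct_le _ _).trans ?_
    have h2 : ‖fun j => ∑ t ∈ Finset.Icc (1 : ℤ) n, u t * lagVec p x (t - 1) j‖ ≤ κ :=
      (pi_norm_le_iff_of_nonneg hκ).2 hb
    calc (p : ℝ) * ‖B‖ * _ ≤ p * (β * ‖l‖) * κ := by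
          gcongr
          exact hβl l
      _ = _ := by ring
  have h3 : |l ⬝ᵥ firstUnit p| ≤ p * ‖l‖ := by
    refine (abs_dotProduct_le _ _).trans ?_
    exact mul_le_of_le_one_right (by positivity) norm_firstUnit_le
  have h4 : (l ⬝ᵥ lagVec p x n) ^ 2 ≤ (p : ℝ) ^ 2 * κ * ‖l‖ ^ 2 := by
    rw [← sq_abs]
    calc |l ⬝ᵥ lagVec p x n| ^ 2 ≤ (p * ‖l‖ * ‖lagVec p x n‖) ^ 2 :=
          pow_le_pow_left₀ (abs_nonneg _) (abs_dotProduct_le _ _) 2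
      _ = (p : ℝ) ^ 2 * ‖lagVec p x n‖ ^ 2 * ‖l‖ ^ 2 := by ring
      _ ≤ _ := by gcongr
  rw [hcross]
  have h5 : |l ⬝ᵥ firstUnit p|
        * |B ⬝ᵥ fun j => ∑ t ∈ Finset.Icc (1 : ℤ) n, u t * lagVec p x (t - 1) j|
      ≤ (p * ‖l‖) * ((β * p) * ‖l‖ * κ) := by gcongr
  rw [← abs_mul] at h5
  have h6 := (abs_le.1 h5).1
  have h7 := sq_nonneg (l ⬝ᵥ lagVec p x 0)
  nlinarith

/-- Lower bound for the quadratic form `∑ (l ⬝ x̲_{t-1})²`. -/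
theorem sum_sq_dotProduct_ge (a : Fin p → ℝ) :
    ∃ c C : ℝ, 0 < c ∧ 0 ≤ C ∧ ∀ (n : ℕ) (x u : ℤ → ℝ) (κ : ℝ),
      (∀ t, 1 ≤ t → t ≤ (n : ℤ) → x t = a ⬝ᵥ lagVec p x (t - 1) + u t) →
      (∀ j, |∑ t ∈ Finset.Icc (1 : ℤ) n, u t * lagVec p x (t - 1) j| ≤ κ) →
      ‖lagVec p x n‖ ^ 2 ≤ κ → ∀ l : Fin p → ℝ,
        (c * (∑ t ∈ Finset.Icc (1 : ℤ) n, u t ^ 2) - C * κ) * ‖l‖ ^ 2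
        ≤ ∑ t ∈ Finset.Icc (1 : ℤ) n, (l ⬝ᵥ lagVec p x (t - 1)) ^ 2 := by
  obtain ⟨C, hC, hstep⟩ := sum_sq_dotProduct_ge_step a
  obtain ⟨β, hβ, hβl⟩ := exists_vecMul_companion_norm_le a
  obtain ⟨c, hc, hcl⟩ := exists_norm_sq_le_sum_companion a
  -- After k substitutions the released terms are (l·Mⁱe₁)² ∑ u_t² for i < k.
  have hiter : ∀ k : ℕ, ∃ D : ℝ, 0 ≤ D ∧ ∀ (n : ℕ) (x u : ℤ → ℝ) (κ : ℝ),
      (∀ t, 1 ≤ t → t ≤ (n : ℤ) → x t = a ⬝ᵥ lagVec p x (t - 1) + u t) →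
      (∀ j, |∑ t ∈ Finset.Icc (1 : ℤ) n, u t * lagVec p x (t - 1) j| ≤ κ) →
      ‖lagVec p x n‖ ^ 2 ≤ κ → ∀ l : Fin p → ℝ,
        (∑ i ∈ Finset.range k, (l ⬝ᵥ ((companion a) ^ i).mulVec (firstUnit p)) ^ 2)
            * (∑ t ∈ Finset.Icc (1 : ℤ) n, u t ^ 2) - D * κ * ‖l‖ ^ 2
        ≤ ∑ t ∈ Finset.Icc (1 : ℤ) n, (l ⬝ᵥ lagVec p x (t - 1)) ^ 2 := by
    intro k
    induction k with
    | zero =>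
      refine ⟨0, le_rfl, fun n x u κ _ _ _ l => ?_⟩
      simp only [Finset.range_zero, Finset.sum_empty, zero_mul, sub_zero]
      exact Finset.sum_nonneg fun t _ => sq_nonneg _
    | succ k ih =>
      obtain ⟨D, hD, ih⟩ := ih
      -- The induction hypothesis is used at Mᵀl, whose norm is at most β‖l‖; this is the source of
      -- β².
      refine ⟨C + D * β ^ 2, by positivity, fun n x u κ har hb hn l => ?_⟩
      have hκ : 0 ≤ κ := le_trans (by positivity) hn
      have h1 := hstep n x u κ har hb hn l
      have h2 := ih n x u κ har hb hn (Matrix.vecMul l (companion a))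
      have h3 : ‖Matrix.vecMul l (companion a)‖ ^ 2 ≤ β ^ 2 * ‖l‖ ^ 2 := by
        rw [← mul_pow]
        exact pow_le_pow_left₀ (norm_nonneg _) (hβl l) 2
      have h4 : D * κ * ‖Matrix.vecMul l (companion a)‖ ^ 2 ≤ D * κ * (β ^ 2 * ‖l‖ ^ 2) := by gcongr
      rw [Finset.sum_range_succ']
      have h5 : ∀ i, Matrix.vecMul l (companion a) ⬝ᵥ ((companion a) ^ i).mulVec (firstUnit p)
          = l ⬝ᵥ ((companion a) ^ (i + 1)).mulVec (firstUnit p) := by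
        intro i
        rw [← Matrix.dotProduct_mulVec, Matrix.mulVec_mulVec, ← pow_succ']
      simp only [h5] at h2
      simp only [pow_zero, Matrix.one_mulVec]
      nlinarith
  obtain ⟨D, hD, h⟩ := hiter p
  refine ⟨c, D, hc, hD, fun n x u κ har hb hn l => le_trans ?_ (h n x u κ har hb hn l)⟩
  have hU : 0 ≤ ∑ t ∈ Finset.Icc (1 : ℤ) n, u t ^ 2 := Finset.sum_nonneg fun t _ => sq_nonneg _
  have := mul_le_mul_of_nonneg_right (hcl l) hU
  nlinarith

theorem residual_eq {a : Fin p → ℝ} {x : ℤ → ℝ} {v : ℝ} {t : ℤ} (ht : 1 ≤ t)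
    (h : x t = a ⬝ᵥ lagVec p x (t - 1) + v) (θ : Fin p → ℝ) :
    residual x θ t = v - (θ - a) ⬝ᵥ lagVec p x (t - 1) := by
  rw [residual, if_neg (by omega), h, sub_dotProduct]
  ring

/-- The normal equations read (θ̂ − a)A = b with A the weighted Gram matrix. Pairing them with θ̂ −
a and using coercivity gives c‖θ̂ − a‖² ≤ ‖θ̂ − a‖ ∑|b_j|. Coercivity also makes A invertible, so
the inverse in `gls` is a true inverse. -/
theorem norm_gls_sub_le {n : ℕ} {h x u : ℤ → ℝ} {a : Fin p → ℝ} {c : ℝ} (hc : 0 < c)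
    (har : ∀ t, 1 ≤ t → t ≤ (n : ℤ) → x t = a ⬝ᵥ lagVec p x (t - 1) + u t)
    (hquad : ∀ l : Fin p → ℝ,
      c * ‖l‖ ^ 2 ≤ ∑ t ∈ Finset.Icc (1 : ℤ) n, (h t ^ 2)⁻¹ * (l ⬝ᵥ lagVec p x (t - 1)) ^ 2) :
    c * ‖gls p n h x - a‖
      ≤ ∑ j, |∑ t ∈ Finset.Icc (1 : ℤ) n, (h t ^ 2)⁻¹ * u t * lagVec p x (t - 1) j| := by
  set A : Matrix (Fin p) (Fin p) ℝ := ∑ t ∈ Finset.Icc (1 : ℤ) n,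
      (h t ^ 2)⁻¹ • Matrix.vecMulVec (lagVec p x (t - 1)) (lagVec p x (t - 1)) with hA
  set b : Fin p → ℝ := fun j => ∑ t ∈ Finset.Icc (1 : ℤ) n,
      (h t ^ 2)⁻¹ * u t * lagVec p x (t - 1) j with hb
  have hvA : ∀ l, Matrix.vecMul l A = ∑ t ∈ Finset.Icc (1 : ℤ) n,
      ((h t ^ 2)⁻¹ * (l ⬝ᵥ lagVec p x (t - 1))) • lagVec p x (t - 1) := by
    intro l
    rw [hA, Matrix.vecMul_sum]
    refine Finset.sum_congr rfl fun t _ => ?_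
    rw [Matrix.vecMul_smul, Matrix.vecMul_vecMulVec]
    ext i
    simp [mul_assoc]
  have hquadA : ∀ l, c * ‖l‖ ^ 2 ≤ Matrix.vecMul l A ⬝ᵥ l := by
    intro l
    refine (hquad l).trans_eq ?_
    rw [hvA, sum_dotProduct]
    refine Finset.sum_congr rfl fun t _ => ?_
    rw [smul_dotProduct, smul_eq_mul, dotProduct_comm (lagVec p x (t - 1)) l]
    ring
  have hdet : IsUnit A.det := by
    rw [isUnit_iff_ne_zero]
    intro h0
    obtain ⟨v, hv, hv0⟩ := Matrix.exists_vecMul_eq_zero_iff.2 h0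
    have h1 := hquadA v
    rw [hv0, zero_dotProduct] at h1
    have h2 : 0 < ‖v‖ := norm_pos_iff.2 hv
    nlinarith [mul_pos hc (pow_pos h2 2)]
  have hnum : ∑ t ∈ Finset.Icc (1 : ℤ) n, ((h t ^ 2)⁻¹ * x t) • lagVec p x (t - 1)
      = Matrix.vecMul a A + b := by
    rw [hvA]
    ext j
    rw [Pi.add_apply, hb, Finset.sum_apply, Finset.sum_apply, ← Finset.sum_add_distrib]
    refine Finset.sum_congr rfl fun t ht => ?_
    rw [Finset.mem_Icc] at ht
    simp only [Pi.smul_apply, smul_eq_mul]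
    rw [har t ht.1 ht.2]
    ring
  have hgls : Matrix.vecMul (gls p n h x - a) A = b := by
    have : gls p n h x = Matrix.vecMul (Matrix.vecMul a A + b) A⁻¹ := by
      rw [← hnum]
      rfl
    rw [this, Matrix.sub_vecMul, Matrix.vecMul_vecMul, Matrix.nonsing_inv_mul A hdet,
      Matrix.vecMul_one]
    simp
  have h1 := hquadA (gls p n h x - a)
  rw [hgls, dotProduct_comm] at h1
  have h2 := h1.trans ((le_abs_self _).trans (abs_dotProduct_le_sum _ _))
  rcases eq_or_lt_of_le (norm_nonneg (gls p n h x - a)) with h0 | h0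
  · rw [← h0, mul_zero]
    exact Finset.sum_nonneg fun j _ => abs_nonneg _
  · nlinarith

end Trajectory

/-! ### Deterministic expansion of the score and of the empirical moments -/

section Expansion

variable {p : ℕ}

/-- The dominating weight in the expansions of the statistics. -/
def weight (p : ℕ) (e x : ℤ → ℝ) (t : ℤ) : ℝ := 1 + e t ^ 4 + ‖lagVec p x (t - 1)‖ ^ 4

theorem weight_nonneg (e x : ℤ → ℝ) (t : ℤ) : 0 ≤ weight p e x t := by
  unfold weight
  positivity

theorem sq_mul_sq_le_half (a b : ℝ) : a ^ 2 * b ^ 2 ≤ (a ^ 4 + b ^ 4) / 2 := by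
  nlinarith [sq_nonneg (a ^ 2 - b ^ 2)]

/-- Second-order remainder bound for a summand of the score. -/
theorem abs_score_remainder_le {c H Δ e f h k d d' y z W W' : ℝ} (hc : 0 < c) (hΔ : 0 ≤ Δ)
    (hh : c ≤ h) (hk : |k| ≤ H) (hhH : |h| ≤ H) (hd : |d| ≤ Δ * y) (hd' : |d'| ≤ Δ * z)
    (hy : 0 ≤ y) (hz : 0 ≤ z) (hW : W = 1 + e ^ 4 + y ^ 4) (hW' : W' = 1 + f ^ 4 + z ^ 4) :
    |((h * e - d) ^ 2 / h ^ 2 - 1) * ((k * f - d') ^ 2 / h ^ 2)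
        - (e ^ 2 - 1) * (k ^ 2 * f ^ 2 / h ^ 2)
        + 2 * ((e ^ 2 - 1) * (k / h ^ 2) * f * d') + 2 * (e * (k ^ 2 / h ^ 3) * f ^ 2 * d)|
      ≤ (1 / c ^ 2 + (5 * H ^ 2 + 2) / c ^ 4) * (Δ ^ 2 * (1 + Δ) ^ 2) * (W + W') := by
  have hh0 : 0 < h := lt_of_lt_of_le hc hh
  have hH : 0 ≤ H := le_trans (abs_nonneg _) hk
  -- Once the constant and linear parts are removed, every term left has at least two factors among
  -- d and d'.
  have hcalc : ((h * e - d) ^ 2 / h ^ 2 - 1) * ((k * f - d') ^ 2 / h ^ 2)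
        - (e ^ 2 - 1) * (k ^ 2 * f ^ 2 / h ^ 2)
        + 2 * ((e ^ 2 - 1) * (k / h ^ 2) * f * d') + 2 * (e * (k ^ 2 / h ^ 3) * f ^ 2 * d)
      = (1 / h ^ 2) * ((e ^ 2 - 1) * d' ^ 2)
        + (1 / h ^ 4) * (d ^ 2 * (k * f) ^ 2 + (-2 * (h * e) * d + d ^ 2) *
          (-2 * (k * f) * d' + d' ^ 2)) := by
    field_simp
    ring
  rw [hcalc]
  have hW0 : 0 ≤ W := by rw [hW]; positivity
  have hW0' : 0 ≤ W' := by rw [hW']; positivity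
  have hi2 : 1 / h ^ 2 ≤ 1 / c ^ 2 := by gcongr
  have hi4 : 1 / h ^ 4 ≤ 1 / c ^ 4 := by gcongr
  have hd2 : d ^ 2 ≤ Δ ^ 2 * y ^ 2 := by
    rw [← mul_pow, ← sq_abs]
    exact pow_le_pow_left₀ (abs_nonneg _) hd 2
  have hd2' : d' ^ 2 ≤ Δ ^ 2 * z ^ 2 := by
    rw [← mul_pow, ← sq_abs]
    exact pow_le_pow_left₀ (abs_nonneg _) hd' 2
  -- No smallness of Δ is assumed; the factor (1 + Δ)² absorbs the powers of Δ above the second.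
  have hone : Δ ^ 2 ≤ Δ ^ 2 * (1 + Δ) ^ 2 := by
    refine le_mul_of_one_le_right (by positivity) ?_
    nlinarith
  have h1 : |(e ^ 2 - 1) * d' ^ 2| ≤ Δ ^ 2 * (1 + Δ) ^ 2 * (W + W') := by
    rw [abs_mul, abs_of_nonneg (sq_nonneg d')]
    have ha : |e ^ 2 - 1| ≤ e ^ 2 + 1 := by
      rw [abs_le]
      constructor <;> linarith [sq_nonneg e]
    calc |e ^ 2 - 1| * d' ^ 2 ≤ (e ^ 2 + 1) * (Δ ^ 2 * z ^ 2) := by gcongr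
      _ = Δ ^ 2 * ((e ^ 2 + 1) * z ^ 2) := by ring
      _ ≤ Δ ^ 2 * (W + W') := by
          gcongr
          have h1 := sq_mul_sq_le_half e z
          have h2 := sq_mul_sq_le_half 1 z
          have h3 : 0 ≤ e ^ 4 := by positivity
          have h4 : 0 ≤ f ^ 4 := by positivity
          rw [hW, hW']
          linarith [pow_nonneg hy 4, pow_nonneg hz 4]
      _ ≤ _ := by gcongr
  have h2 : |d ^ 2 * (k * f) ^ 2| ≤ H ^ 2 * (Δ ^ 2 * (1 + Δ) ^ 2 * (W + W')) := by
    rw [abs_of_nonneg (by positivity)]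
    have hk2 : k ^ 2 ≤ H ^ 2 := by
      rw [← sq_abs]
      exact pow_le_pow_left₀ (abs_nonneg _) hk 2
    calc d ^ 2 * (k * f) ^ 2 = d ^ 2 * (k ^ 2 * f ^ 2) := by ring
      _ ≤ (Δ ^ 2 * y ^ 2) * (H ^ 2 * f ^ 2) := by gcongr
      _ = H ^ 2 * (Δ ^ 2 * (y ^ 2 * f ^ 2)) := by ring
      _ ≤ H ^ 2 * (Δ ^ 2 * (W + W')) := by
          gcongr
          have h1 := sq_mul_sq_le_half y f
          have h3 : 0 ≤ e ^ 4 := by positivity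
          have h4 : 0 ≤ f ^ 4 := by positivity
          rw [hW, hW']
          linarith [pow_nonneg hy 4, pow_nonneg hz 4]
      _ ≤ _ := by gcongr
  -- One square estimate serves both increments, at time t and at the lagged time; their product is
  -- then bounded by 2ab ≤ a² + b².
  have hlin : ∀ g v d y W : ℝ, |g| ≤ H → |d| ≤ Δ * y → 0 ≤ y → W = 1 + v ^ 4 + y ^ 4 →
      (-2 * (g * v) * d + d ^ 2) ^ 2 ≤ Δ ^ 2 * (1 + Δ) ^ 2 * ((4 * H ^ 2 + 2) * W) := by
    intro g v d y W hg hd hy hW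
    have habs : |-2 * (g * v) * d + d ^ 2| ≤ Δ * (1 + Δ) * (2 * H * |v| * y + y ^ 2) := by
      have hb : |-2 * (g * v) * d + d ^ 2| ≤ 2 * (|g| * |v|) * |d| + |d| ^ 2 := by
        refine (abs_add_le _ _).trans_eq ?_
        simp [abs_mul]
      refine hb.trans ?_
      calc 2 * (|g| * |v|) * |d| + |d| ^ 2 ≤ 2 * (H * |v|) * (Δ * y) + (Δ * y) ^ 2 := by gcongr
        _ = Δ * (1 * (2 * H * |v| * y) + Δ * y ^ 2) := by ring
        _ ≤ Δ * ((1 + Δ) * (2 * H * |v| * y) + (1 + Δ) * y ^ 2) := by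
            gcongr <;> linarith
        _ = _ := by ring
    calc (-2 * (g * v) * d + d ^ 2) ^ 2 = |-2 * (g * v) * d + d ^ 2| ^ 2 := (sq_abs _).symm
      _ ≤ (Δ * (1 + Δ) * (2 * H * |v| * y + y ^ 2)) ^ 2 :=
          pow_le_pow_left₀ (abs_nonneg _) habs 2
      _ = Δ ^ 2 * (1 + Δ) ^ 2 * (2 * H * |v| * y + y ^ 2) ^ 2 := by ring
      _ ≤ _ := by
          gcongr
          have h3 : (2 * H * |v| * y + y ^ 2) ^ 2
              ≤ 2 * ((2 * H * |v| * y) ^ 2 + (y ^ 2) ^ 2) := by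
            have := two_mul_le_add_sq (2 * H * |v| * y) (y ^ 2)
            rw [add_sq]
            linarith
          have h4 : (2 * H * |v| * y) ^ 2 = 4 * H ^ 2 * (v ^ 2 * y ^ 2) := by
            rw [mul_pow, mul_pow, mul_pow, sq_abs]
            ring
          have h5 : 4 * H ^ 2 * (v ^ 2 * y ^ 2) ≤ 4 * H ^ 2 * ((v ^ 4 + y ^ 4) / 2) := by
            gcongr
            exact sq_mul_sq_le_half v y
          have hv4 : 0 ≤ v ^ 4 := by positivity
          rw [h4] at h3
          rw [hW]
          linarith [sq_nonneg H, pow_nonneg hy 4]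
  have h3 : |(-2 * (h * e) * d + d ^ 2) * (-2 * (k * f) * d' + d' ^ 2)|
      ≤ (4 * H ^ 2 + 2) * (Δ ^ 2 * (1 + Δ) ^ 2 * (W + W')) := by
    have ha := hlin h e d y W hhH hd hy hW
    have hb := hlin k f d' z W' hk hd' hz hW'
    rw [← sq_abs] at ha hb
    rw [abs_mul]
    have h4 := two_mul_le_add_sq |-2 * (h * e) * d + d ^ 2| |-2 * (k * f) * d' + d' ^ 2|
    have h5 : 0 ≤ Δ ^ 2 * (1 + Δ) ^ 2 * ((4 * H ^ 2 + 2) * W) := by positivity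
    have h6 : 0 ≤ Δ ^ 2 * (1 + Δ) ^ 2 * ((4 * H ^ 2 + 2) * W') := by positivity
    have h7 : (4 * H ^ 2 + 2) * (Δ ^ 2 * (1 + Δ) ^ 2 * (W + W'))
        = Δ ^ 2 * (1 + Δ) ^ 2 * ((4 * H ^ 2 + 2) * W)
          + Δ ^ 2 * (1 + Δ) ^ 2 * ((4 * H ^ 2 + 2) * W') := by ring
    rw [h7]
    linarith
  set G := Δ ^ 2 * (1 + Δ) ^ 2 * (W + W') with hG
  have hG0 : 0 ≤ G := by positivity
  have h4 : |d ^ 2 * (k * f) ^ 2 + (-2 * (h * e) * d + d ^ 2) * (-2 * (k * f) * d' + d' ^ 2)|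
      ≤ (5 * H ^ 2 + 2) * G := by
    refine (abs_add_le _ _).trans ((add_le_add h2 h3).trans_eq ?_)
    ring
  calc |(1 / h ^ 2) * ((e ^ 2 - 1) * d' ^ 2) + (1 / h ^ 4) * (d ^ 2 * (k * f) ^ 2 +
          (-2 * (h * e) * d + d ^ 2) * (-2 * (k * f) * d' + d' ^ 2))|
      ≤ (1 / h ^ 2) * G + (1 / h ^ 4) * ((5 * H ^ 2 + 2) * G) := by
        refine (abs_add_le _ _).trans ?_
        rw [abs_mul (1 / h ^ 2), abs_mul (1 / h ^ 4), abs_of_nonneg (a := 1 / h ^ 2) (by positivity),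
          abs_of_nonneg (a := 1 / h ^ 4) (by positivity)]
        gcongr
    _ ≤ (1 / c ^ 2) * G + (1 / c ^ 4) * ((5 * H ^ 2 + 2) * G) := by gcongr
    _ = _ := by
        rw [hG]
        ring

theorem sum_Icc_lag_le {f : ℤ → ℝ} (hf : ∀ t, 0 ≤ f t) (n l : ℕ) :
    ∑ t ∈ (Finset.Icc (1 : ℤ) n).filter (fun t => (l : ℤ) < t), f (t - l)
      ≤ ∑ t ∈ Finset.Icc (1 : ℤ) n, f t := by
  have hinj : Set.InjOn (fun t : ℤ => t - l)
      ((Finset.Icc (1 : ℤ) n).filter fun t => (l : ℤ) < t) := fun s _ t _ h => by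
    simpa using h
  rw [← Finset.sum_image (f := f) (g := fun t : ℤ => t - l) hinj]
  refine Finset.sum_le_sum_of_subset_of_nonneg (fun t ht => ?_) fun t _ _ => hf t
  simp only [Finset.mem_image, Finset.mem_filter, Finset.mem_Icc] at ht ⊢
  obtain ⟨s, hs, rfl⟩ := ht
  omega

/-- Expansion of the score around the true autoregressive coefficients. -/
theorem abs_score_sub_le {m n : ℕ} {h x e : ℤ → ℝ} {a θ : Fin p → ℝ} {c H : ℝ} (hc : 0 < c)
    (hh : ∀ t, 1 ≤ t → t ≤ (n : ℤ) → c ≤ h t ∧ h t ≤ H)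
    (har : ∀ t, 1 ≤ t → t ≤ (n : ℤ) → x t = a ⬝ᵥ lagVec p x (t - 1) + h t * e t) (i : Fin m)
    (l : ℕ) (hl : l = (i : ℕ) + 1) :
    |2 * √(n : ℝ) * score m n h x θ i - ∑ t ∈ Finset.Icc (1 : ℤ) n,
        (e t ^ 2 - 1) * (if (l : ℤ) < t then h (t - l) ^ 2 / h t ^ 2 else 0) * e (t - l) ^ 2|
      ≤ ‖θ - a‖ * (2 * ∑ j, |∑ t ∈ Finset.Icc (1 : ℤ) n, (e t ^ 2 - 1) *
            ((if (l : ℤ) < t then h (t - l) / h t ^ 2 else 0) * e (t - l) ^ 1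
              * lagVec p x (t - 1 - l) j)|
          + 2 * ∑ j, |∑ t ∈ Finset.Icc (1 : ℤ) n, e t *
            ((if (l : ℤ) < t then h (t - l) ^ 2 / h t ^ 3 else 0) * e (t - l) ^ 2
              * lagVec p x (t - 1) j)|)
        + (1 / c ^ 2 + (5 * H ^ 2 + 2) / c ^ 4) * ((p * ‖θ - a‖) ^ 2 * (1 + p * ‖θ - a‖) ^ 2)
          * (2 * ∑ t ∈ Finset.Icc (1 : ℤ) n, weight p e x t) := by
  rcases Nat.eq_zero_or_pos n with rfl | hn
  · simp
  have hn' : √(n : ℝ) ≠ 0 := by positivity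
  set δ := θ - a with hδ
  set Δ := (p : ℝ) * ‖δ‖ with hΔ
  have hΔ0 : 0 ≤ Δ := by positivity
  set K := (1 / c ^ 2 + (5 * H ^ 2 + 2) / c ^ 4) * (Δ ^ 2 * (1 + Δ) ^ 2) with hK
  have hpos : ∀ t ∈ Finset.Icc (1 : ℤ) n, h t ≠ 0 := fun t ht => by
    rw [Finset.mem_Icc] at ht
    exact (hc.trans_le (hh t ht.1 ht.2).1).ne'
  -- The difference θ − a must leave the sum: at θ = θ̂ it depends on the whole sample, and only the
  -- sums without it have a martingale structure.
  have hlin : ∀ (w : ℤ → ℝ) (r : ℤ),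
      |∑ t ∈ Finset.Icc (1 : ℤ) n, w t * (δ ⬝ᵥ lagVec p x (t - 1 - r))|
        ≤ ‖δ‖ * ∑ j, |∑ t ∈ Finset.Icc (1 : ℤ) n, w t * lagVec p x (t - 1 - r) j| := by
    intro w r
    refine le_trans (le_of_eq ?_) (abs_dotProduct_le_sum δ _)
    congr 1
    simp only [dotProduct, Finset.mul_sum]
    rw [Finset.sum_comm]
    exact Finset.sum_congr rfl fun j _ => Finset.sum_congr rfl fun t _ => by ring
  have h1 := hlin (fun t => (e t ^ 2 - 1) * ((if (l : ℤ) < t then h (t - l) / h t ^ 2 else 0) *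
    e (t - l) ^ 1)) l
  have h2 := hlin (fun t => e t * ((if (l : ℤ) < t then h (t - l) ^ 2 / h t ^ 3 else 0) *
    e (t - l) ^ 2)) 0
  simp only [sub_zero] at h2
  have hscore : 2 * √(n : ℝ) * score m n h x θ i = ∑ t ∈ Finset.Icc (1 : ℤ) n,
      (residual x θ t ^ 2 / h t ^ 2 - 1) * (residual x θ (t - l) ^ 2 / h t ^ 2) := by
    rw [score_eq h x θ hpos i, hl]
    push_cast
    field_simp
  rw [hscore]
  have hrem : ∀ t ∈ Finset.Icc (1 : ℤ) n,
      |(residual x θ t ^ 2 / h t ^ 2 - 1) * (residual x θ (t - l) ^ 2 / h t ^ 2)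
        - (e t ^ 2 - 1) * (if (l : ℤ) < t then h (t - l) ^ 2 / h t ^ 2 else 0) * e (t - l) ^ 2
        + 2 * ((e t ^ 2 - 1) * ((if (l : ℤ) < t then h (t - l) / h t ^ 2 else 0) * e (t - l) ^ 1)
            * (δ ⬝ᵥ lagVec p x (t - 1 - l)))
        + 2 * (e t * ((if (l : ℤ) < t then h (t - l) ^ 2 / h t ^ 3 else 0) * e (t - l) ^ 2)
            * (δ ⬝ᵥ lagVec p x (t - 1)))|
      ≤ if (l : ℤ) < t then K * (weight p e x t + weight p e x (t - l)) else 0 := by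
    intro t ht
    rw [Finset.mem_Icc] at ht
    split_ifs with hlt
    · have hs1 : 1 ≤ t - l := by omega
      have hs2 : t - (l : ℤ) ≤ n := by omega
      rw [residual_eq ht.1 (har t ht.1 ht.2), residual_eq hs1 (har _ hs1 hs2)]
      have hb := abs_score_remainder_le (c := c) (H := H) (Δ := Δ) (e := e t) (f := e (t - l))
        (h := h t) (k := h (t - l)) (d := δ ⬝ᵥ lagVec p x (t - 1))
        (d' := δ ⬝ᵥ lagVec p x (t - l - 1)) (y := ‖lagVec p x (t - 1)‖)
        (z := ‖lagVec p x (t - l - 1)‖) (W := weight p e x t) (W' := weight p e x (t - l))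
        hc hΔ0 (hh t ht.1 ht.2).1
        (by rw [abs_of_pos (hc.trans_le (hh _ hs1 hs2).1)]; exact (hh _ hs1 hs2).2)
        (by rw [abs_of_pos (hc.trans_le (hh _ ht.1 ht.2).1)]; exact (hh _ ht.1 ht.2).2)
        (abs_dotProduct_le _ _) (abs_dotProduct_le _ _) (norm_nonneg _) (norm_nonneg _) rfl rfl
      refine le_trans (le_of_eq ?_) hb
      rw [show t - 1 - (l : ℤ) = t - l - 1 by ring]
      congr 1
      ring
    -- For t ≤ l the lagged residual is 0 by definition, which matches the value 0 given to the
    -- weights there.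
    · have : residual x θ (t - l) = 0 := by rw [residual, if_pos (by omega)]
      simp [this]
  have hsumrem : ∑ t ∈ Finset.Icc (1 : ℤ) n,
      (if (l : ℤ) < t then K * (weight p e x t + weight p e x (t - l)) else 0)
      ≤ K * (2 * ∑ t ∈ Finset.Icc (1 : ℤ) n, weight p e x t) := by
    rw [← Finset.sum_filter, ← Finset.mul_sum, Finset.sum_add_distrib, two_mul]
    have hK0 : 0 ≤ K := by positivity
    refine mul_le_mul_of_nonneg_left (add_le_add ?_ ?_) hK0
    · exact Finset.sum_le_sum_of_subset_of_nonneg (Finset.filter_subset _ _)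
        fun t _ _ => weight_nonneg e x t
    · exact sum_Icc_lag_le (weight_nonneg e x) n l
  have hall := (Finset.abs_sum_le_sum_abs _ _).trans ((Finset.sum_le_sum hrem).trans hsumrem)
  rw [Finset.sum_add_distrib, Finset.sum_add_distrib, Finset.sum_sub_distrib, ← Finset.mul_sum,
    ← Finset.mul_sum] at hall
  have h1' := abs_le.1 h1
  have h2' := abs_le.1 h2
  simp only [mul_assoc] at hall h1' h2' ⊢
  have hall' := abs_le.1 hall
  rw [abs_le]
  simp only [mul_add]
  constructor <;> linarith [h1'.1, h1'.2, h2'.1, h2'.2, hall'.1, hall'.2]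

/-- Binomial expansion: each monomial of degree four in |e| and y is at most e⁴ + y⁴, each power Δʲ
with 1 ≤ j ≤ 4 is at most Δ(1 + Δ)³, and 15 = 4 + 6 + 4 + 1. -/
theorem abs_sub_pow_four_sub_le {Δ e v y : ℝ} (hΔ : 0 ≤ Δ) (hy : 0 ≤ y) (hv : |v| ≤ Δ * y) :
    |(e - v) ^ 4 - e ^ 4| ≤ 15 * (Δ * (1 + Δ) ^ 3) * (1 + e ^ 4 + y ^ 4) := by
  have h0 : (e - v) ^ 4 - e ^ 4 = -4 * e ^ 3 * v + 6 * e ^ 2 * v ^ 2 - 4 * e * v ^ 3 + v ^ 4 := by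
    ring
  have h1 : |(e - v) ^ 4 - e ^ 4|
      ≤ 4 * |e| ^ 3 * |v| + 6 * |e| ^ 2 * |v| ^ 2 + 4 * |e| * |v| ^ 3 + |v| ^ 4 := by
    rw [h0]
    refine (abs_add_le _ _).trans (add_le_add ((abs_sub _ _).trans (add_le_add
      ((abs_add_le _ _).trans (add_le_add ?_ ?_)) ?_)) ?_) <;> simp [abs_mul]
  set E := |e| with hE
  have hE0 : 0 ≤ E := abs_nonneg _
  have h2 : 4 * E ^ 3 * |v| + 6 * E ^ 2 * |v| ^ 2 + 4 * E * |v| ^ 3 + |v| ^ 4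
      ≤ 4 * E ^ 3 * (Δ * y) + 6 * E ^ 2 * (Δ * y) ^ 2 + 4 * E * (Δ * y) ^ 3 + (Δ * y) ^ 4 := by
    gcongr
  have he4 : e ^ 4 = E ^ 4 := by rw [hE]; exact (Even.pow_abs (by decide) e).symm
  have hyE : E ≤ E + y := by linarith
  have hyy : y ≤ E + y := by linarith
  have hA : E ^ 3 * y ≤ E ^ 4 + y ^ 4 := by
    rcases le_total E y with h | h
    · nlinarith [pow_le_pow_left₀ hE0 h 3, pow_nonneg hE0 4]
    · nlinarith [mul_le_mul_of_nonneg_left h (pow_nonneg hE0 3), pow_nonneg hy 4]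
  have hB : E ^ 2 * y ^ 2 ≤ E ^ 4 + y ^ 4 := by
    nlinarith [sq_mul_sq_le_half E y, pow_nonneg hE0 4, pow_nonneg hy 4]
  have hC : E * y ^ 3 ≤ E ^ 4 + y ^ 4 := by
    rcases le_total E y with h | h
    · nlinarith [mul_le_mul_of_nonneg_right h (pow_nonneg hy 3), pow_nonneg hE0 4]
    · nlinarith [pow_le_pow_left₀ hy h 3, pow_nonneg hy 4,
        mul_le_mul_of_nonneg_left (pow_le_pow_left₀ hy h 3) hE0]
  have hD : y ^ 4 ≤ E ^ 4 + y ^ 4 := by linarith [pow_nonneg hE0 4]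
  have k1 : Δ ≤ Δ * (1 + Δ) ^ 3 :=
    le_mul_of_one_le_right hΔ (one_le_pow₀ (by linarith))
  have k2 : Δ ^ 2 ≤ Δ * (1 + Δ) ^ 3 := by
    nlinarith [mul_nonneg hΔ hΔ, mul_nonneg (mul_nonneg hΔ hΔ) hΔ, pow_nonneg hΔ 4]
  have k3 : Δ ^ 3 ≤ Δ * (1 + Δ) ^ 3 := by
    nlinarith [mul_nonneg hΔ hΔ, mul_nonneg (mul_nonneg hΔ hΔ) hΔ, pow_nonneg hΔ 4]
  have k4 : Δ ^ 4 ≤ Δ * (1 + Δ) ^ 3 := by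
    nlinarith [mul_nonneg hΔ hΔ, mul_nonneg (mul_nonneg hΔ hΔ) hΔ, pow_nonneg hΔ 4]
  set D := Δ * (1 + Δ) ^ 3 with hDdef
  have hD0 : 0 ≤ D := by positivity
  set G := E ^ 4 + y ^ 4 with hG
  have hG0 : 0 ≤ G := by positivity
  have t1 := mul_le_mul k1 hA (by positivity) hD0
  have t2 := mul_le_mul k2 hB (by positivity) hD0
  have t3 := mul_le_mul k3 hC (by positivity) hD0
  have t4 := mul_le_mul k4 hD (by positivity) hD0
  have h3 : 4 * E ^ 3 * (Δ * y) + 6 * E ^ 2 * (Δ * y) ^ 2 + 4 * E * (Δ * y) ^ 3 + (Δ * y) ^ 4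
      = 4 * (Δ * (E ^ 3 * y)) + 6 * (Δ ^ 2 * (E ^ 2 * y ^ 2)) + 4 * (Δ ^ 3 * (E * y ^ 3))
        + Δ ^ 4 * y ^ 4 := by
    ring
  have h4 : 15 * D * (1 + E ^ 4 + y ^ 4) = 15 * D + 15 * (D * G) := by
    rw [hG]
    ring
  rw [he4, h4]
  rw [he4] at h1
  linarith

/-- The bound is far from sharp; it is given the shape of the fourth-order one so that both
empirical moments can be treated together. -/
theorem abs_sub_sq_sub_le {Δ e v y : ℝ} (hΔ : 0 ≤ Δ) (hy : 0 ≤ y) (hv : |v| ≤ Δ * y) :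
    |(e - v) ^ 2 - e ^ 2| ≤ 15 * (Δ * (1 + Δ) ^ 3) * (1 + e ^ 4 + y ^ 4) := by
  have h1 : |(e - v) ^ 2 - e ^ 2| ≤ 2 * |e| * |v| + |v| ^ 2 := by
    rw [show (e - v) ^ 2 - e ^ 2 = -2 * e * v + v ^ 2 by ring]
    refine (abs_add_le _ _).trans (add_le_add ?_ ?_) <;> simp [abs_mul]
  have h2 : 2 * |e| * |v| + |v| ^ 2 ≤ 2 * |e| * (Δ * y) + (Δ * y) ^ 2 := by gcongr
  have k1 : Δ ≤ Δ * (1 + Δ) ^ 3 :=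
    le_mul_of_one_le_right hΔ (one_le_pow₀ (by linarith))
  have k2 : Δ ^ 2 ≤ Δ * (1 + Δ) ^ 3 := by
    nlinarith [mul_nonneg hΔ hΔ, mul_nonneg (mul_nonneg hΔ hΔ) hΔ, pow_nonneg hΔ 4]
  set D := Δ * (1 + Δ) ^ 3 with hDdef
  have hD0 : 0 ≤ D := by positivity
  have hA : 2 * |e| * y ≤ 1 + e ^ 4 + y ^ 4 := by
    nlinarith [sq_nonneg (|e| - y), sq_abs e, sq_nonneg (e ^ 2 - 1), sq_nonneg (y ^ 2 - 1),
      sq_nonneg (e ^ 2), sq_nonneg (y ^ 2)]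
  have hB : y ^ 2 ≤ 1 + e ^ 4 + y ^ 4 := by
    nlinarith [sq_nonneg (y ^ 2 - 1), sq_nonneg (e ^ 2), sq_nonneg (y ^ 2)]
  have t1 := mul_le_mul k1 hA (by positivity) hD0
  have t2 := mul_le_mul k2 hB (by positivity) hD0
  have hW : 0 ≤ D * (1 + e ^ 4 + y ^ 4) := by positivity
  nlinarith

/-- Expansion of the empirical moments of orders two and four around the true coefficients. -/
theorem abs_empMoment_sub_le {n k : ℕ} (hk : k = 2 ∨ k = 4) {h x e : ℤ → ℝ} {a : Fin p → ℝ}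
    {c : ℝ} (hc : 0 < c) (hh : ∀ t, 1 ≤ t → t ≤ (n : ℤ) → c ≤ h t)
    (har : ∀ t, 1 ≤ t → t ≤ (n : ℤ) → x t = a ⬝ᵥ lagVec p x (t - 1) + h t * e t)
    {Δ : ℝ} (hΔ : Δ = p * ‖gls p n h x - a‖ / c) :
    |empMoment p n k h x - 1 / (n : ℝ) * ∑ t ∈ Finset.Icc (1 : ℤ) n, e t ^ k|
      ≤ 15 * (Δ * (1 + Δ) ^ 3) * (1 / (n : ℝ) * ∑ t ∈ Finset.Icc (1 : ℤ) n, weight p e x t) := by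
  have hΔ0 : 0 ≤ Δ := by rw [hΔ]; positivity
  rw [empMoment, ← mul_sub, abs_mul, abs_of_nonneg (by positivity), ← Finset.sum_sub_distrib,
    mul_left_comm]
  refine mul_le_mul_of_nonneg_left ?_ (by positivity)
  refine (Finset.abs_sum_le_sum_abs _ _).trans ?_
  rw [Finset.mul_sum]
  refine Finset.sum_le_sum fun t ht => ?_
  rw [Finset.mem_Icc] at ht
  have hht := hh t ht.1 ht.2
  have hpos : 0 < h t := hc.trans_le hht
  rw [residual_eq ht.1 (har t ht.1 ht.2), ← div_pow, sub_div, mul_div_cancel_left₀ _ hpos.ne']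
  set v := (gls p n h x - a) ⬝ᵥ lagVec p x (t - 1) / h t with hv
  have hvb : |v| ≤ Δ * ‖lagVec p x (t - 1)‖ := by
    rw [hv, abs_div, abs_of_pos hpos, div_le_iff₀ hpos]
    refine (abs_dotProduct_le _ _).trans ?_
    calc (p : ℝ) * ‖gls p n h x - a‖ * ‖lagVec p x (t - 1)‖
        = Δ * ‖lagVec p x (t - 1)‖ * c := by rw [hΔ]; field_simp
      _ ≤ _ := by gcongr
  rcases hk with rfl | rfl
  · exact abs_sub_sq_sub_le hΔ0 (norm_nonneg _) hvb
  · exact abs_sub_pow_four_sub_le hΔ0 (norm_nonneg _) hvb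

end Expansion

/-! ### The noise: information, moments, orthogonality -/

section Information

variable {Ω : Type*} {mΩ : MeasurableSpace Ω} {μ : Measure Ω} {ε : ℤ → Ω → ℝ}

/-- The `σ`-algebra generated by the `ε_t`, `t ∈ S`. -/
@[reducible] def info (ε : ℤ → Ω → ℝ) (S : Set ℤ) : MeasurableSpace Ω :=
  ⨆ t ∈ S, MeasurableSpace.comap (ε t) inferInstance

theorem info_mono {S T : Set ℤ} (h : S ⊆ T) : info ε S ≤ info ε T :=
  biSup_mono fun _ ht => h ht

theorem info_le (hε : ∀ t, Measurable (ε t)) (S : Set ℤ) : info ε S ≤ mΩ :=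
  iSup₂_le fun t _ => (hε t).comap_le

theorem measurable_info {S : Set ℤ} {t : ℤ} (ht : t ∈ S) : Measurable[info ε S] (ε t) :=
  (comap_measurable (ε t)).mono
    (le_iSup₂ (f := fun s (_ : s ∈ S) => MeasurableSpace.comap (ε s) inferInstance) t ht) le_rfl

/-- Independence over disjoint sets of times takes the place of conditional expectations throughout.
-/
theorem indepFun_of_info {β γ : Type*} [MeasurableSpace β] [MeasurableSpace γ]
    (hε : ∀ t, Measurable (ε t)) (hind : iIndepFun ε μ) {S T : Set ℤ} (hST : Disjoint S T)
    {X : Ω → β} {Y : Ω → γ} (hX : Measurable[info ε S] X) (hY : Measurable[info ε T] Y) :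
    IndepFun X Y μ := by
  have h := indep_iSup_of_disjoint (fun t => (hε t).comap_le) hind hST
  exact indep_of_indep_of_le_left (indep_of_indep_of_le_right h hY.comap_le) hX.comap_le

end Information

namespace Noise

variable {Ω : Type*} [MeasurableSpace Ω] {μ : Measure Ω} [IsProbabilityMeasure μ] {ε : ℤ → Ω → ℝ}

theorem integrable_comp (hε : Noise μ ε) {f : ℝ → ℝ} (hf : Measurable f)
    (h : Integrable (fun ω => f (ε 0 ω)) μ) (t : ℤ) : Integrable (fun ω => f (ε t ω)) μ :=
  ((hε.identDistrib t).comp hf).integrable_iff.2 h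

theorem integral_comp (hε : Noise μ ε) {f : ℝ → ℝ} (hf : Measurable f) (t : ℤ) :
    ∫ ω, f (ε t ω) ∂μ = ∫ ω, f (ε 0 ω) ∂μ :=
  ((hε.identDistrib t).comp hf).integral_eq

theorem integrable_pow_eight (hε : Noise μ ε) (t : ℤ) :
    Integrable (fun ω => ε t ω ^ 8) μ := by
  refine hε.integrable_comp (f := fun y => y ^ 8) (by fun_prop) ?_ t
  obtain ⟨s, hs, hint⟩ := hε.moment
  refine Integrable.mono' ((integrable_const (1 : ℝ)).add hint)
    ((hε.measurable 0).pow_const 8).aestronglyMeasurable (Eventually.of_forall fun ω => ?_)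
  rw [Real.norm_eq_abs, abs_pow, Pi.add_apply]
  rcases le_total |ε 0 ω| 1 with h | h
  · have h1 : |ε 0 ω| ^ 8 ≤ 1 := pow_le_one₀ (abs_nonneg _) h
    have h2 : 0 ≤ |ε 0 ω| ^ s := by positivity
    linarith
  · have h1 : |ε 0 ω| ^ 8 ≤ |ε 0 ω| ^ s := by
      rw [← Real.rpow_natCast]
      exact Real.rpow_le_rpow_of_exponent_le h (by norm_num; exact hs.le)
    linarith

theorem _root_.ArchLM.abs_pow_le_one_add_pow_eight (y : ℝ) {k : ℕ} (hk : k ≤ 8) :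
    |y| ^ k ≤ 1 + y ^ 8 := by
  have h8 : y ^ 8 = |y| ^ 8 := (Even.pow_abs (by decide) y).symm
  rw [h8]
  rcases le_total |y| 1 with h | h
  · have h1 : |y| ^ k ≤ 1 := pow_le_one₀ (abs_nonneg _) h
    have h2 : 0 ≤ |y| ^ 8 := by positivity
    linarith
  · have h1 : |y| ^ k ≤ |y| ^ 8 := pow_le_pow_right₀ h hk
    linarith

theorem integrable_of_abs_le (hε : Noise μ ε) {f : ℝ → ℝ} (hf : Measurable f) (C : ℝ)
    (h : ∀ y, |f y| ≤ C * (1 + y ^ 8)) (t : ℤ) : Integrable (fun ω => f (ε t ω)) μ :=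
  Integrable.mono' (((integrable_const (1 : ℝ)).add (hε.integrable_pow_eight t)).const_mul C)
    (hf.comp (hε.measurable t)).aestronglyMeasurable (Eventually.of_forall fun ω => h (ε t ω))

theorem integrable_pow (hε : Noise μ ε) {k : ℕ} (hk : k ≤ 8) (t : ℤ) :
    Integrable (fun ω => ε t ω ^ k) μ :=
  hε.integrable_of_abs_le (f := fun y => y ^ k) (by fun_prop) 1
    (fun y => by rw [abs_pow, one_mul]; exact abs_pow_le_one_add_pow_eight y hk) t

theorem integral_sq (hε : Noise μ ε) : ∫ ω, ε 0 ω ^ 2 ∂μ = 1 := by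
  have h := variance_eq_integral (hε.measurable 0).aemeasurable (μ := μ)
  rw [hε.unit_variance, hε.mean_zero] at h
  simpa using h.symm

theorem variance_sq (hε : Noise μ ε) :
    variance (fun ω => ε 0 ω ^ 2) μ = ∫ ω, ε 0 ω ^ 4 ∂μ - 1 := by
  rw [variance_eq_sub]
  · rw [hε.integral_sq]
    simp only [Pi.pow_apply, ← pow_mul]
    norm_num
  · rw [memLp_two_iff_integrable_sq ((hε.measurable 0).pow_const 2).aestronglyMeasurable]
    simpa only [← pow_mul] using hε.integrable_pow (k := 2 * 2) (by norm_num) 0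

/-- For r < t the product of two summands is η(ε_t) times a function of the past of t. The first
factor is centred and independent of the second, so all cross terms vanish; the diagonal terms
factor by the same independence. -/
theorem integral_sq_sum (hε : Noise μ ε) {η : ℝ → ℝ} (hη : Measurable η)
    (h0 : ∫ ω, η (ε 0 ω) ∂μ = 0) (h2 : Integrable (fun ω => η (ε 0 ω) ^ 2) μ) {s : Finset ℤ}
    {F : ℤ → Ω → ℝ} (hF : ∀ t ∈ s, Measurable[info ε (Set.Iio t)] (F t))
    (hF2 : ∀ t ∈ s, Integrable (fun ω => F t ω ^ 2) μ) :
    MemLp (fun ω => ∑ t ∈ s, η (ε t ω) * F t ω) 2 μ ∧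
      ∫ ω, (∑ t ∈ s, η (ε t ω) * F t ω) ^ 2 ∂μ
        = (∫ ω, η (ε 0 ω) ^ 2 ∂μ) * ∑ t ∈ s, ∫ ω, F t ω ^ 2 ∂μ := by
  have hle := info_le hε.measurable
  have hFm : ∀ t ∈ s, Measurable (F t) := fun t ht => (hF t ht).mono (hle _) le_rfl
  have hηi : ∀ t, Measurable[info ε {t}] (fun ω => η (ε t ω)) := fun t =>
    hη.comp (measurable_info (Set.mem_singleton t))
  have hηm : ∀ t, Measurable (fun ω => η (ε t ω)) := fun t => hη.comp (hε.measurable t)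
  have hindep : ∀ t (Y : Ω → ℝ), Measurable[info ε (Set.Iio t)] Y →
      IndepFun (fun ω => η (ε t ω)) Y μ := fun t Y hY =>
    indepFun_of_info hε.measurable hε.indep (by simp) (hηi t) hY
  have hsq : ∀ t ∈ s, Integrable (fun ω => (η (ε t ω) * F t ω) ^ 2) μ := by
    intro t ht
    have hi := ((hindep t _ (hF t ht)).comp (measurable_id.pow_const 2)
      (measurable_id.pow_const 2)).integrable_mul
      (hε.integrable_comp (f := fun y => η y ^ 2) (hη.pow_const 2) h2 t) (hF2 t ht)
    refine hi.congr (Eventually.of_forall fun ω => ?_)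
    simp [mul_pow]
  have hL2 : ∀ t ∈ s, MemLp (fun ω => η (ε t ω) * F t ω) 2 μ := fun t ht =>
    (memLp_two_iff_integrable_sq ((hηm t).mul (hFm t ht)).aestronglyMeasurable).2 (hsq t ht)
  have hlt : ∀ t ∈ s, ∀ r ∈ s, r < t →
      ∫ ω, (η (ε t ω) * F t ω) * (η (ε r ω) * F r ω) ∂μ = 0 := by
    intro t ht r hr hrt
    have hr' : Measurable[info ε (Set.Iio t)] (fun ω => F t ω * (η (ε r ω) * F r ω)) :=
      (hF t ht).mul (((hηi r).mono (info_mono (by simpa using hrt)) le_rfl).mul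
        ((hF r hr).mono (info_mono (Set.Iio_subset_Iio hrt.le)) le_rfl))
    have h := (hindep t _ hr').integral_fun_mul_eq_mul_integral
      (hηm t).aestronglyMeasurable ((hr'.mono (hle _) le_rfl).aestronglyMeasurable)
    rw [hε.integral_comp hη t, h0, zero_mul] at h
    simpa only [mul_assoc] using h
  refine ⟨memLp_finsetSum s hL2, ?_⟩
  have hexp : ∀ ω, (∑ t ∈ s, η (ε t ω) * F t ω) ^ 2
      = ∑ t ∈ s, ∑ r ∈ s, (η (ε t ω) * F t ω) * (η (ε r ω) * F r ω) := fun ω => by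
    rw [sq, Finset.sum_mul_sum]
  have hprod : ∀ t ∈ s, ∀ r ∈ s,
      Integrable (fun ω => (η (ε t ω) * F t ω) * (η (ε r ω) * F r ω)) μ := fun t ht r hr =>
    (hL2 t ht).integrable_mul (hL2 r hr)
  simp only [hexp]
  rw [integral_finsetSum _ fun t ht => integrable_finsetSum _ fun r hr => hprod t ht r hr,
    Finset.mul_sum]
  refine Finset.sum_congr rfl fun t ht => ?_
  rw [integral_finsetSum _ fun r hr => hprod t ht r hr, Finset.sum_eq_single t]
  · have h := ((hindep t _ (hF t ht)).comp (measurable_id.pow_const 2)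
      (measurable_id.pow_const 2)).integral_fun_mul_eq_mul_integral
      ((measurable_id.pow_const 2).comp (hηm t)).aestronglyMeasurable
      ((measurable_id.pow_const 2).comp (hFm t ht)).aestronglyMeasurable
    simp only [Function.comp_apply, id] at h
    rw [hε.integral_comp (f := fun y => η y ^ 2) (hη.pow_const 2) t] at h
    rw [← h]
    refine integral_congr_ae (Eventually.of_forall fun ω => ?_)
    simp only
    ring
  · intro r hr hrt
    rcases lt_or_gt_of_ne hrt with h | h
    · exact hlt t ht r hr h
    · rw [← hlt r hr t ht h]
      exact integral_congr_ae (Eventually.of_forall fun ω => mul_comm _ _)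
  · exact fun h => absurd ht h

/-- Normalized sums of martingale differences `η(ε_t) F_t` are bounded in probability. -/
theorem bddInProb_sum (hε : Noise μ ε) {η : ℝ → ℝ} (hη : Measurable η)
    (h0 : ∫ ω, η (ε 0 ω) ∂μ = 0) (h2 : Integrable (fun ω => η (ε 0 ω) ^ 2) μ)
    {F : ℕ → ℤ → Ω → ℝ} (K : ℝ)
    (hF : ∀ (n : ℕ), ∀ t ∈ Finset.Icc (1 : ℤ) n, Measurable[info ε (Set.Iio t)] (F n t) ∧
      Integrable (fun ω => F n t ω ^ 2) μ ∧ ∫ ω, F n t ω ^ 2 ∂μ ≤ K) :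
    BddInProb μ (fun n ω => (√(n : ℝ))⁻¹ * ∑ t ∈ Finset.Icc (1 : ℤ) n, η (ε t ω) * F n t ω) := by
  have h := fun n : ℕ => hε.integral_sq_sum hη h0 h2 (s := Finset.Icc (1 : ℤ) n) (F := F n)
    (fun t ht => (hF n t ht).1) (fun t ht => (hF n t ht).2.1)
  have hv : 0 ≤ ∫ ω, η (ε 0 ω) ^ 2 ∂μ := integral_nonneg fun ω => sq_nonneg _
  refine .of_integral_sq_le ((∫ ω, η (ε 0 ω) ^ 2 ∂μ) * K)
    (Eventually.of_forall fun n => (h n).1.const_mul _) ?_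
  filter_upwards [eventually_gt_atTop 0] with n hn
  have hn' : (0 : ℝ) < n := by exact_mod_cast hn
  simp only [mul_pow]
  rw [integral_const_mul, (h n).2, inv_pow, Real.sq_sqrt hn'.le, inv_mul_eq_div, div_le_iff₀ hn',
    mul_assoc]
  refine mul_le_mul_of_nonneg_left ?_ hv
  refine (Finset.sum_le_card_nsmul _ _ K fun t ht => (hF n t ht).2.2).trans_eq ?_
  simp [mul_comm]

end Noise

/-! ### Autoregressions driven by the noise -/

section Envelope

variable {Ω : Type*} {mΩ : MeasurableSpace Ω} {μ : Measure Ω} {ε : ℤ → Ω → ℝ} {ρ : ℝ}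

/-- The process `V_{k+1} = ρ V_k + |ε_{k+1}|`, `V_0 = 0`, which dominates the autoregression. -/
def envelope (ρ : ℝ) (ε : ℤ → Ω → ℝ) : ℕ → Ω → ℝ
  | 0 => fun _ => 0
  | k + 1 => fun ω => ρ * envelope ρ ε k ω + |ε ((k : ℤ) + 1) ω|

theorem envelope_nonneg (hρ : 0 ≤ ρ) (k : ℕ) (ω : Ω) : 0 ≤ envelope ρ ε k ω := by
  induction k with
  | zero => exact le_rfl
  | succ k ih => exact add_nonneg (mul_nonneg hρ ih) (abs_nonneg _)

theorem measurable_envelope (hε : ∀ t, Measurable (ε t)) (k : ℕ) :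
    Measurable (envelope ρ ε k) := by
  induction k with
  | zero => exact measurable_const
  | succ k ih => exact (ih.const_mul ρ).add (hε _).abs

/-- Convexity of y⁸ at the points x and y/(1 − ρ), with weights ρ and 1 − ρ. -/
theorem convex_pow_eight {ρ x y : ℝ} (hρ : 0 < ρ) (hρ1 : ρ < 1) :
    (ρ * x + y) ^ 8 ≤ ρ * x ^ 8 + (1 - ρ) * (y / (1 - ρ)) ^ 8 := by
  have h := (Even.convexOn_pow (𝕜 := ℝ) (n := 8) (by decide)).2 (Set.mem_univ x)
    (Set.mem_univ (y / (1 - ρ))) hρ.le (sub_nonneg.2 hρ1.le) (by ring)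
  have h1 : (1 - ρ) ≠ 0 := by linarith
  simp only [smul_eq_mul] at h
  rwa [mul_div_cancel₀ _ h1] at h

/-- By convexity the eighth moments satisfy m_{k+1} ≤ ρ m_k + A, and A/(1 − ρ) is the fixed point of
this recursion. -/
theorem Noise.integral_envelope_le [IsProbabilityMeasure μ] (hε : Noise μ ε) (hρ : 0 < ρ)
    (hρ1 : ρ < 1) : ∃ K : ℝ, 0 ≤ K ∧ ∀ k, Integrable (fun ω => envelope ρ ε k ω ^ 8) μ ∧
      ∫ ω, envelope ρ ε k ω ^ 8 ∂μ ≤ K := by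
  have h1 : 0 < 1 - ρ := by linarith
  set A := (1 - ρ) * ((1 / (1 - ρ)) ^ 8 * ∫ ω, ε 0 ω ^ 8 ∂μ) with hA
  have h8 : 0 ≤ ∫ ω, ε 0 ω ^ 8 ∂μ := integral_nonneg fun ω => by positivity
  have hA0 : 0 ≤ A := by positivity
  refine ⟨A / (1 - ρ), by positivity, fun k => ?_⟩
  induction k with
  | zero =>
    refine ⟨by simp [envelope], ?_⟩
    simp only [envelope]
    simp
    positivity
  | succ k ih =>
    have hi2 : Integrable (fun ω => (1 - ρ) * (|ε ((k : ℤ) + 1) ω| / (1 - ρ)) ^ 8) μ := by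
      have := (hε.integrable_pow_eight ((k : ℤ) + 1)).const_mul ((1 - ρ) * (1 / (1 - ρ)) ^ 8)
      refine this.congr (Eventually.of_forall fun ω => ?_)
      simp only [div_pow, Even.pow_abs (show Even 8 by decide)]
      ring
    have hi := (ih.1.const_mul ρ).add hi2
    have hle : ∀ ω, envelope ρ ε (k + 1) ω ^ 8 ≤ ρ * envelope ρ ε k ω ^ 8
        + (1 - ρ) * (|ε ((k : ℤ) + 1) ω| / (1 - ρ)) ^ 8 := fun ω => convex_pow_eight hρ hρ1
    have hint : Integrable (fun ω => envelope ρ ε (k + 1) ω ^ 8) μ := by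
      refine Integrable.mono' hi
        ((measurable_envelope hε.measurable _).pow_const 8).aestronglyMeasurable
        (Eventually.of_forall fun ω => ?_)
      rw [Real.norm_eq_abs, abs_of_nonneg (by positivity)]
      exact hle ω
    refine ⟨hint, ?_⟩
    have hval : ∫ ω, (1 - ρ) * (|ε ((k : ℤ) + 1) ω| / (1 - ρ)) ^ 8 ∂μ = A := by
      rw [hA, ← hε.integral_comp (f := fun y => y ^ 8) (by fun_prop) ((k : ℤ) + 1),
        ← integral_const_mul, ← integral_const_mul]
      refine integral_congr_ae (Eventually.of_forall fun ω => ?_)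
      simp only [div_pow, Even.pow_abs (show Even 8 by decide)]
      ring
    have := integral_mono hint hi hle
    rw [integral_add' (ih.1.const_mul ρ) hi2, integral_const_mul, hval] at this
    refine this.trans ?_
    have h2 := mul_le_mul_of_nonneg_left ih.2 hρ.le
    have h3 : ρ * (A / (1 - ρ)) + A = A / (1 - ρ) := by
      field_simp
      ring
    linarith

end Envelope

/-! ### The state driven by the noise, separated from the initial values -/

section NoiseDriven

variable {p : ℕ}

/-- The state vector of the autoregression with zero initial values and innovations `w`. -/
def noiseDriven (a : Fin p → ℝ) (w : ℤ → ℝ) : ℕ → Fin p → ℝ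
  | 0 => 0
  | k + 1 => (companion a).mulVec (noiseDriven a w k) + w ((k : ℤ) + 1) • firstUnit p

/-- Superposition. The first summand is adapted to the noise and has moments; the second carries the
initial values, for which neither is assumed, but decays geometrically. -/
theorem lagVec_eq_noiseDriven_add {a : Fin p → ℝ} {x w : ℤ → ℝ} {n : ℕ}
    (har : ∀ t, 1 ≤ t → t ≤ (n : ℤ) → x t = a ⬝ᵥ lagVec p x (t - 1) + w t) {k : ℕ} (hk : k ≤ n) :
    lagVec p x k = noiseDriven a w k + ((companion a) ^ k).mulVec (lagVec p x 0) := by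
  induction k with
  | zero => simp [noiseDriven]
  | succ k ih =>
    have h := lagVec_eq_companion (har ((k : ℤ) + 1) (by omega) (by omega))
    rw [add_sub_cancel_right, ih (by omega), Matrix.mulVec_add, Matrix.mulVec_mulVec,
      ← pow_succ'] at h
    push_cast
    rw [h, noiseDriven]
    abel

theorem norm_noiseDriven_le {Ω : Type*} {a : Fin p → ℝ} {C ρ H : ℝ} (hC : 0 ≤ C) (hρ : 0 ≤ ρ)
    (hpow : ∀ (k : ℕ) (v : Fin p → ℝ), ‖((companion a) ^ k).mulVec v‖ ≤ C * ρ ^ k * ‖v‖)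
    {h : ℤ → ℝ} {ε : ℤ → Ω → ℝ} {ω : Ω} {n : ℕ} (hH : ∀ t, 1 ≤ t → t ≤ (n : ℤ) → |h t| ≤ H)
    {k : ℕ} (hk : k ≤ n) :
    ‖noiseDriven a (fun t => h t * ε t ω) k‖ ≤ C * H * envelope ρ ε k ω := by
  -- The induction bounds all powers Mⁱ of the state at once. Estimating one step at a time would
  -- multiply the constant C into itself.
  suffices hs : ∀ k, k ≤ n → ∀ i, ‖((companion a) ^ i).mulVec
      (noiseDriven a (fun t => h t * ε t ω) k)‖ ≤ C * H * ρ ^ i * envelope ρ ε k ω by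
    simpa using hs k hk 0
  intro k
  induction k with
  | zero =>
    intro _ i
    simp [noiseDriven, envelope]
  | succ k ih =>
    intro hk i
    rw [noiseDriven, envelope, Matrix.mulVec_add, Matrix.mulVec_mulVec, ← pow_succ,
      Matrix.mulVec_smul]
    refine (norm_add_le _ _).trans ?_
    have h1 := ih (by omega) (i + 1)
    have h2 : ‖((companion a) ^ i).mulVec (firstUnit p)‖ ≤ C * ρ ^ i :=
      (hpow i _).trans (mul_le_of_le_one_right (by positivity) norm_firstUnit_le)
    have h3 := hH ((k : ℤ) + 1) (by omega) (by omega)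
    have hH0 : 0 ≤ H := (abs_nonneg _).trans h3
    have h4 : ‖(h ((k : ℤ) + 1) * ε ((k : ℤ) + 1) ω) • ((companion a) ^ i).mulVec (firstUnit p)‖
        ≤ (H * |ε ((k : ℤ) + 1) ω|) * (C * ρ ^ i) := by
      rw [norm_smul, Real.norm_eq_abs, abs_mul]
      gcongr
    calc _ ≤ C * H * ρ ^ (i + 1) * envelope ρ ε k ω
            + (H * |ε ((k : ℤ) + 1) ω|) * (C * ρ ^ i) := add_le_add h1 h4
      _ = _ := by ring

theorem measurable_noiseDriven {Ω : Type*} (a : Fin p → ℝ) (h : ℤ → ℝ)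
    (ε : ℤ → Ω → ℝ) (k : ℕ) (j : Fin p) :
    Measurable[info ε (Set.Iic (k : ℤ))] (fun ω => noiseDriven a (fun t => h t * ε t ω) k j) := by
  induction k generalizing j with
  | zero => exact measurable_const
  | succ k ih =>
    have h1 : ∀ i, Measurable[info ε (Set.Iic ((k + 1 : ℕ) : ℤ))]
        (fun ω => noiseDriven a (fun t => h t * ε t ω) k i) := fun i =>
      (ih i).mono (info_mono (Set.Iic_subset_Iic.2 (by push_cast; omega))) le_rfl
    have h2 : Measurable[info ε (Set.Iic ((k + 1 : ℕ) : ℤ))] (ε ((k : ℤ) + 1)) :=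
      measurable_info (by simp)
    simp only [noiseDriven, Pi.add_apply, Matrix.mulVec, dotProduct, Pi.smul_apply, smul_eq_mul]
    exact (Finset.measurable_fun_sum _ fun i _ => (h1 i).const_mul _).add
      ((h2.const_mul _).mul_const _)

end NoiseDriven

/-- An autoregression with innovations `h_{n,t} ε_t`, where the volatilities `h_{n,t}` lie between
two positive constants, with initial values which are bounded in probability. -/
structure BoundedVolAR {Ω : Type*} [MeasurableSpace Ω] (μ : Measure Ω) {p : ℕ} (a : Fin p → ℝ)
    (c H : ℝ) (h : ℕ → ℤ → ℝ) (ε : ℤ → Ω → ℝ) (x : ℕ → ℤ → Ω → ℝ) : Prop where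
  pos : 0 < c
  bounds : ∀ (n : ℕ) (t : ℤ), 1 ≤ t → t ≤ n → c ≤ h n t ∧ h n t ≤ H
  ar : ∀ (n : ℕ) (ω : Ω) (t : ℤ), 1 ≤ t → t ≤ n →
    x n t ω = a ⬝ᵥ lagVec p (fun s => x n s ω) (t - 1) + h n t * ε t ω
  init : BddInProb μ (fun n ω => ‖lagVec p (fun s => x n s ω) 0‖)

theorem sum_Icc_eq_sum_range (f : ℤ → ℝ) (n : ℕ) :
    ∑ t ∈ Finset.Icc (1 : ℤ) n, f t = ∑ k ∈ Finset.range n, f ((k : ℤ) + 1) := by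
  induction n with
  | zero => simp
  | succ n ih =>
    have h : Finset.Icc (1 : ℤ) ((n + 1 : ℕ) : ℤ)
        = insert ((n : ℤ) + 1) (Finset.Icc (1 : ℤ) n) := by
      ext t
      simp only [Finset.mem_Icc, Finset.mem_insert]
      omega
    rw [h, Finset.sum_insert (by simp), Finset.sum_range_succ, ih, add_comm]

theorem sum_Icc_geom_le {ρ : ℝ} (hρ : 0 ≤ ρ) (hρ1 : ρ < 1) (n : ℕ) :
    ∑ t ∈ Finset.Icc (1 : ℤ) n, ρ ^ (t - 1).toNat ≤ (1 - ρ)⁻¹ := by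
  rw [sum_Icc_eq_sum_range]
  simp only [add_sub_cancel_right, Int.toNat_natCast]
  rw [← tsum_geometric_of_lt_one hρ hρ1]
  exact (summable_geometric_of_lt_one hρ hρ1).sum_le_tsum _ fun _ _ => by positivity

namespace BoundedVolAR

variable {Ω : Type*} [MeasurableSpace Ω] {μ : Measure Ω} [IsProbabilityMeasure μ]
  {ε : ℤ → Ω → ℝ} {p : ℕ} {a : Fin p → ℝ} {c H : ℝ} {h : ℕ → ℤ → ℝ} {x : ℕ → ℤ → Ω → ℝ}

theorem abs_vol_le (hx : BoundedVolAR μ a c H h ε x) (n : ℕ) (t : ℤ) (h1 : 1 ≤ t) (hn : t ≤ n) :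
    |h n t| ≤ H := by
  rw [abs_of_pos (hx.pos.trans_le (hx.bounds n t h1 hn).1)]
  exact (hx.bounds n t h1 hn).2

/-- The martingale difference sums `∑ η(ε_t) c_t ε_{t-l}^q x_{t-1-r-j}` are `O_P(√n)`. -/
theorem bddInProb_linear_sum (hx : BoundedVolAR μ a c H h ε x) (hε : Noise μ ε) (ha : Stable a)
    {η : ℝ → ℝ} (hη : Measurable η) (h0 : ∫ ω, η (ε 0 ω) ∂μ = 0)
    (h2 : Integrable (fun ω => η (ε 0 ω) ^ 2) μ) {l r q : ℕ} (hl : 1 ≤ l) (hq : q ≤ 2)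
    {w : ℕ → ℤ → ℝ} {B : ℝ} (hw : ∀ (n : ℕ) (t : ℤ), 1 ≤ t → t ≤ n → |w n t| ≤ B)
    (hwr : ∀ n t, t ≤ (r : ℤ) → w n t = 0) (j : Fin p) :
    BddInProb μ (fun n ω => (√(n : ℝ))⁻¹ * ∑ t ∈ Finset.Icc (1 : ℤ) n, η (ε t ω) *
      (w n t * ε (t - l) ω ^ q * lagVec p (fun s => x n s ω) (t - 1 - r) j)) := by
  obtain ⟨C, ρ, hC, hρ, hρ1, hpow⟩ := ha.exists_norm_companion_pow_mulVec_le
  obtain ⟨K, hK, hV⟩ := hε.integral_envelope_le hρ hρ1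
  have hB : 0 ≤ B := (abs_nonneg _).trans (hw 1 1 le_rfl (by simp))
  have hH : 0 ≤ H := (abs_nonneg _).trans (hx.abs_vol_le 1 1 le_rfl (by simp))
  -- The truncation at 0 is harmless, because the weights vanish for t ≤ r.
  set k : ℤ → ℕ := fun t => (t - 1 - r).toNat with hk
  set E8 := ∫ ω, ε 0 ω ^ 8 ∂μ with hE8
  -- the contribution of the noise
  have hmain : BddInProb μ (fun n ω => (√(n : ℝ))⁻¹ * ∑ t ∈ Finset.Icc (1 : ℤ) n, η (ε t ω) *
      (w n t * ε (t - l) ω ^ q * noiseDriven a (fun t => h n t * ε t ω) (k t) j)) := by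
    refine hε.bddInProb_sum hη h0 h2 (F := fun n t ω => w n t * ε (t - l) ω ^ q *
      noiseDriven a (fun t => h n t * ε t ω) (k t) j) (B ^ 2 * (C * H) ^ 2 * (2 + E8 + K))
      fun n t ht => ?_
    rw [Finset.mem_Icc] at ht
    have hkt : k t ≤ n := by simp only [hk]; omega
    have hmeas : Measurable[info ε (Set.Iio t)] (fun ω => w n t * ε (t - l) ω ^ q *
        noiseDriven a (fun t => h n t * ε t ω) (k t) j) := by
      refine (((measurable_info (by simp; omega)).pow_const q).const_mul _).mul
        ((measurable_noiseDriven a (h n) ε (k t) j).mono (info_mono fun s hs => ?_) le_rfl)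
      simp only [Set.mem_Iic, Set.mem_Iio, hk] at hs ⊢
      omega
    have hdom : ∀ ω, (w n t * ε (t - l) ω ^ q *
        noiseDriven a (fun t => h n t * ε t ω) (k t) j) ^ 2
        ≤ B ^ 2 * (C * H) ^ 2 * (2 + ε (t - l) ω ^ 8 + envelope ρ ε (k t) ω ^ 8) := by
      intro ω
      set e := ε (t - l) ω
      set v := envelope ρ ε (k t) ω with hv
      have hv0 : 0 ≤ v := envelope_nonneg hρ.le _ _
      have hy : |noiseDriven a (fun t => h n t * ε t ω) (k t) j| ≤ C * H * v :=
        (norm_le_pi_norm _ j).trans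
          (norm_noiseDriven_le hC hρ.le hpow (fun t h1 hn => hx.abs_vol_le n t h1 hn) hkt)
      have h3 : (e ^ q) ^ 2 ≤ 1 + e ^ 4 := by
        interval_cases q
        · simp
          positivity
        · nlinarith [sq_nonneg (e ^ 2 - 1), sq_nonneg (e ^ 2)]
        · nlinarith
      have h4 : (1 + e ^ 4) * v ^ 2 ≤ 2 + e ^ 8 + v ^ 8 := by
        nlinarith [sq_nonneg (1 + e ^ 4 - v ^ 2), sq_nonneg (e ^ 4 - 1), sq_nonneg (v ^ 4 - 1)]
      have h5 := hw n t ht.1 ht.2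
      calc (w n t * e ^ q * noiseDriven a (fun t => h n t * ε t ω) (k t) j) ^ 2
          = |w n t| ^ 2 * (e ^ q) ^ 2
            * |noiseDriven a (fun t => h n t * ε t ω) (k t) j| ^ 2 := by
              rw [sq_abs, sq_abs]; ring
        _ ≤ B ^ 2 * (1 + e ^ 4) * (C * H * v) ^ 2 := by gcongr
        _ = B ^ 2 * (C * H) ^ 2 * ((1 + e ^ 4) * v ^ 2) := by ring
        _ ≤ _ := by gcongr
    have hi1 : Integrable (fun ω => 2 + ε (t - l) ω ^ 8) μ :=
      (integrable_const 2).add (hε.integrable_pow_eight _)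
    have hdomi : Integrable (fun ω => B ^ 2 * (C * H) ^ 2 *
        (2 + ε (t - l) ω ^ 8 + envelope ρ ε (k t) ω ^ 8)) μ :=
      (hi1.add (hV _).1).const_mul _
    have hint : Integrable (fun ω => (w n t * ε (t - l) ω ^ q *
        noiseDriven a (fun t => h n t * ε t ω) (k t) j) ^ 2) μ := by
      refine Integrable.mono' hdomi ((hmeas.mono (info_le hε.measurable _) le_rfl).pow_const
        2).aestronglyMeasurable (Eventually.of_forall fun ω => ?_)
      rw [Real.norm_eq_abs, abs_of_nonneg (sq_nonneg _)]
      exact hdom ω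
    refine ⟨hmeas, hint, (integral_mono hint hdomi hdom).trans ?_⟩
    rw [integral_const_mul, integral_add hi1 (hV _).1, integral_add (integrable_const 2) (hε.integrable_pow_eight _),
      hε.integral_comp (f := fun y => y ^ 8) (by fun_prop)]
    simp only [integral_const, probReal_univ, one_smul]
    have := (hV (k t)).2
    gcongr
  -- the contribution of the initial values
  have hi1 : ∀ t : ℤ, Integrable (fun ω => 1 + ε (t - l) ω ^ 8) μ := fun t =>
    (integrable_const 1).add (hε.integrable_pow_eight _)
  have hi2 : ∀ t : ℤ, Integrable (fun ω =>
      ρ ^ (t - 1).toNat * (η (ε t ω) ^ 2 + (1 + ε (t - l) ω ^ 8))) μ := fun t =>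
    ((hε.integrable_comp (f := fun y => η y ^ 2) (hη.pow_const 2) h2 t).add (hi1 t)).const_mul _
  -- Orthogonality is not available here, as the initial values may depend on the noise. Geometric
  -- decay makes the whole sum O_P(1) even without normalization: a factor bounded in L¹ times
  -- ‖x̲_0‖. The constant ρ⁻ʳ turns ρ^(t−1−r) into ρ^(t−1).
  have hrest : BddInProb μ (fun n ω => (∑ t ∈ Finset.Icc (1 : ℤ) n,
      ρ ^ (t - 1).toNat * (η (ε t ω) ^ 2 + (1 + ε (t - l) ω ^ 8)))
        * (B * C * (ρ ^ r)⁻¹ * ‖lagVec p (fun s => x n s ω) 0‖)) := by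
    refine .mul (.of_integral_abs_le ((1 - ρ)⁻¹ * (∫ ω, η (ε 0 ω) ^ 2 ∂μ + (1 + E8))) ?_ ?_)
      (hx.init.const_mul _)
    · exact Eventually.of_forall fun n => integrable_finsetSum _ fun t _ => hi2 t
    · refine Eventually.of_forall fun n => ?_
      have hpos : ∀ ω, 0 ≤ ∑ t ∈ Finset.Icc (1 : ℤ) n,
          ρ ^ (t - 1).toNat * (η (ε t ω) ^ 2 + (1 + ε (t - l) ω ^ 8)) := fun ω =>
        Finset.sum_nonneg fun t _ => by positivity
      simp only [abs_of_nonneg (hpos _)]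
      rw [integral_finsetSum _ fun t _ => hi2 t]
      have hval : ∀ t : ℤ, ∫ ω, ρ ^ (t - 1).toNat * (η (ε t ω) ^ 2 + (1 + ε (t - l) ω ^ 8)) ∂μ
          = ρ ^ (t - 1).toNat * (∫ ω, η (ε 0 ω) ^ 2 ∂μ + (1 + E8)) := by
        intro t
        rw [integral_const_mul, integral_add
          (hε.integrable_comp (f := fun y => η y ^ 2) (hη.pow_const 2) h2 t) (hi1 t),
          integral_add (integrable_const 1) (hε.integrable_pow_eight _),
          hε.integral_comp (f := fun y => y ^ 8) (by fun_prop),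
          hε.integral_comp (f := fun y => η y ^ 2) (hη.pow_const 2)]
        simp only [integral_const, probReal_univ, one_smul, hE8]
      simp only [hval]
      rw [← Finset.sum_mul]
      have h3 : 0 ≤ ∫ ω, η (ε 0 ω) ^ 2 ∂μ := integral_nonneg fun ω => sq_nonneg _
      have h4 : 0 ≤ E8 := integral_nonneg fun ω => by positivity
      exact mul_le_mul_of_nonneg_right (sum_Icc_geom_le hρ.le hρ1 n) (by positivity)
  refine (hmain.abs.add hrest).mono ?_
  filter_upwards [eventually_ge_atTop 1] with n hn ω
  have hsn : (√(n : ℝ))⁻¹ ≤ 1 := by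
    refine inv_le_one_of_one_le₀ (Real.one_le_sqrt.2 ?_)
    exact_mod_cast hn
  have hdec : ∀ t ∈ Finset.Icc (1 : ℤ) n, η (ε t ω) *
      (w n t * ε (t - l) ω ^ q * lagVec p (fun s => x n s ω) (t - 1 - r) j)
      = η (ε t ω) * (w n t * ε (t - l) ω ^ q *
          noiseDriven a (fun t => h n t * ε t ω) (k t) j)
        + η (ε t ω) * (w n t * ε (t - l) ω ^ q *
          ((companion a) ^ (k t)).mulVec (lagVec p (fun s => x n s ω) 0) j) := by
    intro t ht
    rw [Finset.mem_Icc] at ht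
    rcases le_or_gt t r with htr | htr
    · simp [hwr n t htr]
    · have hkt : ((k t : ℕ) : ℤ) = t - 1 - r := by simp only [hk]; omega
      rw [← hkt, lagVec_eq_noiseDriven_add (fun t h1 hn => hx.ar n ω t h1 hn)
        (k := k t) (by omega), Pi.add_apply]
      ring
  rw [Finset.sum_congr rfl hdec, Finset.sum_add_distrib, mul_add]
  have hS : |(√(n : ℝ))⁻¹ * ∑ t ∈ Finset.Icc (1 : ℤ) n, η (ε t ω) * (w n t * ε (t - l) ω ^ q *
      ((companion a) ^ (k t)).mulVec (lagVec p (fun s => x n s ω) 0) j)|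
      ≤ (∑ t ∈ Finset.Icc (1 : ℤ) n,
        ρ ^ (t - 1).toNat * (η (ε t ω) ^ 2 + (1 + ε (t - l) ω ^ 8)))
        * (B * C * (ρ ^ r)⁻¹ * ‖lagVec p (fun s => x n s ω) 0‖) := by
    rw [abs_mul, abs_of_nonneg (by positivity)]
    refine (mul_le_of_le_one_left (abs_nonneg _) hsn).trans ?_
    refine (Finset.abs_sum_le_sum_abs _ _).trans ?_
    rw [Finset.sum_mul]
    refine Finset.sum_le_sum fun t ht => ?_
    rw [Finset.mem_Icc] at ht
    set R := ‖lagVec p (fun s => x n s ω) 0‖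
    have h3 : |((companion a) ^ (k t)).mulVec (lagVec p (fun s => x n s ω) 0) j|
        ≤ C * ρ ^ k t * R := (norm_le_pi_norm _ j).trans (hpow _ _)
    have h4 : ρ ^ k t ≤ (ρ ^ r)⁻¹ * ρ ^ (t - 1).toNat := by
      rw [inv_mul_eq_div, le_div_iff₀ (by positivity), ← pow_add]
      refine pow_le_pow_of_le_one hρ.le hρ1.le ?_
      simp only [hk]
      omega
    have h5 : |η (ε t ω)| * |ε (t - l) ω| ^ q ≤ η (ε t ω) ^ 2 + (1 + ε (t - l) ω ^ 8) := by
      have h6 := abs_pow_le_one_add_pow_eight (ε (t - l) ω) (k := 2 * q) (by omega)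
      rw [mul_comm 2 q, pow_mul] at h6
      have h7 := two_mul_le_add_sq |η (ε t ω)| (|ε (t - l) ω| ^ q)
      rw [sq_abs] at h7
      have h8 : 0 ≤ ε (t - l) ω ^ 8 := by positivity
      nlinarith [sq_nonneg (η (ε t ω))]
    have h9 := hw n t ht.1 ht.2
    rw [abs_mul, abs_mul, abs_mul, abs_pow]
    calc |η (ε t ω)| * (|w n t| * |ε (t - l) ω| ^ q * |((companion a) ^ (k t)).mulVec
            (lagVec p (fun s => x n s ω) 0) j|)
        ≤ |η (ε t ω)| * (B * |ε (t - l) ω| ^ q * (C * ((ρ ^ r)⁻¹ * ρ ^ (t - 1).toNat) * R)) := by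
          gcongr
          exact h3.trans (by gcongr)
      _ = ρ ^ (t - 1).toNat * (|η (ε t ω)| * |ε (t - l) ω| ^ q) * (B * C * (ρ ^ r)⁻¹ * R) := by
          ring
      _ ≤ _ := by gcongr
  refine (abs_add_le _ _).trans ((add_le_add le_rfl hS).trans (le_abs_self _))

end BoundedVolAR

/-! ### The rate of convergence of the generalized least-squares estimator -/

/-- Chebyshev's inequality, as the case F = 1 of the martingale bound; k ≤ 4 keeps the square of ε^k
integrable. -/
theorem Noise.bddInProb_sum_sub_integral {Ω : Type*} [MeasurableSpace Ω] {μ : Measure Ω}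
    [IsProbabilityMeasure μ] {ε : ℤ → Ω → ℝ} (hε : Noise μ ε) {k : ℕ} (hk : k ≤ 4) :
    BddInProb μ (fun n ω => (√(n : ℝ))⁻¹ *
      ∑ t ∈ Finset.Icc (1 : ℤ) n, (ε t ω ^ k - ∫ ω, ε 0 ω ^ k ∂μ)) := by
  have h := hε.bddInProb_sum (η := fun y => y ^ k - ∫ ω, ε 0 ω ^ k ∂μ) (by fun_prop)
    (by rw [integral_sub (hε.integrable_pow (by omega) 0) (integrable_const _)]; simp)
    (by
      have h1 := ((hε.integrable_pow (k := 2 * k) (by omega) 0).sub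
        ((hε.integrable_pow (k := k) (by omega) 0).const_mul (2 * ∫ ω, ε 0 ω ^ k ∂μ))).add
        (integrable_const ((∫ ω, ε 0 ω ^ k ∂μ) ^ 2))
      refine h1.congr (Eventually.of_forall fun ω => ?_)
      simp only [Pi.add_apply, Pi.sub_apply]
      ring)
    (F := fun _ _ _ => 1) 1 (fun n t _ => ⟨measurable_const, integrable_const _, by simp⟩)
  simpa using h

namespace BoundedVolAR

variable {Ω : Type*} [MeasurableSpace Ω] {μ : Measure Ω} [IsProbabilityMeasure μ]
  {ε : ℤ → Ω → ℝ} {p : ℕ} {a : Fin p → ℝ} {c H : ℝ} {h : ℕ → ℤ → ℝ} {x : ℕ → ℤ → Ω → ℝ}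

theorem exists_norm_lagVec_le (hx : BoundedVolAR μ a c H h ε x) (ha : Stable a) :
    ∃ D ρ : ℝ, 0 ≤ D ∧ 0 < ρ ∧ ρ < 1 ∧ ∀ (n k : ℕ) (ω : Ω), k ≤ n →
      ‖lagVec p (fun s => x n s ω) k‖
        ≤ D * (envelope ρ ε k ω + ‖lagVec p (fun s => x n s ω) 0‖) := by
  obtain ⟨C, ρ, hC, hρ, hρ1, hpow⟩ := ha.exists_norm_companion_pow_mulVec_le
  have hH : 0 ≤ H := (abs_nonneg _).trans (hx.abs_vol_le 1 1 le_rfl (by simp))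
  refine ⟨C * H + C, ρ, by positivity, hρ, hρ1, fun n k ω hk => ?_⟩
  rw [lagVec_eq_noiseDriven_add (fun t h1 hn => hx.ar n ω t h1 hn) hk]
  refine (norm_add_le _ _).trans ?_
  have h1 := norm_noiseDriven_le hC hρ.le hpow (ω := ω) (ε := ε)
    (fun t h1 hn => hx.abs_vol_le n t h1 hn) hk
  have h2 := hpow k (lagVec p (fun s => x n s ω) 0)
  have h3 : ρ ^ k ≤ 1 := pow_le_one₀ hρ.le hρ1.le
  have hV := envelope_nonneg (ε := ε) hρ.le k ω
  set R := ‖lagVec p (fun s => x n s ω) 0‖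
  have hR : 0 ≤ R := norm_nonneg _
  have h4 : C * ρ ^ k * R ≤ C * 1 * R := by gcongr
  nlinarith [mul_nonneg hC hV, mul_nonneg (mul_nonneg hC hH) hR]

theorem bddInProb_norm_lagVec (hx : BoundedVolAR μ a c H h ε x) (hε : Noise μ ε)
    (ha : Stable a) : BddInProb μ (fun n ω => ‖lagVec p (fun s => x n s ω) n‖) := by
  obtain ⟨D, ρ, hD, hρ, hρ1, hb⟩ := hx.exists_norm_lagVec_le ha
  obtain ⟨K, hK, hV⟩ := hε.integral_envelope_le hρ hρ1
  have h1 : BddInProb μ (fun n ω => 1 + envelope ρ ε n ω ^ 8) := by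
    refine (BddInProb.const 1).add (.of_integral_abs_le K
      (Eventually.of_forall fun n => (hV n).1) (Eventually.of_forall fun n => ?_))
    simp only [abs_of_nonneg (show (0 : ℝ) ≤ envelope ρ ε n _ ^ 8 by positivity)]
    exact (hV n).2
  refine ((h1.add hx.init).const_mul D).mono (Eventually.of_forall fun n ω => ?_)
  rw [abs_norm]
  refine (hb n n ω le_rfl).trans (le_trans ?_ (le_abs_self _))
  have h2 := (le_abs_self _).trans
    ((pow_one |envelope ρ ε n ω|).symm.le.trans (abs_pow_le_one_add_pow_eight _ (by norm_num)))
  gcongr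

/-- The weights need not be integrable because of the initial values. The fourth power of the state
is split between the envelope, which has bounded moments, and ‖x̲_0‖⁴, which is a single O_P(1)
variable. -/
theorem bddInProb_mean_weight (hx : BoundedVolAR μ a c H h ε x) (hε : Noise μ ε)
    (ha : Stable a) : BddInProb μ (fun n ω => 1 / (n : ℝ) * ∑ t ∈ Finset.Icc (1 : ℤ) n,
      weight p (fun s => ε s ω) (fun s => x n s ω) t) := by
  obtain ⟨D, ρ, hD, hρ, hρ1, hb⟩ := hx.exists_norm_lagVec_le ha
  obtain ⟨K, hK, hV⟩ := hε.integral_envelope_le hρ hρ1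
  set G : ℤ → Ω → ℝ := fun t ω =>
    (2 + ε t ω ^ 8) + 8 * D ^ 4 * (1 + envelope ρ ε (t - 1).toNat ω ^ 8) with hG
  have hG0 : ∀ t ω, 0 ≤ G t ω := fun t ω => by simp only [hG]; positivity
  have hi1 : ∀ t, Integrable (fun ω => 2 + ε t ω ^ 8) μ := fun t =>
    (integrable_const 2).add (hε.integrable_pow_eight _)
  have hi2 : ∀ k, Integrable (fun ω => 1 + envelope ρ ε k ω ^ 8) μ := fun k =>
    (integrable_const 1).add (hV k).1
  have hGi : ∀ t, Integrable (G t) μ := fun t => (hi1 t).add ((hi2 _).const_mul _)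
  have hGle : ∀ t, ∫ ω, G t ω ∂μ ≤ (2 + ∫ ω, ε 0 ω ^ 8 ∂μ) + 8 * D ^ 4 * (1 + K) := by
    intro t
    simp only [hG]
    rw [integral_add (hi1 t) ((hi2 _).const_mul _), integral_const_mul,
      integral_add (integrable_const 2) (hε.integrable_pow_eight _),
      integral_add (integrable_const 1) (hV _).1,
      hε.integral_comp (f := fun y => y ^ 8) (by fun_prop)]
    simp only [integral_const, probReal_univ, one_smul]
    have := (hV (t - 1).toNat).2
    gcongr
  have hmean : BddInProb μ (fun n ω => 1 / (n : ℝ) * ∑ t ∈ Finset.Icc (1 : ℤ) n, G t ω) := by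
    refine .of_integral_abs_le ((2 + ∫ ω, ε 0 ω ^ 8 ∂μ) + 8 * D ^ 4 * (1 + K))
      (Eventually.of_forall fun n => (integrable_finsetSum _ fun t _ => hGi t).const_mul _) ?_
    filter_upwards [eventually_gt_atTop 0] with n hn
    have hn' : (0 : ℝ) < n := by exact_mod_cast hn
    have hpos : ∀ ω, 0 ≤ 1 / (n : ℝ) * ∑ t ∈ Finset.Icc (1 : ℤ) n, G t ω := fun ω =>
      mul_nonneg (by positivity) (Finset.sum_nonneg fun t _ => hG0 t ω)
    simp only [abs_of_nonneg (hpos _)]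
    rw [integral_const_mul, integral_finsetSum _ fun t _ => hGi t, one_div, inv_mul_eq_div,
      div_le_iff₀ hn']
    refine (Finset.sum_le_card_nsmul _ _ _ fun t _ => hGle t).trans_eq ?_
    rw [Int.card_Icc, add_sub_cancel_right, Int.toNat_natCast, nsmul_eq_mul, mul_comm]
  refine (hmean.add ((hx.init.pow 4).const_mul (8 * D ^ 4))).mono ?_
  filter_upwards [eventually_gt_atTop 0] with n hn ω
  have hn' : (0 : ℝ) < n := by exact_mod_cast hn
  set R := ‖lagVec p (fun s => x n s ω) 0‖ with hR
  have hR0 : 0 ≤ R := norm_nonneg _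
  rw [abs_of_nonneg (mul_nonneg (by positivity) (Finset.sum_nonneg fun t _ =>
    weight_nonneg _ _ t))]
  refine le_trans ?_ (le_abs_self _)
  have hpt : ∀ t ∈ Finset.Icc (1 : ℤ) n,
      weight p (fun s => ε s ω) (fun s => x n s ω) t ≤ G t ω + 8 * D ^ 4 * R ^ 4 := by
    intro t ht
    rw [Finset.mem_Icc] at ht
    have hk : (((t - 1).toNat : ℕ) : ℤ) = t - 1 := by omega
    have h1 := hb n (t - 1).toNat ω (by omega)
    rw [hk] at h1
    set v := envelope ρ ε (t - 1).toNat ω with hv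
    have hv0 : 0 ≤ v := envelope_nonneg hρ.le _ _
    have h2 : ‖lagVec p (fun s => x n s ω) (t - 1)‖ ^ 4 ≤ (D * (v + R)) ^ 4 :=
      pow_le_pow_left₀ (norm_nonneg _) h1 4
    have h3 : (v + R) ^ 4 ≤ 8 * (v ^ 4 + R ^ 4) := by
      exact (add_pow_le hv0 hR0 4).trans_eq (by norm_num)
    have h4 := abs_pow_le_one_add_pow_eight v (k := 4) (by norm_num)
    rw [abs_of_nonneg hv0] at h4
    have h5 := abs_pow_le_one_add_pow_eight (ε t ω) (k := 4) (by norm_num)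
    rw [Even.pow_abs (by decide)] at h5
    have h6 : D ^ 4 * (v + R) ^ 4 ≤ D ^ 4 * (8 * ((1 + v ^ 8) + R ^ 4)) := by
      gcongr
      linarith
    rw [mul_pow] at h2
    simp only [weight, hG]
    linarith
  have h7 := Finset.sum_le_sum hpt
  rw [Finset.sum_add_distrib, Finset.sum_const, Int.card_Icc] at h7
  have h8 := mul_le_mul_of_nonneg_left h7 (show 0 ≤ 1 / (n : ℝ) by positivity)
  refine h8.trans_eq ?_
  simp only [add_sub_cancel_right, Int.toNat_natCast, nsmul_eq_mul, mul_add]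
  field_simp

/-- With probability tending to one, ∑ u_t² is of order n and dominates the O_P(√n) error of the
quadratic lower bound, so the Gram matrix is at least a multiple of n. The score of the
least-squares problem is a martingale sum of order √n, and the normal equations give the rate. -/
theorem bddInProb_sqrt_mul_norm_gls_sub (hx : BoundedVolAR μ a c H h ε x) (hε : Noise μ ε)
    (ha : Stable a) :
    BddInProb μ (fun n ω => √(n : ℝ) * ‖gls p n (h n) (fun s => x n s ω) - a‖) := by
  have hc := hx.pos
  have hH : 0 < H := hc.trans_le
    ((hx.bounds 1 1 le_rfl (by simp)).1.trans (hx.bounds 1 1 le_rfl (by simp)).2)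
  obtain ⟨c₁, C₁, hc₁, hC₁, hquad⟩ := sum_sq_dotProduct_ge a
  have hlin : ∀ (w : ℕ → ℤ → ℝ) (B : ℝ),
      (∀ (n : ℕ) (t : ℤ), 1 ≤ t → t ≤ n → |w n t| ≤ B) →
      BddInProb μ (fun n ω => ∑ j, |(√(n : ℝ))⁻¹ * ∑ t ∈ Finset.Icc (1 : ℤ) n,
        w n t * ε t ω * lagVec p (fun s => x n s ω) (t - 1) j|) := by
    intro w B hw
    refine BddInProb.sum _ fun j _ => BddInProb.abs ?_
    have h1 := hx.bddInProb_linear_sum hε ha (η := fun y => y) measurable_id hε.mean_zero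
      (hε.integrable_pow (by norm_num) 0) (l := 1) (r := 0) (q := 0) le_rfl (by norm_num)
      (w := fun n t => if t ≤ 0 then 0 else w n t) (B := B)
      (fun n t h1 hn => by rw [if_neg (by omega)]; exact hw n t h1 hn)
      (fun n t ht => by rw [if_pos (by simpa using ht)]) j
    refine h1.mono (Eventually.of_forall fun n ω => le_of_eq ?_)
    congr 2
    refine Finset.sum_congr rfl fun t ht => ?_
    rw [Finset.mem_Icc] at ht
    rw [if_neg (by omega)]
    push_cast
    rw [sub_zero]
    ring
  have hZ₁ := hlin h H fun n t h1 hn => hx.abs_vol_le n t h1 hn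
  have hZ₂ := hlin (fun n t => (h n t ^ 2)⁻¹ * h n t) (1 / c) fun n t h1 hn => by
    have hb := (hx.bounds n t h1 hn).1
    have hpos : 0 < h n t := hc.trans_le hb
    rw [show (h n t ^ 2)⁻¹ * h n t = 1 / h n t by field_simp, abs_of_pos (by positivity)]
    gcongr
  have hD := hε.bddInProb_sum_sub_integral (k := 2) (by norm_num)
  rw [hε.integral_sq] at hD
  -- Half of the leading constant c₁c²; the other half absorbs the fluctuations.
  set κ₀ : ℝ := c₁ * c ^ 2 / 2 with hκ₀
  -- The unfavourable event, shown below to be negligible, is that these fluctuations reach κ₀√n.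
  have hκ₀pos : 0 < κ₀ := by positivity
  have hbad := ((hD.abs.const_mul (c₁ * c ^ 2)).add
    ((hZ₁.add ((hx.bddInProb_norm_lagVec hε ha).pow 2)).const_mul C₁)).tendsto_measureReal_ge
    (c := fun n => κ₀ * √(n : ℝ))
    ((Real.tendsto_sqrt_atTop.comp tendsto_natCast_atTop_atTop).const_mul_atTop hκ₀pos)
  refine (hZ₂.const_mul (H ^ 2 / κ₀)).mono_whp
    (squeeze_zero' (Eventually.of_forall fun n => measureReal_nonneg) ?_ hbad)
  filter_upwards [eventually_ge_atTop 1] with n hn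
  refine measureReal_mono fun ω hω => ?_
  by_contra hcon
  refine hω ?_
  simp only [Set.mem_ofPred_eq, not_le] at hcon
  have hcon := (le_abs_self _).trans_lt hcon
  have hn0 : (0 : ℝ) < n := by exact_mod_cast hn
  have hsn : 0 < √(n : ℝ) := Real.sqrt_pos.2 hn0
  have hsq : √(n : ℝ) * √(n : ℝ) = n := Real.mul_self_sqrt hn0.le
  have hs1 : 1 ≤ √(n : ℝ) := Real.one_le_sqrt.2 (by exact_mod_cast hn)
  set y : ℤ → ℝ := fun s => x n s ω with hy
  set Z := ∑ j, |(√(n : ℝ))⁻¹ * ∑ t ∈ Finset.Icc (1 : ℤ) n,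
    h n t * ε t ω * lagVec p y (t - 1) j| with hZ
  set D := (√(n : ℝ))⁻¹ * ∑ t ∈ Finset.Icc (1 : ℤ) n, (ε t ω ^ 2 - 1) with hDdef
  set L := ‖lagVec p y n‖ with hL
  have hZ0 : 0 ≤ Z := Finset.sum_nonneg fun j _ => abs_nonneg _
  have har : ∀ t, 1 ≤ t → t ≤ (n : ℤ) → y t = a ⬝ᵥ lagVec p y (t - 1) + h n t * ε t ω :=
    fun t h1 hn => hx.ar n ω t h1 hn
  -- The choice κ = √n(Z + L²) covers both requirements: the cross sums are at most √n Z, and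
  -- ‖x̲_n‖² = L² ≤ √n L².
  have hq := hquad n y (fun t => h n t * ε t ω) (√(n : ℝ) * (Z + L ^ 2)) har
    (fun j => by
      have h1 := Finset.single_le_sum (f := fun j => |(√(n : ℝ))⁻¹ *
        ∑ t ∈ Finset.Icc (1 : ℤ) n, h n t * ε t ω * lagVec p y (t - 1) j|)
        (fun j _ => abs_nonneg _) (Finset.mem_univ j)
      simp only [abs_mul, abs_of_pos (inv_pos.2 hsn)] at h1
      rw [inv_mul_le_iff₀ hsn] at h1
      refine h1.trans (mul_le_mul_of_nonneg_left ?_ hsn.le)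
      simp only [hZ, abs_mul, abs_of_pos (inv_pos.2 hsn)]
      linarith [sq_nonneg L])
    (by nlinarith [sq_nonneg L])
  have hU : c ^ 2 * (n - √(n : ℝ) * |D|)
      ≤ ∑ t ∈ Finset.Icc (1 : ℤ) n, (h n t * ε t ω) ^ 2 := by
    have h1 : ∑ t ∈ Finset.Icc (1 : ℤ) n, ε t ω ^ 2 = n + √(n : ℝ) * D := by
      rw [hDdef, mul_inv_cancel_left₀ hsn.ne', Finset.sum_sub_distrib]
      simp
    have h2 : c ^ 2 * ∑ t ∈ Finset.Icc (1 : ℤ) n, ε t ω ^ 2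
        ≤ ∑ t ∈ Finset.Icc (1 : ℤ) n, (h n t * ε t ω) ^ 2 := by
      rw [Finset.mul_sum]
      refine Finset.sum_le_sum fun t ht => ?_
      rw [Finset.mem_Icc] at ht
      rw [mul_pow]
      have := (hx.bounds n t ht.1 ht.2).1
      gcongr
    refine le_trans (mul_le_mul_of_nonneg_left ?_ (sq_nonneg c)) h2
    rw [h1]
    nlinarith [neg_abs_le D]
  have hlow : ∀ l : Fin p → ℝ, κ₀ * n / H ^ 2 * ‖l‖ ^ 2 ≤ ∑ t ∈ Finset.Icc (1 : ℤ) n,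
      (h n t ^ 2)⁻¹ * (l ⬝ᵥ lagVec p y (t - 1)) ^ 2 := by
    intro l
    have h1 : κ₀ * n ≤ c₁ * (∑ t ∈ Finset.Icc (1 : ℤ) n, (h n t * ε t ω) ^ 2)
        - C₁ * (√(n : ℝ) * (Z + L ^ 2)) := by
      have h2 := mul_le_mul_of_nonneg_left hU hc₁.le
      have h3 := mul_le_mul_of_nonneg_left hcon.le hsn.le
      have h4 : √(n : ℝ) * (κ₀ * √(n : ℝ)) = κ₀ * n := by
        linear_combination κ₀ * hsq
      rw [h4] at h3
      have h5 : c₁ * (c ^ 2 * (n - √(n : ℝ) * |D|))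
          = 2 * (κ₀ * n) - √(n : ℝ) * (c₁ * c ^ 2 * |D|) := by rw [hκ₀]; ring
      rw [h5] at h2
      nlinarith
    calc κ₀ * n / H ^ 2 * ‖l‖ ^ 2 = (H ^ 2)⁻¹ * (κ₀ * n * ‖l‖ ^ 2) := by field_simp
      _ ≤ (H ^ 2)⁻¹ * ∑ t ∈ Finset.Icc (1 : ℤ) n, (l ⬝ᵥ lagVec p y (t - 1)) ^ 2 := by
          gcongr
          refine le_trans ?_ (hq l)
          gcongr
      _ ≤ _ := by
          rw [Finset.mul_sum]
          refine Finset.sum_le_sum fun t ht => ?_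
          rw [Finset.mem_Icc] at ht
          have hb := hx.bounds n t ht.1 ht.2
          have hpos : 0 < h n t := hc.trans_le hb.1
          gcongr
          exact hb.2
  have hfin := norm_gls_sub_le (show 0 < κ₀ * n / H ^ 2 by positivity) har hlow
  rw [abs_of_nonneg (by positivity)]
  refine le_trans ?_ (le_abs_self _)
  have h6 : ∑ j, |∑ t ∈ Finset.Icc (1 : ℤ) n,
      (h n t ^ 2)⁻¹ * (h n t * ε t ω) * lagVec p y (t - 1) j|
      = √(n : ℝ) * ∑ j, |(√(n : ℝ))⁻¹ * ∑ t ∈ Finset.Icc (1 : ℤ) n,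
        (h n t ^ 2)⁻¹ * h n t * ε t ω * lagVec p y (t - 1) j| := by
    rw [Finset.mul_sum]
    refine Finset.sum_congr rfl fun j _ => ?_
    rw [abs_mul, abs_of_pos (inv_pos.2 hsn), mul_inv_cancel_left₀ hsn.ne']
    simp only [mul_assoc]
  rw [h6] at hfin
  set T := ∑ j, |(√(n : ℝ))⁻¹ * ∑ t ∈ Finset.Icc (1 : ℤ) n,
        (h n t ^ 2)⁻¹ * h n t * ε t ω * lagVec p y (t - 1) j|
  rw [div_mul_eq_mul_div, div_le_iff₀ (by positivity)] at hfin
  rw [div_mul_eq_mul_div, le_div_iff₀ hκ₀pos]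
  refine le_of_mul_le_mul_left ?_ hsn
  calc √(n : ℝ) * (√(n : ℝ) * ‖gls p n (h n) y - a‖ * κ₀)
      = κ₀ * (√(n : ℝ) * √(n : ℝ)) * ‖gls p n (h n) y - a‖ := by ring
    _ ≤ √(n : ℝ) * T * H ^ 2 := by rw [hsq]; exact hfin
    _ = _ := by ring

end BoundedVolAR

/-! ### Asymptotic expansion of the score and of the empirical moments -/

namespace BoundedVolAR

variable {Ω : Type*} [MeasurableSpace Ω] {μ : Measure Ω} [IsProbabilityMeasure μ]
  {ε : ℤ → Ω → ℝ} {p : ℕ} {a : Fin p → ℝ} {c H : ℝ} {h : ℕ → ℤ → ℝ} {x : ℕ → ℤ → Ω → ℝ}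

theorem tendsto_const_div_sqrt (r : ℝ) : Tendsto (fun n : ℕ => r / √(n : ℝ)) atTop (𝓝 0) :=
  (Real.tendsto_sqrt_atTop.comp tendsto_natCast_atTop_atTop).const_div_atTop r

theorem abs_lag_ratio_le (hx : BoundedVolAR μ a c H h ε x) (l i j : ℕ) (n : ℕ) (t : ℤ)
    (h1 : 1 ≤ t) (hn : t ≤ n) :
    |if (l : ℤ) < t then h n (t - l) ^ i / h n t ^ j else 0| ≤ H ^ i / c ^ j := by
  have hc := hx.pos
  have hb := hx.bounds n t h1 hn
  have hH : 0 ≤ H := hc.le.trans (hb.1.trans hb.2)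
  split_ifs with hlt
  · have hb' := hx.bounds n (t - l) (by omega) (by omega)
    have hp := hc.trans_le hb.1
    have hp' := hc.trans_le hb'.1
    rw [abs_of_nonneg (by positivity)]
    gcongr
    · exact hb'.2
    · exact hb.1
  · simp
    positivity

theorem integral_sq_sub_one (hε : Noise μ ε) : ∫ ω, (ε 0 ω ^ 2 - 1) ∂μ = 0 := by
  rw [integral_sub (hε.integrable_pow (by norm_num) 0) (integrable_const _), hε.integral_sq]
  simp

theorem integrable_sq_sub_one_sq (hε : Noise μ ε) :
    Integrable (fun ω => (ε 0 ω ^ 2 - 1) ^ 2) μ := by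
  have h1 := ((hε.integrable_pow (k := 4) (by norm_num) 0).sub
    ((hε.integrable_pow (k := 2) (by norm_num) 0).const_mul 2)).add (integrable_const (1 : ℝ))
  refine h1.congr (Eventually.of_forall fun ω => ?_)
  simp only [Pi.add_apply, Pi.sub_apply]
  ring

/-- The score at the estimator is asymptotically equivalent to the score at the truth. -/
theorem tendstoInMeasure_score_sub (hx : BoundedVolAR μ a c H h ε x) (hε : Noise μ ε)
    (ha : Stable a) {m : ℕ} (i : Fin m) {l : ℕ} (hl : l = (i : ℕ) + 1) :
    TendstoInMeasure μ (fun n ω =>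
      score m n (h n) (fun s => x n s ω) (gls p n (h n) (fun s => x n s ω)) i
        - 1 / (2 * √(n : ℝ)) * ∑ t ∈ Finset.Icc (1 : ℤ) n, (ε t ω ^ 2 - 1) *
          (if (l : ℤ) < t then h n (t - l) ^ 2 / h n t ^ 2 else 0) * ε (t - l) ω ^ 2)
      atTop (fun _ => 0) := by
  have hc := hx.pos
  set K := (1 / c ^ 2 + (5 * H ^ 2 + 2) / c ^ 4) with hK
  have hK0 : 0 ≤ K := by positivity
  have hD := hx.bddInProb_sqrt_mul_norm_gls_sub hε ha
  have hW := hx.bddInProb_mean_weight hε ha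
  have hA := BddInProb.sum Finset.univ fun j (_ : j ∈ Finset.univ) =>
    (hx.bddInProb_linear_sum hε ha (η := fun y => y ^ 2 - 1) (by fun_prop)
      (integral_sq_sub_one hε) (integrable_sq_sub_one_sq hε) (l := l) (r := l) (q := 1)
      (by omega) (by norm_num)
      (w := fun n t => if (l : ℤ) < t then h n (t - l) ^ 1 / h n t ^ 2 else 0)
      (hx.abs_lag_ratio_le l 1 2) (fun n t ht => if_neg (by omega)) j).abs
  have hB := BddInProb.sum Finset.univ fun j (_ : j ∈ Finset.univ) =>
    (hx.bddInProb_linear_sum hε ha (η := fun y => y) measurable_id hε.mean_zero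
      (hε.integrable_pow (by norm_num) 0) (l := l) (r := 0) (q := 2) (by omega) le_rfl
      (w := fun n t => if (l : ℤ) < t then h n (t - l) ^ 2 / h n t ^ 3 else 0)
      (hx.abs_lag_ratio_le l 2 3) (fun n t ht => if_neg (by push_cast at ht; omega)) j).abs
  -- This dominates 2√n times the difference of the scores: a linear part √n‖δ‖(A + B) and a
  -- quadratic part of size (√n‖δ‖)² times the mean weight. The factor 1/(2√n) then sends the
  -- difference to zero.
  have hX := ((hD.mul (hA.add hB)).const_mul 2).add
    (((hD.pow 2).mul (((BddInProb.const 1).add (hD.const_mul p)).pow 2)).mul hW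
      |>.const_mul (2 * K * p ^ 2))
  refine hX.tendstoInMeasure_zero (tendsto_const_div_sqrt (1 / 2)) ?_
  filter_upwards [eventually_ge_atTop 1] with n hn ω
  have hn0 : (0 : ℝ) < n := by exact_mod_cast hn
  have hsn : 0 < √(n : ℝ) := Real.sqrt_pos.2 hn0
  have hsq : √(n : ℝ) * √(n : ℝ) = n := Real.mul_self_sqrt hn0.le
  have hs1 : 1 ≤ √(n : ℝ) := Real.one_le_sqrt.2 (by exact_mod_cast hn)
  set y : ℤ → ℝ := fun s => x n s ω with hy
  have hexp := abs_score_sub_le (m := m) (x := y)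
    (θ := gls p n (h n) y) hc (hx.bounds n) (e := fun s => ε s ω)
    (fun t h1 hn => hx.ar n ω t h1 hn) i l hl
  set δ := ‖gls p n (h n) y - a‖ with hδ
  have hδ0 : 0 ≤ δ := norm_nonneg _
  set S := ∑ t ∈ Finset.Icc (1 : ℤ) n, (ε t ω ^ 2 - 1) *
    (if (l : ℤ) < t then h n (t - l) ^ 2 / h n t ^ 2 else 0) * ε (t - l) ω ^ 2 with hS
  set W := 1 / (n : ℝ) * ∑ t ∈ Finset.Icc (1 : ℤ) n, weight p (fun s => ε s ω) y t with hWd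
  have hW0 : 0 ≤ W := mul_nonneg (by positivity) (Finset.sum_nonneg fun t _ => weight_nonneg _ _ t)
  have hWn : ∑ t ∈ Finset.Icc (1 : ℤ) n, weight p (fun s => ε s ω) y t = n * W := by
    rw [hWd]
    field_simp
  have hscale : ∀ f : Fin p → ℝ, ∑ j, |f j| = √(n : ℝ) * ∑ j, |(√(n : ℝ))⁻¹ * f j| := by
    intro f
    rw [Finset.mul_sum]
    refine Finset.sum_congr rfl fun j _ => ?_
    rw [abs_mul, abs_of_pos (inv_pos.2 hsn), mul_inv_cancel_left₀ hsn.ne']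
  rw [hWn] at hexp
  simp only [pow_one, Nat.cast_zero, sub_zero] at hexp ⊢
  set A := ∑ j, |(√(n : ℝ))⁻¹ * ∑ t ∈ Finset.Icc (1 : ℤ) n, (ε t ω ^ 2 - 1) *
    ((if (l : ℤ) < t then h n (t - l) / h n t ^ 2 else 0) * ε (t - l) ω
      * lagVec p y (t - 1 - l) j)| with hAd
  set B := ∑ j, |(√(n : ℝ))⁻¹ * ∑ t ∈ Finset.Icc (1 : ℤ) n, ε t ω *
    ((if (l : ℤ) < t then h n (t - l) ^ 2 / h n t ^ 3 else 0) * ε (t - l) ω ^ 2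
      * lagVec p y (t - 1) j)| with hBd
  set s := √(n : ℝ) with hs
  have hAs : ∑ j, |∑ t ∈ Finset.Icc (1 : ℤ) n, (ε t ω ^ 2 - 1) *
      ((if (l : ℤ) < t then h n (t - l) / h n t ^ 2 else 0) * ε (t - l) ω
        * lagVec p y (t - 1 - l) j)| = s * A := hscale _
  have hBs : ∑ j, |∑ t ∈ Finset.Icc (1 : ℤ) n, ε t ω *
      ((if (l : ℤ) < t then h n (t - l) ^ 2 / h n t ^ 3 else 0) * ε (t - l) ω ^ 2
        * lagVec p y (t - 1) j)| = s * B := hscale _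
  rw [hAs, hBs] at hexp
  have hkey : |2 * s * score m n (h n) y (gls p n (h n) y) i - S|
      ≤ 2 * (s * δ * (A + B))
        + 2 * K * p ^ 2 * ((s * δ) ^ 2 * (1 + p * (s * δ)) ^ 2 * W) := by
    refine hexp.trans ?_
    have h1 : δ * (2 * (s * A) + 2 * (s * B)) = 2 * (s * δ * (A + B)) := by ring
    have h2 : K * ((p * δ) ^ 2 * (1 + p * δ) ^ 2) * (2 * (n * W))
        = 2 * K * p ^ 2 * ((s * δ) ^ 2 * (1 + p * δ) ^ 2 * W) := by
      rw [← hsq]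
      ring
    rw [h1, h2]
    have h3 : δ ≤ s * δ := le_mul_of_one_le_left hδ0 hs1
    gcongr
  have h4 : score m n (h n) y (gls p n (h n) y) i - 1 / (2 * s) * S
      = 1 / 2 / s * (2 * s * score m n (h n) y (gls p n (h n) y) i - S) := by
    field_simp
  rw [h4, abs_mul, abs_of_pos (show 0 < 1 / 2 / s by positivity)]
  exact mul_le_mul_of_nonneg_left (hkey.trans (le_abs_self _)) (by positivity)

/-- Both errors are O_P(n^{-1/2}): replacing residuals by the noise costs a multiple of ‖θ̂ − a‖
times the mean weight, and the average of ε_t^k is handled by Chebyshev's inequality. -/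
theorem tendstoInMeasure_empMoment (hx : BoundedVolAR μ a c H h ε x) (hε : Noise μ ε)
    (ha : Stable a) {k : ℕ} (hk : k = 2 ∨ k = 4) :
    TendstoInMeasure μ (fun n ω => empMoment p n k (h n) (fun s => x n s ω)) atTop
      (fun _ => ∫ ω, ε 0 ω ^ k ∂μ) := by
  have hc := hx.pos
  have hD := hx.bddInProb_sqrt_mul_norm_gls_sub hε ha
  have hW := hx.bddInProb_mean_weight hε ha
  have hE := hε.bddInProb_sum_sub_integral (k := k) (by omega)
  have hD' := hD.const_mul (p / c)
  have hX := (((hD'.mul (((BddInProb.const 1).add hD').pow 3)).mul hW).const_mul 15).add hE.abs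
  suffices hs : TendstoInMeasure μ (fun n ω => empMoment p n k (h n) (fun s => x n s ω)
      - ∫ ω, ε 0 ω ^ k ∂μ) atTop (fun _ => 0) by
    rw [tendstoInMeasure_iff_norm] at hs ⊢
    simpa only [sub_zero] using hs
  refine hX.tendstoInMeasure_zero (tendsto_const_div_sqrt 1) ?_
  filter_upwards [eventually_ge_atTop 1] with n hn ω
  have hn0 : (0 : ℝ) < n := by exact_mod_cast hn
  have hsn : 0 < √(n : ℝ) := Real.sqrt_pos.2 hn0
  have hsq : √(n : ℝ) * √(n : ℝ) = n := Real.mul_self_sqrt hn0.le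
  have hs1 : 1 ≤ √(n : ℝ) := Real.one_le_sqrt.2 (by exact_mod_cast hn)
  set y : ℤ → ℝ := fun s => x n s ω with hy
  have hexp := abs_empMoment_sub_le hk hc (fun t h1 hn => (hx.bounds n t h1 hn).1)
    (e := fun s => ε s ω) (fun t h1 hn => hx.ar n ω t h1 hn) rfl
  set δ := ‖gls p n (h n) y - a‖ with hδ
  set W := 1 / (n : ℝ) * ∑ t ∈ Finset.Icc (1 : ℤ) n, weight p (fun s => ε s ω) y t with hWd
  have hW0 : 0 ≤ W := mul_nonneg (by positivity) (Finset.sum_nonneg fun t _ => weight_nonneg _ _ t)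
  set s := √(n : ℝ) with hs
  set Δ := p / c * (s * δ) with hΔ
  have hΔ0 : 0 ≤ Δ := by positivity
  set E := ∫ ω, ε 0 ω ^ k ∂μ with hEd
  set Y := s⁻¹ * ∑ t ∈ Finset.Icc (1 : ℤ) n, (ε t ω ^ k - E) with hY
  have h1 : p * δ / c = Δ / s := by
    rw [hΔ]
    field_simp
  have h2 : 1 / (n : ℝ) * ∑ t ∈ Finset.Icc (1 : ℤ) n, ε t ω ^ k - E = 1 / s * Y := by
    rw [hY, Finset.sum_sub_distrib, Finset.sum_const, Int.card_Icc, add_sub_cancel_right,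
      Int.toNat_natCast, nsmul_eq_mul, ← hsq]
    field_simp
  rw [h1] at hexp
  have h3 : Δ / s ≤ Δ := div_le_self hΔ0 hs1
  have h4 : 15 * (Δ / s * (1 + Δ / s) ^ 3) * W ≤ 1 / s * (15 * (Δ * (1 + Δ) ^ 3 * W)) := by
    calc 15 * (Δ / s * (1 + Δ / s) ^ 3) * W ≤ 15 * (Δ / s * (1 + Δ) ^ 3) * W := by gcongr
      _ = _ := by ring
  have h5 : |1 / s * Y| = 1 / s * |Y| := by rw [abs_mul, abs_of_pos (by positivity)]
  calc |empMoment p n k (h n) y - E|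
      = |(empMoment p n k (h n) y - 1 / (n : ℝ) * ∑ t ∈ Finset.Icc (1 : ℤ) n, ε t ω ^ k)
          + 1 / s * Y| := by
        rw [← h2]
        congr 1
        ring
    _ ≤ 1 / s * (15 * (Δ * (1 + Δ) ^ 3 * W)) + 1 / s * |Y| := by
        rw [← h5]
        exact (abs_add_le _ _).trans (add_le_add (hexp.trans h4) le_rfl)
    _ = 1 / s * (15 * (Δ * (1 + Δ) ^ 3 * W) + |Y|) := by ring
    _ ≤ _ := mul_le_mul_of_nonneg_left (le_abs_self _) (by positivity)

end BoundedVolAR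

/-- Weights which are close to one in mean square can be removed from the score. -/
theorem Noise.tendstoInMeasure_weighted_sub {Ω : Type*} [MeasurableSpace Ω] {μ : Measure Ω}
    [IsProbabilityMeasure μ] {ε : ℤ → Ω → ℝ} (hε : Noise μ ε) {l : ℕ} (hl : 1 ≤ l)
    {w : ℕ → ℤ → ℝ} {C : ℝ} (hw : ∀ n : ℕ, ∑ t ∈ Finset.Icc (1 : ℤ) n, (w n t - 1) ^ 2 ≤ C) :
    TendstoInMeasure μ (fun (n : ℕ) ω =>
      1 / (2 * √(n : ℝ)) * ∑ t ∈ Finset.Icc (1 : ℤ) n, (ε t ω ^ 2 - 1) * w n t * ε (t - l) ω ^ 2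
      - 1 / (2 * √(n : ℝ)) * ∑ t ∈ Finset.Icc (1 : ℤ) n, (ε t ω ^ 2 - 1) * ε (t - l) ω ^ 2)
      atTop (fun _ => 0) := by
  have hF : ∀ (n : ℕ) (t : ℤ), Integrable (fun ω => ((w n t - 1) * ε (t - l) ω ^ 2) ^ 2) μ ∧
      ∫ ω, ((w n t - 1) * ε (t - l) ω ^ 2) ^ 2 ∂μ
        = (w n t - 1) ^ 2 * ∫ ω, ε 0 ω ^ 4 ∂μ := by
    intro n t
    have h1 : (fun ω => ((w n t - 1) * ε (t - l) ω ^ 2) ^ 2)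
        = fun ω => (w n t - 1) ^ 2 * ε (t - l) ω ^ 4 := by
      ext ω
      ring
    rw [h1, integral_const_mul, hε.integral_comp (f := fun y => y ^ 4) (by fun_prop)]
    exact ⟨(hε.integrable_pow (by norm_num) _).const_mul _, rfl⟩
  have h := fun n : ℕ => hε.integral_sq_sum (η := fun y => y ^ 2 - 1) (by fun_prop)
    (BoundedVolAR.integral_sq_sub_one hε) (BoundedVolAR.integrable_sq_sub_one_sq hε)
    (s := Finset.Icc (1 : ℤ) n) (F := fun t ω => (w n t - 1) * ε (t - l) ω ^ 2)
    (fun t _ => ((measurable_info (by simp; omega)).pow_const 2).const_mul _)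
    (fun t _ => (hF n t).1)
  have hv : 0 ≤ ∫ ω, (ε 0 ω ^ 2 - 1) ^ 2 ∂μ := integral_nonneg fun ω => sq_nonneg _
  have h4 : 0 ≤ ∫ ω, ε 0 ω ^ 4 ∂μ := integral_nonneg fun ω => by positivity
  -- By orthogonality the second moment of the unnormalized difference is a constant times ∑ (w −
  -- 1)², which is bounded; hence the factor 1/√n is all gain.
  have hb : BddInProb μ (fun (n : ℕ) ω => ∑ t ∈ Finset.Icc (1 : ℤ) n,
      (ε t ω ^ 2 - 1) * ((w n t - 1) * ε (t - l) ω ^ 2)) := by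
    refine .of_integral_sq_le ((∫ ω, (ε 0 ω ^ 2 - 1) ^ 2 ∂μ) * (C * ∫ ω, ε 0 ω ^ 4 ∂μ))
      (Eventually.of_forall fun n => (h n).1) (Eventually.of_forall fun n => ?_)
    rw [(h n).2]
    simp only [(hF _ _).2]
    rw [← Finset.sum_mul]
    have := hw n
    gcongr
  refine hb.tendstoInMeasure_zero (BoundedVolAR.tendsto_const_div_sqrt (1 / 2))
    (Eventually.of_forall fun n ω => ?_)
  rw [← mul_sub, ← Finset.sum_sub_distrib, abs_mul, abs_of_nonneg (by positivity)]
  refine le_of_eq ?_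
  congr 1
  · rw [div_div]
  · congr 1
    exact Finset.sum_congr rfl fun t _ => by ring

/-! ### Piecewise Lipschitz volatilities -/

theorem VolatilityFunction.exists_bounds {g : ℝ → ℝ} (hg : VolatilityFunction g) :
    ∃ c H : ℝ, 0 < c ∧ ∀ (n : ℕ) (t : ℤ), 1 ≤ t → t ≤ n → c ≤ vol g n t ∧ vol g n t ≤ H := by
  obtain ⟨c, hc, hcg⟩ := hg.bounded_below
  obtain ⟨H, hH⟩ := hg.bounded
  refine ⟨c, H, hc, fun n t h1 hn => ?_⟩
  have ht : (t : ℝ) / n ∈ Set.Ioc (0 : ℝ) 1 := by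
    have h1' : (1 : ℝ) ≤ t := by exact_mod_cast h1
    have hn' : (t : ℝ) ≤ n := by exact_mod_cast hn
    exact ⟨by apply div_pos <;> linarith, div_le_one_of_le₀ hn' (by linarith)⟩
  exact ⟨hcg _ ht, hH ⟨_, ht, rfl⟩⟩

/-- At most `l` integer points leave an interval when shifted by `l`. -/
theorem card_filter_lag_le {I : Set ℝ} (hI : I.OrdConnected) (n l : ℕ)
    [DecidablePred fun t : ℤ => (t : ℝ) / n ∈ I ∧ ((t - l : ℤ) : ℝ) / n ∉ I] :
    ((Finset.Icc (1 : ℤ) n).filter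
      fun t : ℤ => (t : ℝ) / n ∈ I ∧ ((t - l : ℤ) : ℝ) / n ∉ I).card ≤ l := by
  set B := (Finset.Icc (1 : ℤ) n).filter
      fun t : ℤ => (t : ℝ) / n ∈ I ∧ ((t - l : ℤ) : ℝ) / n ∉ I with hB
  rcases B.eq_empty_or_nonempty with h | h
  · simp [h]
  · have hsub : B ⊆ Finset.Ico (B.min' h) (B.min' h + l) := by
      intro t ht
      have hmin := B.min'_le t ht
      have hm := B.min'_mem h
      have ht := Finset.mem_filter.1 ht
      have hm := Finset.mem_filter.1 hm
      rw [Finset.mem_Ico]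
      refine ⟨hmin, ?_⟩
      by_contra hcon
      refine ht.2.2 (hI.out hm.2.1 ht.2.1 ⟨?_, ?_⟩)
      · have : ((B.min' h : ℤ) : ℝ) ≤ ((t - l : ℤ) : ℝ) := by
          exact_mod_cast (by omega : B.min' h ≤ t - l)
        gcongr
      · have : ((t - l : ℤ) : ℝ) ≤ t := by
          exact_mod_cast (by omega : t - (l : ℤ) ≤ t)
        gcongr
    simpa using Finset.card_le_card hsub

/-- Within one piece the ratio is 1 + O(1/n). At most l times per piece are separated from their lag
by a piece boundary, and the l first times carry the weight 0; each of these contributes at most M.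
-/
theorem VolatilityFunction.exists_sum_ratio_sub_one_sq_le {g : ℝ → ℝ}
    (hg : VolatilityFunction g) (l : ℕ) :
    ∃ C : ℝ, ∀ n : ℕ, ∑ t ∈ Finset.Icc (1 : ℤ) n,
      ((if (l : ℤ) < t then vol g n (t - l) ^ 2 / vol g n t ^ 2 else 0) - 1) ^ 2 ≤ C := by
  classical
  obtain ⟨c, H, hc, hb⟩ := hg.exists_bounds
  obtain ⟨k, I, hI, -, hU, hL⟩ := hg.piecewiseLipschitz
  choose K hK using hL
  set L : ℝ := ∑ j, (K j : ℝ) with hLd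
  have hL0 : 0 ≤ L := Finset.sum_nonneg fun j _ => (K j).2
  have hH : 0 ≤ H := hc.le.trans ((hb 1 1 le_rfl (by simp)).1.trans (hb 1 1 le_rfl (by simp)).2)
  set G : ℝ := (L * l * (2 * H) / c ^ 2) ^ 2 with hG
  set M : ℝ := (H ^ 2 / c ^ 2 + 1) ^ 2 with hM
  have hM0 : 0 ≤ M := sq_nonneg _
  refine ⟨G + M * ((∑ _j : Fin k, (l : ℝ)) + l), fun n => ?_⟩
  set bad : Fin k → ℤ → Prop := fun j t => (t : ℝ) / n ∈ I j ∧ ((t - l : ℤ) : ℝ) / n ∉ I j with hbad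
  have hpt : ∀ t ∈ Finset.Icc (1 : ℤ) n,
      ((if (l : ℤ) < t then vol g n (t - l) ^ 2 / vol g n t ^ 2 else 0) - 1) ^ 2
        ≤ G / n + M * ((∑ j, if bad j t then (1 : ℝ) else 0) + if t ≤ (l : ℤ) then 1 else 0) := by
    intro t ht
    rw [Finset.mem_Icc] at ht
    have hn1 : (1 : ℝ) ≤ n := by exact_mod_cast (by omega : 1 ≤ n)
    have hbt := hb n t ht.1 ht.2
    have hpos : 0 < vol g n t := hc.trans_le hbt.1
    have hG0 : 0 ≤ G / n := by positivity
    have hsum0 : 0 ≤ ∑ j, if bad j t then (1 : ℝ) else 0 :=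
      Finset.sum_nonneg fun j _ => by split_ifs <;> norm_num
    rcases le_or_gt t l with htl | htl
    · rw [if_neg (by omega), if_pos htl]
      have : (1 : ℝ) ≤ M := by
        rw [hM]
        exact one_le_pow₀ (by linarith [show 0 ≤ H ^ 2 / c ^ 2 by positivity])
      nlinarith [mul_nonneg hM0 hsum0]
    · rw [if_pos htl, if_neg (by omega), add_zero]
      have hbs := hb n (t - l) (by omega) (by omega)
      have hpos' : 0 < vol g n (t - l) := hc.trans_le hbs.1
      by_cases hex : ∃ j, bad j t
      · obtain ⟨j, hj⟩ := hex
        have h1 : (1 : ℝ) ≤ ∑ j, if bad j t then (1 : ℝ) else 0 := by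
          have := Finset.single_le_sum (f := fun j => if bad j t then (1 : ℝ) else 0)
            (fun j _ => by split_ifs <;> norm_num) (Finset.mem_univ j)
          simpa [hj] using this
        have h2 : vol g n (t - l) ^ 2 / vol g n t ^ 2 ≤ H ^ 2 / c ^ 2 := by
          gcongr
          · exact hbs.2
          · exact hbt.1
        have h3 : 0 ≤ vol g n (t - l) ^ 2 / vol g n t ^ 2 := by positivity
        have h4 : (vol g n (t - l) ^ 2 / vol g n t ^ 2 - 1) ^ 2 ≤ M := by
          rw [hM]
          refine sq_le_sq' ?_ ?_ <;> linarith
        nlinarith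
      · push Not at hex
        have htU : (t : ℝ) / n ∈ ⋃ j, I j := by
          rw [hU]
          have h1' : (1 : ℝ) ≤ t := by exact_mod_cast ht.1
          have hn' : (t : ℝ) ≤ n := by exact_mod_cast ht.2
          exact ⟨by apply div_pos <;> linarith, div_le_one_of_le₀ hn' (by linarith)⟩
        obtain ⟨j, hj⟩ := Set.mem_iUnion.1 htU
        have hj' : ((t - l : ℤ) : ℝ) / n ∈ I j := by
          by_contra hcon
          exact hex j ⟨hj, hcon⟩
        have hlip := (hK j).dist_le_mul _ hj' _ hj
        rw [Real.dist_eq, Real.dist_eq] at hlip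
        have hdist : |((t - l : ℤ) : ℝ) / n - t / n| = l / n := by
          rw [← sub_div, Int.cast_sub, Int.cast_natCast, sub_sub_cancel_left, abs_div, abs_neg,
            abs_of_nonneg (by positivity : (0 : ℝ) ≤ l), abs_of_nonneg (by positivity : (0 : ℝ) ≤ n)]
        rw [hdist] at hlip
        have hKL : (K j : ℝ) ≤ L :=
          Finset.single_le_sum (f := fun j => (K j : ℝ)) (fun j _ => (K j).2) (Finset.mem_univ j)
        have h1 : |vol g n (t - l) - vol g n t| ≤ L * (l / n) :=
          hlip.trans (by gcongr)
        have h2 : |vol g n (t - l) ^ 2 / vol g n t ^ 2 - 1| ≤ L * l * (2 * H) / c ^ 2 / n := by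
          have h3 : vol g n (t - l) ^ 2 / vol g n t ^ 2 - 1
              = (vol g n (t - l) - vol g n t) * (vol g n (t - l) + vol g n t)
                / vol g n t ^ 2 := by
            field_simp
            ring
          rw [h3, abs_div, abs_mul, abs_of_pos (add_pos hpos' hpos), abs_of_pos (pow_pos hpos 2)]
          calc |vol g n (t - l) - vol g n t| * (vol g n (t - l) + vol g n t) / vol g n t ^ 2
              ≤ L * (l / n) * (2 * H) / c ^ 2 := by
                gcongr
                · linarith [hbs.2, hbt.2]
                · exact hbt.1
            _ = _ := by ring
        -- The true order is G/n²; the weaker G/n suffices, as its sum over t ≤ n is at most G.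
        have h5 : (vol g n (t - l) ^ 2 / vol g n t ^ 2 - 1) ^ 2 ≤ G / n := by
          rw [← sq_abs]
          refine (pow_le_pow_left₀ (abs_nonneg _) h2 2).trans ?_
          rw [div_pow, ← hG]
          gcongr
          nlinarith
        linarith [mul_nonneg hM0 hsum0]
  refine (Finset.sum_le_sum hpt).trans ?_
  rw [Finset.sum_add_distrib, ← Finset.mul_sum, Finset.sum_add_distrib, Finset.sum_comm]
  refine add_le_add ?_ (mul_le_mul_of_nonneg_left (add_le_add ?_ ?_) hM0)
  · rw [Finset.sum_const, Int.card_Icc, add_sub_cancel_right, Int.toNat_natCast, nsmul_eq_mul]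
    rcases Nat.eq_zero_or_pos n with rfl | hn
    · simp
      positivity
    · have hn0 : (n : ℝ) ≠ 0 := by positivity
      rw [mul_div_cancel₀ _ hn0]
  · refine Finset.sum_le_sum fun j _ => ?_
    rw [← Finset.sum_filter, Finset.sum_const, nsmul_eq_mul, mul_one]
    exact Nat.cast_le.2 (card_filter_lag_le (hI j) n l)
  · rw [← Finset.sum_filter, Finset.sum_const, nsmul_eq_mul, mul_one]
    have hsub : (Finset.Icc (1 : ℤ) n).filter (fun t => t ≤ (l : ℤ)) ⊆ Finset.Icc (1 : ℤ) l := by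
      intro t ht
      simp only [Finset.mem_filter, Finset.mem_Icc] at ht ⊢
      omega
    have := Finset.card_le_card hsub
    rw [Int.card_Icc, add_sub_cancel_right, Int.toNat_natCast] at this
    exact_mod_cast this

/-! ### A central limit theorem for finite-range martingale differences -/

section CharacteristicFunction

open Complex

theorem norm_cexp_sub_taylor_le (y : ℝ) :
    ‖cexp (I * y) - 1 - I * y + (y : ℂ) ^ 2 / 2‖ ≤ 4 * |y| ^ 3 := by
  rcases le_total |y| 1 with hy | hy
  · have hn : ‖I * (y : ℂ)‖ = |y| := by simp
    have h := Complex.exp_bound (x := I * y) (by rw [hn]; exact hy) (n := 3) (by norm_num)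
    have he : cexp (I * y) - 1 - I * y + (y : ℂ) ^ 2 / 2
        = cexp (I * y) - ∑ j ∈ Finset.range 3, (I * (y : ℂ)) ^ j / (j.factorial : ℂ) := by
      simp only [Finset.sum_range_succ, Finset.sum_range_zero, Nat.factorial]
      have hI : (I * (y : ℂ)) ^ 2 = -(y : ℂ) ^ 2 := by rw [mul_pow, I_sq]; ring
      rw [hI]
      push_cast
      ring
    rw [he]
    refine h.trans ?_
    rw [hn, mul_comm]
    refine mul_le_mul_of_nonneg_right ?_ (by positivity)
    norm_num [Nat.factorial]
  · have h1 : ‖cexp (I * y)‖ = 1 := by rw [mul_comm]; exact Complex.norm_exp_ofReal_mul_I y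
    have h2 : ‖I * (y : ℂ)‖ = |y| := by simp
    have h3 : ‖(y : ℂ) ^ 2 / 2‖ = |y| ^ 2 / 2 := by simp
    have h4 : ‖cexp (I * y) - 1 - I * y + (y : ℂ) ^ 2 / 2‖ ≤ 1 + 1 + |y| + |y| ^ 2 / 2 := by
      refine (norm_add_le _ _).trans (add_le_add ((norm_sub_le _ _).trans (add_le_add
        ((norm_sub_le _ _).trans ?_) h2.le)) h3.le)
      rw [h1, norm_one]
    nlinarith [pow_le_pow_right₀ hy (show 1 ≤ 3 by norm_num),
      pow_le_pow_right₀ hy (show 2 ≤ 3 by norm_num), pow_le_pow_right₀ hy (show 0 ≤ 3 by norm_num)]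

theorem norm_cexp_sub_cexp_le (y z : ℝ) : ‖cexp (I * y) - cexp (I * z)‖ ≤ |y - z| := by
  have h : cexp (I * y) - cexp (I * z) = cexp (z * I) * (cexp (I * (y - z : ℝ)) - 1) := by
    rw [mul_sub, ← Complex.exp_add, mul_one]
    push_cast
    ring_nf
  rw [h, norm_mul, Complex.norm_exp_ofReal_mul_I, one_mul]
  exact Real.norm_exp_I_mul_ofReal_sub_one_le

/-- `W_k` depends on `ε_{k+1-m}, …, ε_{k+1}` only, is orthogonal to the bounded functions of
`ε_t`, `t ≤ k`, and has constant variance `σ2` and bounded third absolute moments. -/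
structure FiniteRangeMDS {Ω : Type*} [MeasurableSpace Ω] (μ : Measure Ω) (ε : ℤ → Ω → ℝ) (m : ℕ) (σ2 K : ℝ) (W : ℕ → Ω → ℝ) :
    Prop where
  measurable : ∀ k : ℕ, Measurable[info ε (Set.Icc ((k : ℤ) + 1 - m) (k + 1))] (W k)
  orthogonal : ∀ (k : ℕ) (G : Ω → ℂ), Measurable[info ε (Set.Iic (k : ℤ))] G →
    (∀ ω, ‖G ω‖ ≤ 1) → ∫ ω, G ω * (W k ω : ℂ) ∂μ = 0
  variance : ∀ k, ∫ ω, W k ω ^ 2 ∂μ = σ2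
  integrable : ∀ k, Integrable (fun ω => |W k ω| ^ 3) μ
  third : ∀ k, ∫ ω, |W k ω| ^ 3 ∂μ ≤ K

/-! ### Recursion for the characteristic functions of partial sums -/

namespace FiniteRangeMDS

/-- `exp (iθ(W_0 + ⋯ + W_{k-1}))`. -/
def expSum {Ω : Type*} (W : ℕ → Ω → ℝ) (θ : ℝ) (k : ℕ) (ω : Ω) : ℂ :=
  cexp (I * (θ * ∑ j ∈ Finset.range k, W j ω : ℝ))

theorem norm_expSum {Ω : Type*} {W : ℕ → Ω → ℝ} (θ : ℝ) (k : ℕ) (ω : Ω) : ‖expSum W θ k ω‖ = 1 := by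
  rw [expSum, mul_comm]
  exact Complex.norm_exp_ofReal_mul_I _

theorem expSum_succ {Ω : Type*} {W : ℕ → Ω → ℝ} (θ : ℝ) (k : ℕ) (ω : Ω) :
    expSum W θ (k + 1) ω = expSum W θ k ω * cexp (I * (θ * W k ω : ℝ)) := by
  rw [expSum, expSum, ← Complex.exp_add, Finset.sum_range_succ]
  push_cast
  ring_nf

theorem norm_expSum_sub_le {Ω : Type*} {W : ℕ → Ω → ℝ} {m : ℕ} {θ : ℝ}
    (hθ : 0 ≤ θ) (k : ℕ) (ω : Ω) :
    ‖expSum W θ k ω - expSum W θ (k - m) ω‖ ≤ θ * ∑ j ∈ Finset.Ico (k - m) k, |W j ω| := by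
  refine (norm_cexp_sub_cexp_le _ _).trans ?_
  rw [← mul_sub, abs_mul, abs_of_nonneg hθ, ← Finset.sum_Ico_eq_sub _ (Nat.sub_le k m)]
  exact mul_le_mul_of_nonneg_left (Finset.abs_sum_le_sum_abs _ _) hθ

variable {Ω : Type*} [MeasurableSpace Ω] {μ : Measure Ω} {ε : ℤ → Ω → ℝ} {m : ℕ} {W : ℕ → Ω → ℝ}
  {σ2 K : ℝ}

theorem measurable' (hW : FiniteRangeMDS μ ε m σ2 K W)
    (hε : ∀ t, Measurable (ε t)) (k : ℕ) : Measurable (W k) := (hW.measurable k).mono (info_le hε _) le_rfl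

theorem measurable_expSum_info (hW : FiniteRangeMDS μ ε m σ2 K W)
    (θ : ℝ) {k : ℕ} {r : ℤ} (hr : ∀ j < k, (j : ℤ) + 1 ≤ r) :
    Measurable[info ε (Set.Iic r)] (expSum W θ k) := by
  have h : Measurable[info ε (Set.Iic r)] (fun ω => ∑ j ∈ Finset.range k, W j ω) :=
    Finset.measurable_sum _ fun j hj => (hW.measurable j).mono (info_mono fun t ht =>
      ht.2.trans (hr j (Finset.mem_range.1 hj))) le_rfl
  have hc : Measurable (fun y : ℝ => cexp (I * (θ * y : ℝ))) := by fun_prop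
  exact hc.comp h

theorem measurable_expSum (hW : FiniteRangeMDS μ ε m σ2 K W)
    (hε : ∀ t, Measurable (ε t)) (θ : ℝ) (k : ℕ) : Measurable (expSum W θ k) :=
  (hW.measurable_expSum_info θ (r := k) (fun j hj => by omega)).mono (info_le hε _) le_rfl

theorem integrable_expSum [IsProbabilityMeasure μ] (hW : FiniteRangeMDS μ ε m σ2 K W)
    (hε : ∀ t, Measurable (ε t)) (θ : ℝ) (k : ℕ) : Integrable (expSum W θ k) μ :=
  Integrable.of_bound (hW.measurable_expSum hε θ k).aestronglyMeasurable 1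
    (Eventually.of_forall fun ω => (norm_expSum θ k ω).le)

theorem integrable_abs [IsProbabilityMeasure μ] (hW : FiniteRangeMDS μ ε m σ2 K W)
    (hε : ∀ t, Measurable (ε t)) (k : ℕ) : Integrable (fun ω => |W k ω|) μ := by
  refine Integrable.mono' ((integrable_const (1 : ℝ)).add (hW.integrable k))
    (hW.measurable' hε k).norm.aestronglyMeasurable (Eventually.of_forall fun ω => ?_)
  simp only [Real.norm_eq_abs, abs_abs, Pi.add_apply]
  have h := abs_nonneg (W k ω)
  nlinarith [sq_nonneg (|W k ω| - 1), mul_nonneg h (sq_nonneg (|W k ω| - 1))]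

theorem integral_abs_le [IsProbabilityMeasure μ] (hW : FiniteRangeMDS μ ε m σ2 K W)
    (hε : ∀ t, Measurable (ε t)) (k : ℕ) : ∫ ω, |W k ω| ∂μ ≤ 1 + K := by
  have h : ∫ ω, |W k ω| ∂μ ≤ ∫ ω, (1 + |W k ω| ^ 3) ∂μ := by
    refine integral_mono (hW.integrable_abs hε k) ((integrable_const (1 : ℝ)).add (hW.integrable k))
      fun ω => ?_
    have h := abs_nonneg (W k ω)
    simp only
    nlinarith [sq_nonneg (|W k ω| - 1), mul_nonneg h (sq_nonneg (|W k ω| - 1))]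
  rw [integral_add (integrable_const _) (hW.integrable k)] at h
  simp only [integral_const, probReal_univ, smul_eq_mul, mul_one] at h
  linarith [hW.third k]

theorem integrable_sq [IsProbabilityMeasure μ] (hW : FiniteRangeMDS μ ε m σ2 K W)
    (hε : ∀ t, Measurable (ε t)) (k : ℕ) : Integrable (fun ω => W k ω ^ 2) μ := by
  refine Integrable.mono' ((integrable_const (1 : ℝ)).add (hW.integrable k))
    ((hW.measurable' hε k).pow_const 2).aestronglyMeasurable (Eventually.of_forall fun ω => ?_)
  simp only [Real.norm_eq_abs, abs_pow, Pi.add_apply]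
  have h := abs_nonneg (W k ω)
  nlinarith [mul_nonneg h (sq_nonneg (|W k ω| - 1)), sq_nonneg (|W k ω| - 1),
    mul_nonneg (add_nonneg h zero_le_one) (sq_nonneg (|W k ω| - 1))]

theorem norm_integral_expSum_sub_le [IsProbabilityMeasure μ] (hW : FiniteRangeMDS μ ε m σ2 K W)
    (hε : ∀ t, Measurable (ε t)) {θ : ℝ} (hθ : 0 ≤ θ) (k : ℕ) :
    ‖∫ ω, expSum W θ k ω ∂μ - ∫ ω, expSum W θ (k - m) ω ∂μ‖ ≤ θ * (m * (1 + K)) := by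
  have hK : 0 ≤ 1 + K := (integral_nonneg fun ω => abs_nonneg _).trans (hW.integral_abs_le hε k)
  rw [← integral_sub (hW.integrable_expSum hε θ k) (hW.integrable_expSum hε θ (k - m))]
  refine (norm_integral_le_integral_norm _).trans ?_
  refine (integral_mono_of_nonneg (Eventually.of_forall fun ω => norm_nonneg _)
    ((integrable_finsetSum _ fun j _ => hW.integrable_abs hε j).const_mul θ)
    (Eventually.of_forall fun ω => norm_expSum_sub_le hθ k ω)).trans ?_
  rw [integral_const_mul, integral_finsetSum _ fun j _ => hW.integrable_abs hε j]
  refine mul_le_mul_of_nonneg_left ?_ hθ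
  refine (Finset.sum_le_card_nsmul _ _ (1 + K) fun j _ => hW.integral_abs_le hε j).trans ?_
  rw [nsmul_eq_mul, Nat.card_Ico]
  refine mul_le_mul_of_nonneg_right ?_ hK
  exact_mod_cast (by omega : k - (k - m) ≤ m)

/-- The exponentials differ by at most θ times the sum of the last m terms |W_j|, and |W_j| W_k² ≤
|W_j|³ + |W_k|³. -/
theorem norm_integral_expSum_sub_mul_sq_le (hW : FiniteRangeMDS μ ε m σ2 K W)
    {θ : ℝ} (hθ : 0 ≤ θ) (k : ℕ) :
    ‖∫ ω, (expSum W θ k ω - expSum W θ (k - m) ω) * (W k ω : ℂ) ^ 2 ∂μ‖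
      ≤ θ * (m * (2 * K)) := by
  have hK : 0 ≤ K := (integral_nonneg fun ω => by positivity).trans (hW.third k)
  refine (norm_integral_le_integral_norm _).trans ?_
  have hi : Integrable (fun ω => θ * ∑ j ∈ Finset.Ico (k - m) k,
      (|W j ω| ^ 3 + |W k ω| ^ 3)) μ :=
    (integrable_finsetSum _ fun j _ => (hW.integrable j).add (hW.integrable k)).const_mul θ
  refine (integral_mono_of_nonneg (Eventually.of_forall fun ω => norm_nonneg _) hi
    (Eventually.of_forall fun ω => ?_)).trans ?_
  · simp only [norm_mul, norm_pow, Complex.norm_real, Real.norm_eq_abs]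
    refine (mul_le_mul_of_nonneg_right (norm_expSum_sub_le hθ k ω) (by positivity)).trans ?_
    rw [mul_assoc, Finset.sum_mul]
    refine mul_le_mul_of_nonneg_left (Finset.sum_le_sum fun j _ => ?_) hθ
    have ha := abs_nonneg (W j ω)
    have hb := abs_nonneg (W k ω)
    rcases le_total |W j ω| |W k ω| with h | h
    · have h1 := mul_le_mul_of_nonneg_right h (sq_nonneg |W k ω|)
      have h2 : 0 ≤ |W j ω| ^ 3 := by positivity
      nlinarith
    · have h1 := mul_le_mul_of_nonneg_left (pow_le_pow_left₀ hb h 2) ha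
      have h2 : 0 ≤ |W k ω| ^ 3 := by positivity
      nlinarith
  · have hi' : ∀ j, Integrable (fun ω => |W j ω| ^ 3 + |W k ω| ^ 3) μ := fun j =>
      (hW.integrable j).add (hW.integrable k)
    rw [integral_const_mul, integral_finsetSum _ fun j _ => hi' j]
    refine mul_le_mul_of_nonneg_left ?_ hθ
    refine (Finset.sum_le_card_nsmul _ _ (2 * K) fun j _ => ?_).trans ?_
    · rw [integral_add (hW.integrable j) (hW.integrable k)]
      linarith [hW.third j, hW.third k]
    · rw [nsmul_eq_mul, Nat.card_Ico]
      refine mul_le_mul_of_nonneg_right ?_ (by positivity)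
      exact_mod_cast (by omega : k - (k - m) ≤ m)

theorem integral_expSum_mul_sq [IsProbabilityMeasure μ] (hW : FiniteRangeMDS μ ε m σ2 K W)
    (hε : ∀ t, Measurable (ε t)) (hind : iIndepFun ε μ)
    (θ : ℝ) (k : ℕ) :
    ∫ ω, expSum W θ (k - m) ω * (W k ω : ℂ) ^ 2 ∂μ = (∫ ω, expSum W θ (k - m) ω ∂μ) * σ2 := by
  -- The partial sum up to k − m involves times at most k − m, and W_k only later ones. If k < m the
  -- natural difference is 0, the exponential is constant, and the side condition is vacuous.
  have h1 := hW.measurable_expSum_info θ (k := k - m) (r := (k : ℤ) - m)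
    (fun j hj => by omega)
  have h2 : Measurable[info ε (Set.Icc ((k : ℤ) + 1 - m) (k + 1))]
      (fun ω => (W k ω : ℂ) ^ 2) :=
    (Complex.measurable_ofReal.pow_const 2).comp (hW.measurable k)
  have hd : Disjoint (Set.Iic ((k : ℤ) - m)) (Set.Icc ((k : ℤ) + 1 - m) (k + 1)) := by
    rw [Set.disjoint_left]
    intro t ht ht'
    have h1 : t ≤ (k : ℤ) - m := ht
    have h2 : (k : ℤ) + 1 - m ≤ t := ht'.1
    omega
  have h := (indepFun_of_info hε hind hd h1 h2).integral_fun_mul_eq_mul_integral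
    (h1.mono (info_le hε _) le_rfl).aestronglyMeasurable
    (h2.mono (info_le hε _) le_rfl).aestronglyMeasurable
  rw [h, ← hW.variance k, ← integral_complex_ofReal]
  push_cast
  rfl

/-- Expand exp(iθW_k) to second order. The linear term vanishes by orthogonality. In the quadratic
term the exponential of the past is moved back m steps, where it is independent of W_k; the
expectation factors, and moving forward again restores step k. Each move, like the Taylor remainder,
costs O(θ³). -/
theorem norm_integral_expSum_succ_sub_le [IsProbabilityMeasure μ] (hW : FiniteRangeMDS μ ε m σ2 K W)
    (hε : ∀ t, Measurable (ε t)) (hind : iIndepFun ε μ)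
    {θ : ℝ} (hθ : 0 ≤ θ) (k : ℕ) :
    ‖∫ ω, expSum W θ (k + 1) ω ∂μ - (1 - θ ^ 2 * σ2 / 2 : ℝ) * ∫ ω, expSum W θ k ω ∂μ‖
      ≤ (4 * K + m * (2 * K + (1 + K) * σ2)) * θ ^ 3 := by
  have hσ : 0 ≤ σ2 := hW.variance k ▸ integral_nonneg fun ω => by positivity
  have hK : 0 ≤ K := (integral_nonneg fun ω => by positivity).trans (hW.third k)
  have hWm := hW.measurable' hε k
  have hfb : ∀ k, ∀ᵐ ω ∂μ, ‖expSum W θ k ω‖ ≤ 1 := fun k =>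
    Eventually.of_forall fun ω => (norm_expSum θ k ω).le
  have hfm := fun k => (hW.measurable_expSum hε θ k).aestronglyMeasurable (μ := μ)
  have hi1 : Integrable (fun ω => expSum W θ k ω * (W k ω : ℂ)) μ :=
    Integrable.bdd_mul
      (((integrable_norm_iff hWm.aestronglyMeasurable).1 (hW.integrable_abs hε k)).ofReal)
      (hfm k) (hfb k)
  have hWc : Integrable (fun ω => (W k ω : ℂ) ^ 2) μ := by
    simpa using (hW.integrable_sq hε k).ofReal (𝕜 := ℂ)
  have hi2 : ∀ j, Integrable (fun ω => expSum W θ j ω * (W k ω : ℂ) ^ 2) μ := fun j =>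
    Integrable.bdd_mul hWc (hfm j) (hfb j)
  set R : Ω → ℂ := fun ω => expSum W θ k ω * (cexp (I * (θ * W k ω : ℝ)) - 1
    - I * (θ * W k ω : ℝ) + ((θ * W k ω : ℝ) : ℂ) ^ 2 / 2) with hR
  have hdec : ∀ ω, R ω = expSum W θ (k + 1) ω - expSum W θ k ω
      - I * θ * (expSum W θ k ω * (W k ω : ℂ))
      + (θ ^ 2 / 2 : ℝ) * (expSum W θ k ω * (W k ω : ℂ) ^ 2) := by
    intro ω
    rw [hR, expSum_succ]
    push_cast
    ring
  have horth : ∫ ω, expSum W θ k ω * (W k ω : ℂ) ∂μ = 0 :=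
    hW.orthogonal k _ (hW.measurable_expSum_info θ (fun j hj => by omega))
      fun ω => (norm_expSum θ k ω).le
  have hRint : ∫ ω, R ω ∂μ = ∫ ω, expSum W θ (k + 1) ω ∂μ - ∫ ω, expSum W θ k ω ∂μ
      + (θ ^ 2 / 2 : ℝ) * ∫ ω, expSum W θ k ω * (W k ω : ℂ) ^ 2 ∂μ := by
    have hd1 : Integrable (fun ω => expSum W θ (k + 1) ω - expSum W θ k ω) μ :=
      (hW.integrable_expSum hε θ (k + 1)).sub (hW.integrable_expSum hε θ k)
    have hd2 : Integrable (fun ω => expSum W θ (k + 1) ω - expSum W θ k ω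
        - I * θ * (expSum W θ k ω * (W k ω : ℂ))) μ := hd1.sub (hi1.const_mul _)
    simp_rw [hdec]
    rw [integral_add hd2 ((hi2 k).const_mul _), integral_sub hd1 (hi1.const_mul _),
      integral_sub (hW.integrable_expSum hε θ (k + 1)) (hW.integrable_expSum hε θ k),
      integral_const_mul, integral_const_mul, horth, mul_zero, sub_zero]
  have hRle : ‖∫ ω, R ω ∂μ‖ ≤ 4 * K * θ ^ 3 := by
    refine (norm_integral_le_integral_norm _).trans ?_
    refine (integral_mono_of_nonneg (Eventually.of_forall fun ω => norm_nonneg _)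
      ((hW.integrable k).const_mul (4 * θ ^ 3)) (Eventually.of_forall fun ω => ?_)).trans ?_
    · simp only [hR, norm_mul, norm_expSum, one_mul]
      refine (norm_cexp_sub_taylor_le _).trans (le_of_eq ?_)
      rw [abs_mul, abs_of_nonneg hθ]
      ring
    · rw [integral_const_mul]
      have := mul_le_mul_of_nonneg_left (hW.third k) (show 0 ≤ 4 * θ ^ 3 by positivity)
      linarith
  have hsplit : ∫ ω, expSum W θ k ω * (W k ω : ℂ) ^ 2 ∂μ
      = ∫ ω, (expSum W θ k ω - expSum W θ (k - m) ω) * (W k ω : ℂ) ^ 2 ∂μ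
        + (∫ ω, expSum W θ (k - m) ω ∂μ) * σ2 := by
    rw [← hW.integral_expSum_mul_sq hε hind θ k]
    simp_rw [sub_mul]
    rw [integral_sub (hi2 k) (hi2 (k - m))]
    ring
  have hA := hW.norm_integral_expSum_sub_mul_sq_le hθ k
  have hB := hW.norm_integral_expSum_sub_le hε hθ k
  set A := ∫ ω, (expSum W θ k ω - expSum W θ (k - m) ω) * (W k ω : ℂ) ^ 2 ∂μ
  set a := ∫ ω, expSum W θ k ω ∂μ
  set a' := ∫ ω, expSum W θ (k - m) ω ∂μ
  have hfin : ∫ ω, expSum W θ (k + 1) ω ∂μ - (1 - θ ^ 2 * σ2 / 2 : ℝ) * a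
      = ∫ ω, R ω ∂μ - (θ ^ 2 / 2 : ℝ) * A + (θ ^ 2 / 2 : ℝ) * σ2 * (a - a') := by
    rw [hRint, hsplit]
    push_cast
    ring
  rw [hfin]
  have hA' : ‖((θ ^ 2 / 2 : ℝ) : ℂ) * A‖ ≤ θ ^ 2 / 2 * (θ * (m * (2 * K))) := by
    rw [norm_mul, Complex.norm_real, Real.norm_of_nonneg (by positivity)]
    exact mul_le_mul_of_nonneg_left hA (by positivity)
  have hB' : ‖((θ ^ 2 / 2 : ℝ) : ℂ) * σ2 * (a - a')‖
      ≤ θ ^ 2 / 2 * σ2 * (θ * (m * (1 + K))) := by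
    rw [norm_mul, norm_mul, Complex.norm_real, Complex.norm_real,
      Real.norm_of_nonneg (by positivity), Real.norm_of_nonneg hσ]
    exact mul_le_mul_of_nonneg_left hB (by positivity)
  have hpos : 0 ≤ θ ^ 3 * (m * (2 * K + (1 + K) * σ2)) := by positivity
  have := (norm_add_le _ _).trans (add_le_add ((norm_sub_le _ _).trans (add_le_add hRle hA')) hB')
  refine this.trans ?_
  linarith

/-- The central limit theorem, for characteristic functions. -/
theorem tendsto_integral_cexp [IsProbabilityMeasure μ] (hW : FiniteRangeMDS μ ε m σ2 K W)
    (hε : ∀ t, Measurable (ε t)) (hind : iIndepFun ε μ) :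
    Tendsto (fun n : ℕ => ∫ ω, cexp (I * (1 / √(n : ℝ) * ∑ j ∈ Finset.range n, W j ω : ℝ)) ∂μ)
      atTop (𝓝 (Real.exp (-σ2 / 2) : ℂ)) := by
  have hσ : 0 ≤ σ2 := hW.variance 0 ▸ integral_nonneg fun ω => by positivity
  set D := 4 * K + m * (2 * K + (1 + K) * σ2) with hD
  have hlim : Tendsto (fun n : ℕ => (((1 + (-σ2 / 2) / n) ^ n : ℝ) : ℂ)) atTop
      (𝓝 (Real.exp (-σ2 / 2) : ℂ)) :=
    (Complex.continuous_ofReal.tendsto _).comp (Real.tendsto_one_add_div_pow_exp (-σ2 / 2))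
  refine hlim.congr_dist (squeeze_zero' (Eventually.of_forall fun n => dist_nonneg) ?_
    (BoundedVolAR.tendsto_const_div_sqrt D))
  -- For n ≥ σ² the multiplier 1 − σ²/(2n) has modulus at most 1, so the one-step errors add up
  -- without amplification.
  filter_upwards [eventually_ge_atTop 1, eventually_ge_atTop ⌈σ2⌉₊] with n hn hn'
  have hn0 : (0 : ℝ) < n := by exact_mod_cast hn
  have hnσ : σ2 ≤ n := (Nat.le_ceil σ2).trans (by exact_mod_cast hn')
  have hsn : 0 < √(n : ℝ) := Real.sqrt_pos.2 hn0
  have hsq : √(n : ℝ) ^ 2 = n := Real.sq_sqrt hn0.le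
  set θ := 1 / √(n : ℝ) with hθ
  have hθ0 : 0 ≤ θ := by positivity
  have hθ2 : θ ^ 2 = 1 / n := by rw [hθ, div_pow, hsq, one_pow]
  set c := 1 - θ ^ 2 * σ2 / 2 with hc
  have hc' : 1 + (-σ2 / 2) / n = c := by rw [hc, hθ2]; ring
  have hcabs : |c| ≤ 1 := by
    have h1 : θ ^ 2 * σ2 ≤ 1 := by rw [hθ2, one_div_mul_eq_div]; exact (div_le_one hn0).2 hnσ
    have h2 : 0 ≤ θ ^ 2 * σ2 := by positivity
    rw [abs_le]
    constructor <;> linarith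
  have hind' : ∀ k : ℕ, ‖∫ ω, expSum W θ k ω ∂μ - (c : ℂ) ^ k‖ ≤ k * (D * θ ^ 3) := by
    intro k
    induction k with
    | zero => simp [expSum]
    | succ k ih =>
      have h1 := hW.norm_integral_expSum_succ_sub_le hε hind hθ0 k
      have h2 : ∫ ω, expSum W θ (k + 1) ω ∂μ - (c : ℂ) ^ (k + 1)
          = (∫ ω, expSum W θ (k + 1) ω ∂μ - (c : ℂ) * ∫ ω, expSum W θ k ω ∂μ)
            + (c : ℂ) * (∫ ω, expSum W θ k ω ∂μ - (c : ℂ) ^ k) := by ring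
      rw [h2]
      refine (norm_add_le _ _).trans ?_
      have h3 : ‖(c : ℂ) * (∫ ω, expSum W θ k ω ∂μ - (c : ℂ) ^ k)‖ ≤ 1 * (k * (D * θ ^ 3)) := by
        rw [norm_mul, Complex.norm_real]
        exact mul_le_mul hcabs ih (norm_nonneg _) zero_le_one
      push_cast
      linarith
  have hfin := hind' n
  rw [hc', dist_comm, dist_eq_norm]
  push_cast
  -- There are n steps, each with error Dθ³ and θ = n^{-1/2}.
  have he : (n : ℝ) * (D * θ ^ 3) = D / √(n : ℝ) := by
    have : (n : ℝ) * θ ^ 2 = 1 := by rw [hθ2]; field_simp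
    calc (n : ℝ) * (D * θ ^ 3) = ((n : ℝ) * θ ^ 2) * (D * θ) := by ring
      _ = D / √(n : ℝ) := by rw [this, hθ]; ring
  rw [← he]
  simpa [expSum] using hfin

end FiniteRangeMDS

end CharacteristicFunction

/-! ### Asymptotic normality of the linearized score -/

/-- `(1 / 2√n) ∑ (ε_t² - 1) (ε_{t-1}², …, ε_{t-m}²)`. -/
def noiseScore {Ω : Type*} (m : ℕ) (ε : ℤ → Ω → ℝ) (n : ℕ) (ω : Ω) : Fin m → ℝ := fun i =>
  1 / (2 * √(n : ℝ)) * ∑ t ∈ Finset.Icc (1 : ℤ) n,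
    (ε t ω ^ 2 - 1) * ε (t - ((i : ℕ) + 1)) ω ^ 2

/-- The summands of `v ⬝ᵥ noiseScore`. -/
def noiseScoreTerm {Ω : Type*} {m : ℕ} (ε : ℤ → Ω → ℝ) (v : Fin m → ℝ) (k : ℕ) (ω : Ω) : ℝ :=
  1 / 2 * (ε (k + 1) ω ^ 2 - 1) * ∑ i : Fin m, v i * ε (k - (i : ℕ)) ω ^ 2

/-- The Cramér–Wold reduction to scalar sums; the index k stands for t − 1. -/
theorem dotProduct_noiseScore {Ω : Type*} {m : ℕ} (ε : ℤ → Ω → ℝ) (v : Fin m → ℝ) (n : ℕ)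
    (ω : Ω) : v ⬝ᵥ noiseScore m ε n ω
      = 1 / √(n : ℝ) * ∑ k ∈ Finset.range n, noiseScoreTerm ε v k ω := by
  simp only [dotProduct, noiseScore, noiseScoreTerm, sum_Icc_eq_sum_range, Finset.mul_sum]
  rw [Finset.sum_comm]
  refine Finset.sum_congr rfl fun k _ => Finset.sum_congr rfl fun i _ => ?_
  rw [add_sub_add_right_eq_sub, one_div_mul_eq_div, one_div]
  rcases eq_or_ne (√(n : ℝ)) 0 with hs | hs
  · simp [hs]
  · field_simp

/-! ### Moments of the summands and the limit law of the noise score -/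

section

variable {Ω : Type*} [MeasurableSpace Ω] {μ : Measure Ω} [IsProbabilityMeasure μ]
  {ε : ℤ → Ω → ℝ} {m : ℕ}

namespace Noise

/-- The origin of the pattern of Σ: E(ε⁴) on the diagonal, and E(ε²)² = 1 off it. -/
theorem integral_sq_mul_sq (hε : Noise μ ε) (s t : ℤ) :
    Integrable (fun ω => ε s ω ^ 2 * ε t ω ^ 2) μ ∧
      ∫ ω, ε s ω ^ 2 * ε t ω ^ 2 ∂μ = if s = t then ∫ ω, ε 0 ω ^ 4 ∂μ else 1 := by
  split_ifs with hst
  · subst hst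
    simp only [← pow_add]
    exact ⟨hε.integrable_pow (by norm_num) s,
      hε.integral_comp (f := fun y => y ^ (2 + 2)) (by fun_prop) s⟩
  · have hind : IndepFun (fun ω => ε s ω ^ 2) (fun ω => ε t ω ^ 2) μ :=
      (hε.indep.indepFun hst).comp (measurable_id.pow_const 2) (measurable_id.pow_const 2)
    have hi := fun t => hε.integrable_pow (k := 2) (by norm_num) t
    refine ⟨hind.integrable_mul (hi s) (hi t), ?_⟩
    rw [hind.integral_fun_mul_eq_mul_integral (hi s).aestronglyMeasurable
      (hi t).aestronglyMeasurable, hε.integral_comp (f := fun y => y ^ 2) (by fun_prop) s,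
      hε.integral_comp (f := fun y => y ^ 2) (by fun_prop) t, hε.integral_sq, mul_one]

theorem integral_sq_sub_one_sq (hε : Noise μ ε) :
    ∫ ω, (ε 0 ω ^ 2 - 1) ^ 2 ∂μ = variance (fun ω => ε 0 ω ^ 2) μ := by
  rw [variance_eq_integral ((hε.measurable 0).pow_const 2).aemeasurable, hε.integral_sq]

theorem integrable_abs_sq_sub_one_cube (hε : Noise μ ε) :
    Integrable (fun ω => |ε 0 ω ^ 2 - 1| ^ 3) μ := by
  refine hε.integrable_of_abs_le (f := fun y => |y ^ 2 - 1| ^ 3) (by fun_prop) 8 (fun y => ?_) 0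
  rw [abs_pow, abs_abs]
  rcases le_total |y| 1 with hy | hy
  · have h1 : y ^ 2 ≤ 1 := (sq_le_one_iff_abs_le_one y).2 hy
    have h2 : |y ^ 2 - 1| ≤ 1 := by rw [abs_le]; constructor <;> nlinarith [sq_nonneg y]
    have h3 := pow_le_one₀ (n := 3) (abs_nonneg (y ^ 2 - 1)) h2
    have h4 : 0 ≤ y ^ 8 := by positivity
    linarith
  · have h1 : 1 ≤ y ^ 2 := (one_le_sq_iff_one_le_abs y).2 hy
    have h2 : |y ^ 2 - 1| ≤ y ^ 2 := by rw [abs_of_nonneg (by linarith)]; linarith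
    have h3 := pow_le_pow_left₀ (abs_nonneg (y ^ 2 - 1)) h2 3
    have h4 := abs_pow_le_one_add_pow_eight y (k := 6) (by norm_num)
    have h5 : (y ^ 2) ^ 3 = |y| ^ 6 := by rw [← sq_abs]; ring
    have h6 : 0 ≤ y ^ 8 := by positivity
    linarith

theorem integral_lag_sum_sq (hε : Noise μ ε) (v : Fin m → ℝ) (k : ℤ) :
    Integrable (fun ω => (∑ i : Fin m, v i * ε (k - (i : ℕ)) ω ^ 2) ^ 2) μ ∧
      ∫ ω, (∑ i : Fin m, v i * ε (k - (i : ℕ)) ω ^ 2) ^ 2 ∂μ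
        = ∑ i, ∑ j, v i * v j * if i = j then ∫ ω, ε 0 ω ^ 4 ∂μ else 1 := by
  have hexp : ∀ ω, (∑ i : Fin m, v i * ε (k - (i : ℕ)) ω ^ 2) ^ 2
      = ∑ i, ∑ j, v i * v j * (ε (k - (i : ℕ)) ω ^ 2 * ε (k - (j : ℕ)) ω ^ 2) := by
    intro ω
    rw [sq, Finset.sum_mul_sum]
    exact Finset.sum_congr rfl fun i _ => Finset.sum_congr rfl fun j _ => by ring
  have hi : ∀ i j : Fin m, Integrable
      (fun ω => v i * v j * (ε (k - (i : ℕ)) ω ^ 2 * ε (k - (j : ℕ)) ω ^ 2)) μ := fun i j =>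
    (hε.integral_sq_mul_sq _ _).1.const_mul _
  simp_rw [hexp]
  refine ⟨integrable_finsetSum _ fun i _ => integrable_finsetSum _ fun j _ => hi i j, ?_⟩
  rw [integral_finsetSum _ fun i _ => integrable_finsetSum _ fun j _ => hi i j]
  refine Finset.sum_congr rfl fun i _ => ?_
  rw [integral_finsetSum _ fun j _ => hi i j]
  refine Finset.sum_congr rfl fun j _ => ?_
  rw [integral_const_mul, (hε.integral_sq_mul_sq _ _).2]
  congr 1
  refine if_congr ?_ rfl rfl
  rw [Fin.ext_iff]
  omega

/-- The power mean inequality for m terms; sixth moments of the noise suffice. -/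
theorem integral_lag_sum_cube_le (hε : Noise μ ε) (v : Fin m → ℝ) (k : ℤ) :
    Integrable (fun ω => |∑ i : Fin m, v i * ε (k - (i : ℕ)) ω ^ 2| ^ 3) μ ∧
      ∫ ω, |∑ i : Fin m, v i * ε (k - (i : ℕ)) ω ^ 2| ^ 3 ∂μ
        ≤ (m : ℝ) ^ 2 * ∑ i, |v i| ^ 3 * ∫ ω, ε 0 ω ^ 6 ∂μ := by
  have hi : Integrable (fun ω => (m : ℝ) ^ 2 * ∑ i : Fin m,
      |v i| ^ 3 * ε (k - (i : ℕ)) ω ^ 6) μ :=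
    (integrable_finsetSum _ fun i _ =>
      (hε.integrable_pow (k := 6) (by norm_num) _).const_mul _).const_mul _
  have hle : ∀ ω, |∑ i : Fin m, v i * ε (k - (i : ℕ)) ω ^ 2| ^ 3
      ≤ (m : ℝ) ^ 2 * ∑ i : Fin m, |v i| ^ 3 * ε (k - (i : ℕ)) ω ^ 6 := by
    intro ω
    have h1 := pow_le_pow_left₀ (abs_nonneg _) (Finset.abs_sum_le_sum_abs
      (fun i : Fin m => v i * ε (k - (i : ℕ)) ω ^ 2) Finset.univ) 3
    have h2 := pow_sum_div_card_le_sum_pow (s := (Finset.univ : Finset (Fin m)))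
      (f := fun i => |v i * ε (k - (i : ℕ)) ω ^ 2|) (fun i _ => abs_nonneg _) 2
    refine h1.trans ?_
    rcases Nat.eq_zero_or_pos m with hm | hm
    · subst hm
      simp
    rw [Finset.card_univ, Fintype.card_fin, div_le_iff₀ (by positivity), mul_comm] at h2
    refine h2.trans (le_of_eq ?_)
    congr 1
    refine Finset.sum_congr rfl fun i _ => ?_
    rw [abs_mul, abs_of_nonneg (sq_nonneg (ε (k - (i : ℕ)) ω))]
    ring
  have hm : AEStronglyMeasurable (fun ω => |∑ i : Fin m, v i * ε (k - (i : ℕ)) ω ^ 2| ^ 3) μ := by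
    have h := hε.measurable
    exact Measurable.aestronglyMeasurable (by fun_prop)
  refine ⟨hi.mono' hm (Eventually.of_forall fun ω => ?_), ?_⟩
  · rw [Real.norm_of_nonneg (by positivity)]
    exact hle ω
  · refine (integral_mono_of_nonneg (Eventually.of_forall fun ω => by positivity) hi
      (Eventually.of_forall hle)).trans (le_of_eq ?_)
    rw [integral_const_mul, integral_finsetSum _ fun i _ =>
      (hε.integrable_pow (k := 6) (by norm_num) _).const_mul _]
    simp_rw [integral_const_mul]
    congr 1
    exact Finset.sum_congr rfl fun i _ => by
      rw [hε.integral_comp (f := fun y => y ^ 6) (by fun_prop)]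

/-- The factor ε_{k+1}² − 1 is centred and independent of the past, while the sum over lags uses
ε_{k+1−m}, …, ε_k. This gives orthogonality, and the second and third moments factor. -/
theorem finiteRangeMDS_noiseScoreTerm (hε : Noise μ ε) (v : Fin m → ℝ) :
    FiniteRangeMDS μ ε m
      (v ⬝ᵥ (covMatrix m (variance (fun ω => ε 0 ω ^ 2) μ) (∫ ω, ε 0 ω ^ 4 ∂μ)).mulVec v)
      (1 / 8 * (∫ ω, |ε 0 ω ^ 2 - 1| ^ 3 ∂μ) *
        ((m : ℝ) ^ 2 * ∑ i, |v i| ^ 3 * ∫ ω, ε 0 ω ^ 6 ∂μ))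
      (noiseScoreTerm ε v) := by
  have hV : ∀ (k : ℕ) (S : Set ℤ), (∀ t : ℤ, (k : ℤ) - m < t → t ≤ k → t ∈ S) →
      Measurable[info ε S] (fun ω => ∑ i : Fin m, v i * ε (k - (i : ℕ)) ω ^ 2) := by
    intro k S hS
    exact Finset.measurable_sum _ fun i _ => ((measurable_info (ε := ε)
      (hS _ (by have := i.2; omega) (by omega))).pow_const 2).const_mul (v i)
  have hη : ∀ (k : ℕ) (S : Set ℤ), (k : ℤ) + 1 ∈ S →
      Measurable[info ε S] (fun ω => ε (k + 1) ω ^ 2 - 1) := fun k S hS =>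
    ((measurable_info (ε := ε) hS).pow_const 2).sub_const 1
  have hind : ∀ (k : ℕ) (Y : Ω → ℝ), Measurable[info ε (Set.Iic (k : ℤ))] Y →
      IndepFun (fun ω => ε (k + 1) ω ^ 2 - 1) Y μ := fun k Y hY =>
    indepFun_of_info hε.measurable hε.indep (by simp) (hη k _ (Set.mem_singleton _)) hY
  have hVk := fun k : ℕ => hV k (Set.Iic (k : ℤ)) fun t _ h => h
  have hle := info_le hε.measurable
  have hindV := fun k : ℕ => hind k _ (hVk k)
  have hη1 : ∀ t, ∫ ω, (ε t ω ^ 2 - 1) ∂μ = 0 := fun t => by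
    rw [hε.integral_comp (f := fun y => y ^ 2 - 1) (by fun_prop) t,
      BoundedVolAR.integral_sq_sub_one hε]
  have hη2 := fun t => hε.integral_comp (f := fun y => (y ^ 2 - 1) ^ 2) (by fun_prop) t
  have hη3 := fun t => hε.integral_comp (f := fun y => |y ^ 2 - 1| ^ 3) (by fun_prop) t
  have hη3i := fun t => hε.integrable_comp (f := fun y => |y ^ 2 - 1| ^ 3) (by fun_prop)
    hε.integrable_abs_sq_sub_one_cube t
  have hcube : ∀ k ω, |noiseScoreTerm ε v k ω| ^ 3 = 1 / 8 * (|ε (k + 1) ω ^ 2 - 1| ^ 3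
      * |∑ i : Fin m, v i * ε (k - (i : ℕ)) ω ^ 2| ^ 3) := by
    intro k ω
    rw [noiseScoreTerm, abs_mul, abs_mul, abs_of_pos (by norm_num : (0 : ℝ) < 1 / 2)]
    ring
  have hindcube := fun k : ℕ => (hindV k).comp (φ := fun y : ℝ => |y| ^ 3)
    (ψ := fun y : ℝ => |y| ^ 3) (by fun_prop) (by fun_prop)
  refine ⟨fun k => ?_, fun k G hG _ => ?_, fun k => ?_, fun k => ?_, fun k => ?_⟩
  · exact ((hη k (Set.Icc _ _) ⟨by omega, le_rfl⟩).const_mul (1 / 2)).mul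
      (hV k (Set.Icc _ _) fun t h1 h2 => ⟨by omega, by omega⟩)
  · have hη' : Measurable[info ε {(k : ℤ) + 1}] (fun ω => ((ε (k + 1) ω ^ 2 - 1 : ℝ) : ℂ)) :=
      Complex.measurable_ofReal.comp (hη k _ (Set.mem_singleton _))
    have hY : Measurable[info ε (Set.Iic (k : ℤ))] (fun ω => G ω *
        ((1 / 2 * ∑ i : Fin m, v i * ε (k - (i : ℕ)) ω ^ 2 : ℝ) : ℂ)) :=
      hG.mul (Complex.measurable_ofReal.comp ((hVk k).const_mul (1 / 2)))
    have h := (indepFun_of_info hε.measurable hε.indep (by simp) hη'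
      hY).integral_fun_mul_eq_mul_integral
      (hη'.mono (hle _) le_rfl).aestronglyMeasurable (hY.mono (hle _) le_rfl).aestronglyMeasurable
    rw [integral_complex_ofReal, hη1, Complex.ofReal_zero, zero_mul] at h
    rw [← h]
    refine integral_congr_ae (Eventually.of_forall fun ω => ?_)
    simp only [noiseScoreTerm]
    push_cast
    ring
  · have h := ((hindV k).comp (φ := fun y : ℝ => y ^ 2) (ψ := fun y : ℝ => y ^ 2) (by fun_prop)
      (by fun_prop)).integral_fun_mul_eq_mul_integral
      (((hη k _ (Set.mem_singleton _)).mono (hle _) le_rfl).pow_const 2).aestronglyMeasurable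
      (((hVk k).mono (hle _) le_rfl).pow_const 2).aestronglyMeasurable
    simp only [Function.comp_apply] at h
    rw [hη2, hε.integral_sq_sub_one_sq, (hε.integral_lag_sum_sq v k).2] at h
    have hW : ∀ ω, noiseScoreTerm ε v k ω ^ 2 = 1 / 4 * ((ε (k + 1) ω ^ 2 - 1) ^ 2
        * (∑ i : Fin m, v i * ε (k - (i : ℕ)) ω ^ 2) ^ 2) := fun ω => by
      rw [noiseScoreTerm]; ring
    simp_rw [hW]
    rw [integral_const_mul, h]
    simp only [dotProduct, Matrix.mulVec, covMatrix, Matrix.of_apply, Finset.mul_sum]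
    exact Finset.sum_congr rfl fun i _ => Finset.sum_congr rfl fun j _ => by ring
  · simp_rw [hcube]
    exact ((hindcube k).integrable_mul (hη3i _) (hε.integral_lag_sum_cube_le v k).1).const_mul _
  · simp_rw [hcube]
    have h := (hindcube k).integral_fun_mul_eq_mul_integral (hη3i _).aestronglyMeasurable
      (hε.integral_lag_sum_cube_le v k).1.aestronglyMeasurable
    simp only [Function.comp_apply] at h
    rw [integral_const_mul, h, hη3, mul_assoc]
    refine mul_le_mul_of_nonneg_left (mul_le_mul_of_nonneg_left
      (hε.integral_lag_sum_cube_le v k).2 ?_) (by norm_num)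
    exact integral_nonneg fun ω => by positivity

theorem measurable_noiseScore {Ω : Type*} [MeasurableSpace Ω] {ε : ℤ → Ω → ℝ}
    (hε : ∀ t, Measurable (ε t)) (n : ℕ) : Measurable (noiseScore m ε n) := by
  unfold noiseScore
  fun_prop

theorem _root_.ArchLM.charFun_map_toLp {Ω' : Type*} [MeasurableSpace Ω'] (ν : Measure Ω')
    {X : Ω' → Fin m → ℝ} (hX : Measurable X) (v : EuclideanSpace ℝ (Fin m)) :
    charFun (ν.map fun ω => (WithLp.toLp 2 (X ω) : EuclideanSpace ℝ (Fin m))) v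
      = ∫ ω, Complex.exp (Complex.I * (v.ofLp ⬝ᵥ X ω : ℝ)) ∂ν := by
  have hlp : Measurable (fun ω => (WithLp.toLp 2 (X ω) : EuclideanSpace ℝ (Fin m))) :=
    (PiLp.continuous_toLp 2 _).measurable.comp hX
  rw [charFun_apply, integral_map hlp.aemeasurable (by fun_prop)]
  refine integral_congr_ae (Eventually.of_forall fun ω => ?_)
  simp only [EuclideanSpace.inner_eq_star_dotProduct, star_trivial, mul_comm Complex.I]

/-- The linearized score is asymptotically normal with covariance matrix `R Rᵀ`. -/
theorem tendstoInDistribution_noiseScore (hε : Noise μ ε) {R : Matrix (Fin m) (Fin m) ℝ}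
    (hR : R * R.transpose = covMatrix m (variance (fun ω => ε 0 ω ^ 2) μ) (∫ ω, ε 0 ω ^ 4 ∂μ)) :
    TendstoInDistribution (noiseScore m ε) atTop (fun z : Fin m → ℝ => R.mulVec z) (fun _ => μ)
      (Measure.pi fun _ : Fin m => gaussianReal 0 1) := by
  have hmR : Measurable (fun z : Fin m → ℝ => R.mulVec z) :=
    (Continuous.matrix_mulVec continuous_const continuous_id).measurable
  have hlp : Measurable (WithLp.toLp 2 : (Fin m → ℝ) → EuclideanSpace ℝ (Fin m)) :=
    (PiLp.continuous_toLp 2 _).measurable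
  have hlim : ∀ v : EuclideanSpace ℝ (Fin m),
      ∫ z, Complex.exp (Complex.I * (v.ofLp ⬝ᵥ R.mulVec z : ℝ))
        ∂(Measure.pi fun _ : Fin m => gaussianReal 0 1)
        = (Real.exp (-(v.ofLp ⬝ᵥ (covMatrix m (variance (fun ω => ε 0 ω ^ 2) μ)
          (∫ ω, ε 0 ω ^ 4 ∂μ)).mulVec v.ofLp) / 2) : ℂ) := by
    intro v
    -- The characteristic function of RZ at v is that of Z at Rᵀv, and ‖Rᵀv‖² = v·Σv. The norm must
    -- be Euclidean, hence the passage through `WithLp.toLp 2`.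
    have h := charFun_stdGaussian
      (WithLp.toLp 2 (R.transpose.mulVec v.ofLp) : EuclideanSpace ℝ (Fin m))
    rw [← map_pi_eq_stdGaussian] at h
    have h' := (charFun_map_toLp (Measure.pi fun _ : Fin m => gaussianReal 0 1) measurable_id
      (WithLp.toLp 2 (R.transpose.mulVec v.ofLp))).symm.trans h
    have hdot : ∀ z : Fin m → ℝ, v.ofLp ⬝ᵥ R.mulVec z = R.transpose.mulVec v.ofLp ⬝ᵥ z := fun z => by
      rw [Matrix.dotProduct_mulVec, Matrix.mulVec_transpose]
    simp_rw [hdot]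
    refine h'.trans ?_
    have hn : v.ofLp ⬝ᵥ (covMatrix m (variance (fun ω => ε 0 ω ^ 2) μ)
        (∫ ω, ε 0 ω ^ 4 ∂μ)).mulVec v.ofLp
        = ‖(WithLp.toLp 2 (R.transpose.mulVec v.ofLp) : EuclideanSpace ℝ (Fin m))‖ ^ 2 := by
      rw [← hR, ← Matrix.mulVec_mulVec, hdot, EuclideanSpace.real_norm_sq_eq]
      simp only [dotProduct, sq]
    rw [hn]
    push_cast
    rfl
  have hE : TendstoInDistribution (fun n ω => WithLp.toLp 2 (noiseScore m ε n ω)) atTop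
      (fun z : Fin m → ℝ => WithLp.toLp 2 (R.mulVec z)) (fun _ => μ)
      (Measure.pi fun _ : Fin m => gaussianReal 0 1) := by
    refine ⟨fun n => (hlp.comp (measurable_noiseScore hε.measurable n)).aemeasurable,
      (hlp.comp hmR).aemeasurable, ?_⟩
    -- Lévy's continuity theorem; for each v it calls for the scalar limit theorem only.
    refine (ProbabilityMeasure.tendsto_iff_tendsto_charFun
      (E := EuclideanSpace ℝ (Fin m))).2 fun v => ?_
    have hclt := (hε.finiteRangeMDS_noiseScoreTerm v.ofLp).tendsto_integral_cexp hε.measurable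
      hε.indep
    rw [← hlim v, ← charFun_map_toLp _ hmR v] at hclt
    refine hclt.congr fun n => ?_
    simp_rw [← dotProduct_noiseScore]
    exact (charFun_map_toLp μ (measurable_noiseScore hε.measurable n) v).symm
  exact hE.continuous_comp (PiLp.continuous_ofLp 2 _)

end Noise

end

/-! ### Linear algebra -/

section Matrix

variable {m : ℕ}

theorem continuousAt_matrix_inv {A : Matrix (Fin m) (Fin m) ℝ} (hA : A.det ≠ 0) :
    ContinuousAt (fun (B : Fin m → Fin m → ℝ) i j => (Matrix.of B)⁻¹ i j) (fun i j => A i j) := by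
  have hd : Continuous (fun B : Fin m → Fin m → ℝ => (Matrix.of B).det) :=
    Continuous.matrix_det continuous_id
  refine continuousAt_pi.2 fun i => continuousAt_pi.2 fun j => ?_
  have ha : Continuous (fun B : Fin m → Fin m → ℝ => (Matrix.of B).adjugate i j) :=
    (Continuous.matrix_adjugate continuous_id).matrix_elem i j
  simp only [Matrix.inv_def, Ring.inverse_eq_inv', Matrix.smul_apply, smul_eq_mul]
  exact (hd.continuousAt.inv₀ hA).mul ha.continuousAt

theorem measurable_matrix_inv_apply (i j : Fin m) :
    Measurable (fun B : Fin m → Fin m → ℝ => (Matrix.of B)⁻¹ i j) := by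
  have hd : Continuous (fun B : Fin m → Fin m → ℝ => (Matrix.of B).det) :=
    Continuous.matrix_det continuous_id
  have ha : Continuous (fun B : Fin m → Fin m → ℝ => (Matrix.of B).adjugate i j) :=
    (Continuous.matrix_adjugate continuous_id).matrix_elem i j
  simp only [Matrix.inv_def, Ring.inverse_eq_inv', Matrix.smul_apply, smul_eq_mul]
  exact hd.measurable.inv.mul ha.measurable

/-- The matrix is (v/4)((e − 1)I + 11ᵀ), a positive multiple of the identity plus a positive
semidefinite matrix of rank at most one. -/
theorem posDef_covMatrix {v e : ℝ} (hv : 0 < v) (he : 1 < e) : (covMatrix m v e).PosDef := by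
  have h : covMatrix m v e = (v / 4 * (e - 1)) • (1 : Matrix (Fin m) (Fin m) ℝ)
      + (v / 4) • Matrix.vecMulVec (fun _ => 1) (star fun _ => 1) := by
    ext i j
    simp only [covMatrix, Matrix.of_apply, Matrix.add_apply, Matrix.smul_apply, Matrix.one_apply,
      Matrix.vecMulVec_apply, Pi.star_apply, star_one, smul_eq_mul]
    split_ifs <;> ring
  rw [h]
  exact (Matrix.PosDef.one.smul (mul_pos (by positivity) (by linarith))).add_posSemidef
    ((Matrix.posSemidef_vecMulVec_self_star _).smul (by positivity))

-- Factor A = BᵀB with B invertible and take R = Bᵀ; then RᵀA⁻¹R = B(BᵀB)⁻¹Bᵀ = I.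
open scoped MatrixOrder Matrix.Norms.L2Operator in
theorem exists_mul_transpose_eq {A : Matrix (Fin m) (Fin m) ℝ} (hA : A.PosDef) :
    ∃ R : Matrix (Fin m) (Fin m) ℝ, R * R.transpose = A ∧
      ∀ z, R.mulVec z ⬝ᵥ A⁻¹.mulVec (R.mulVec z) = z ⬝ᵥ z := by
  obtain ⟨B, hB⟩ := CStarAlgebra.nonneg_iff_eq_star_mul_self.1 hA.posSemidef.nonneg
  rw [Matrix.star_eq_conjTranspose, Matrix.conjTranspose_eq_transpose_of_trivial] at hB
  have hdet : IsUnit B.det := by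
    have h := hA.det_pos.ne'
    rw [hB, Matrix.det_mul, Matrix.det_transpose] at h
    exact isUnit_iff_ne_zero.2 (left_ne_zero_of_mul h)
  have hdet' : IsUnit B.transpose.det := by rwa [Matrix.det_transpose]
  refine ⟨B.transpose, by rw [hB, Matrix.transpose_transpose], fun z => ?_⟩
  rw [hB, Matrix.mul_inv_rev, Matrix.mulVec_mulVec, Matrix.mul_assoc,
    Matrix.nonsing_inv_mul _ hdet', Matrix.mul_one, Matrix.dotProduct_mulVec,
    ← Matrix.mulVec_transpose, Matrix.mulVec_mulVec, Matrix.transpose_nonsing_inv,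
    Matrix.nonsing_inv_mul _ hdet', Matrix.one_mulVec]

end Matrix

/-! ### The model under the null hypothesis -/

section Null

variable {Ω : Type*} [MeasurableSpace Ω] {μ : Measure Ω} {p m : ℕ} {a : Fin p → ℝ} {α : Fin m → ℝ}
  {g : ℝ → ℝ} {ε : ℤ → Ω → ℝ} {u x : ℕ → ℤ → Ω → ℝ}

theorem ARCHModel.ar_of_null (hx : ARCHModel μ a α g ε u x) (hnull : ∀ i, α i = 0)
    {n : ℕ} {t : ℤ} (hpos : 0 < vol g n t) (h1 : 1 ≤ t) (hn : t ≤ n) (ω : Ω) :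
    x n t ω = a ⬝ᵥ lagVec p (fun s => x n s ω) (t - 1) + vol g n t * ε t ω := by
  rw [hx.ar n t h1 hn ω, hx.arch n t h1 hn ω]
  simp [hnull, Real.sqrt_sq hpos.le]

theorem ARCHModel.boundedVolAR [IsProbabilityMeasure μ] (hx : ARCHModel μ a α g ε u x)
    (hnull : ∀ i, α i = 0) {c H : ℝ} (hc : 0 < c)
    (hb : ∀ (n : ℕ) (t : ℤ), 1 ≤ t → t ≤ n → c ≤ vol g n t ∧ vol g n t ≤ H) :
    BoundedVolAR μ a c H (vol g) ε x where
  pos := hc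
  bounds := hb
  ar n ω t h1 hn := hx.ar_of_null hnull (hc.trans_le (hb n t h1 hn).1) h1 hn ω
  init := by
    have hi : ∀ i : Fin p, BddInProb μ (fun n ω => x n (0 - (i : ℕ)) ω) := by
      intro i δ hδ
      obtain ⟨M, hM⟩ := hx.init_bounded δ hδ
      refine ⟨max M 0, le_max_right _ _, Eventually.of_forall fun n => ?_⟩
      refine (measureReal_mono fun ω hω => ?_).trans
        (hM n (0 - (i : ℕ)) (by have := i.2; omega) (by omega))
      exact (le_max_left M 0).trans_lt hω
    refine (BddInProb.sum Finset.univ fun i (_ : i ∈ Finset.univ) => (hi i).abs).mono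
      (Eventually.of_forall fun n ω => ?_)
    rw [abs_of_nonneg (norm_nonneg _), abs_of_nonneg (Finset.sum_nonneg fun i _ => abs_nonneg _)]
    refine (pi_norm_le_iff_of_nonneg (Finset.sum_nonneg fun i _ => abs_nonneg _)).2 fun i => ?_
    exact Finset.single_le_sum (f := fun i : Fin p => |x n (0 - (i : ℕ)) ω|)
      (fun i _ => abs_nonneg _) (Finset.mem_univ i)

theorem ARCHModel.measurable (hx : ARCHModel μ a α g ε u x) (hε : ∀ t, Measurable (ε t))
    (hnull : ∀ i, α i = 0) {n : ℕ} (hpos : ∀ t : ℤ, 1 ≤ t → t ≤ n → 0 < vol g n t)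
    {t : ℤ} (hp : -(p : ℤ) < t) (hn : t ≤ n) : Measurable (x n t) := by
  suffices h : ∀ k : ℕ, k ≤ n → ∀ t : ℤ, -(p : ℤ) < t → t ≤ k → Measurable (x n t) from
    h n le_rfl t hp hn
  intro k
  induction k with
  | zero => exact fun _ t h1 h2 => hx.init_measurable n t h1 (by exact_mod_cast h2)
  | succ k ih =>
    intro hk t h1 h2
    rcases eq_or_ne t ((k : ℤ) + 1) with rfl | hne
    · have he : x n ((k : ℤ) + 1) = fun ω => ∑ i : Fin p, a i * x n ((k : ℤ) + 1 - 1 - (i : ℕ)) ω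
          + vol g n (k + 1) * ε (k + 1) ω := by
        funext ω
        rw [hx.ar_of_null hnull (hpos _ (by omega) (by exact_mod_cast hk)) (by omega)
          (by exact_mod_cast hk) ω]
        rfl
      rw [he]
      refine (Finset.measurable_sum _ fun i _ => ?_).add ((hε _).const_mul _)
      exact (ih (by omega) _ (by have := i.2; omega) (by omega)).const_mul _
    · exact ih (by omega) t h1 (by push_cast at h2; omega)

end Null

/-! ### Measurability of the statistics -/

section Measurability

variable {Ω : Type*} [MeasurableSpace Ω] {p : ℕ} {n : ℕ} {x : ℤ → Ω → ℝ}

theorem measurable_lagVec_apply (hx : ∀ t : ℤ, -(p : ℤ) < t → t ≤ n → Measurable (x t)) {t : ℤ}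
    (h0 : 0 ≤ t) (hn : t ≤ n) (i : Fin p) :
    Measurable (fun ω => lagVec p (fun s => x s ω) t i) :=
  hx _ (by have := i.2; omega) (by omega)

theorem measurable_gls_apply (h : ℤ → ℝ)
    (hx : ∀ t : ℤ, -(p : ℤ) < t → t ≤ n → Measurable (x t)) (i : Fin p) :
    Measurable (fun ω => gls p n h (fun s => x s ω) i) := by
  have hlag : ∀ t ∈ Finset.Icc (1 : ℤ) n, ∀ i : Fin p,
      Measurable (fun ω => lagVec p (fun s => x s ω) (t - 1) i) := fun t ht i => by
    rw [Finset.mem_Icc] at ht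
    exact measurable_lagVec_apply hx (by omega) (by omega) i
  have hxt : ∀ t ∈ Finset.Icc (1 : ℤ) n, Measurable (x t) := fun t ht => by
    rw [Finset.mem_Icc] at ht
    exact hx t (by omega) ht.2
  simp only [gls, Matrix.vecMul, dotProduct]
  refine Finset.measurable_sum _ fun j _ => Measurable.mul ?_ ?_
  · simp only [Finset.sum_apply, Pi.smul_apply, smul_eq_mul]
    exact Finset.measurable_sum _ fun t ht => ((hxt t ht).const_mul _).mul (hlag t ht j)
  · refine (measurable_matrix_inv_apply j i).comp (g := fun B : Fin p → Fin p → ℝ =>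
      (Matrix.of B)⁻¹ j i) (f := fun ω k l => (∑ t ∈ Finset.Icc (1 : ℤ) n,
      (h t ^ 2)⁻¹ • Matrix.vecMulVec (lagVec p (fun s => x s ω) (t - 1))
        (lagVec p (fun s => x s ω) (t - 1))) k l) ?_
    refine measurable_pi_lambda _ fun k => measurable_pi_lambda _ fun l => ?_
    simp only [Matrix.sum_apply, Matrix.smul_apply, Matrix.vecMulVec_apply, smul_eq_mul]
    exact Finset.measurable_sum _ fun t ht => ((hlag t ht k).mul (hlag t ht l)).const_mul _

theorem measurable_residual_gls (h : ℤ → ℝ)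
    (hx : ∀ t : ℤ, -(p : ℤ) < t → t ≤ n → Measurable (x t)) {t : ℤ} (hn : t ≤ n) :
    Measurable (fun ω => residual (fun s => x s ω) (gls p n h (fun s => x s ω)) t) := by
  unfold residual
  split_ifs with h0
  · exact measurable_const
  · refine (hx t (by omega) hn).sub ?_
    simp only [dotProduct]
    exact Finset.measurable_sum _ fun i _ => (measurable_gls_apply h hx i).mul
      (measurable_lagVec_apply hx (by omega) (by omega) i)

theorem measurable_empMoment (h : ℤ → ℝ)
    (hx : ∀ t : ℤ, -(p : ℤ) < t → t ≤ n → Measurable (x t)) (k : ℕ) :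
    Measurable (fun ω => empMoment p n k h (fun s => x s ω)) :=
  (Finset.measurable_sum _ fun _ ht => ((measurable_residual_gls h hx
    (Finset.mem_Icc.1 ht).2).pow_const k).div_const _).const_mul _

theorem measurable_score_gls {m : ℕ} {h : ℤ → ℝ} (hh : ∀ t ∈ Finset.Icc (1 : ℤ) n, h t ≠ 0)
    (hx : ∀ t : ℤ, -(p : ℤ) < t → t ≤ n → Measurable (x t)) :
    Measurable (fun ω => score m n h (fun s => x s ω) (gls p n h (fun s => x s ω))) := by
  refine measurable_pi_lambda _ fun i => ?_
  simp only [score_eq _ _ _ hh]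
  refine (Finset.measurable_sum _ fun t ht => ?_).const_mul _
  have ht' := Finset.mem_Icc.1 ht
  exact ((((measurable_residual_gls h hx ht'.2).pow_const 2).div_const _).sub_const 1).mul
    (((measurable_residual_gls h hx (by omega)).pow_const 2).div_const _)

end Measurability

/-! ### The limit law of the statistics -/

section Limit

variable {Ω : Type*} [MeasurableSpace Ω] {μ : Measure Ω} [IsProbabilityMeasure μ] {p m : ℕ}
  {a : Fin p → ℝ} {α : Fin m → ℝ} {g : ℝ → ℝ} {ε : ℤ → Ω → ℝ} {u x : ℕ → ℤ → Ω → ℝ}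

theorem Noise.variance_sq_pos (hε : Noise μ ε) : 0 < variance (fun ω => ε 0 ω ^ 2) μ := by
  rw [hε.variance_sq]
  linarith [hε.kurtosis]

theorem ARCHModel.measurable_vol {Ω : Type*} [MeasurableSpace Ω] {μ : Measure Ω}
    {ε : ℤ → Ω → ℝ} {u x : ℕ → ℤ → Ω → ℝ} (hx : ARCHModel μ a α g ε u x) (hε : Noise μ ε)
    (hg : VolatilityFunction g) (hnull : ∀ i, α i = 0) (n : ℕ) :
    (∀ t ∈ Finset.Icc (1 : ℤ) n, vol g n t ≠ 0) ∧
      ∀ t : ℤ, -(p : ℤ) < t → t ≤ n → Measurable (x n t) := by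
  obtain ⟨c, H, hc, hb⟩ := hg.exists_bounds
  refine ⟨fun t ht => ?_, fun t h1 h2 => hx.measurable hε.measurable hnull
    (fun t h1 h2 => hc.trans_le (hb n t h1 h2).1) h1 h2⟩
  rw [Finset.mem_Icc] at ht
  exact (hc.trans_le (hb n t ht.1 ht.2).1).ne'

/-- Two negligible errors separate the score from the noise score: the estimation of a, and the
volatility ratios. -/
theorem ARCHModel.tendstoInDistribution_score (hx : ARCHModel μ a α g ε u x) (hε : Noise μ ε)
    (ha : Stable a) (hg : VolatilityFunction g) (hnull : ∀ i, α i = 0)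
    {R : Matrix (Fin m) (Fin m) ℝ}
    (hR : R * R.transpose = covMatrix m (variance (fun ω => ε 0 ω ^ 2) μ) (∫ ω, ε 0 ω ^ 4 ∂μ)) :
    TendstoInDistribution (fun n ω =>
        score m n (vol g n) (fun t => x n t ω) (gls p n (vol g n) (fun t => x n t ω))) atTop
      (fun z : Fin m → ℝ => R.mulVec z) (fun _ => μ)
      (Measure.pi fun _ : Fin m => gaussianReal 0 1) := by
  obtain ⟨c, H, hc, hb⟩ := hg.exists_bounds
  have hB := hx.boundedVolAR hnull hc hb
  refine tendstoInDistribution_of_tendstoInMeasure_sub _ _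
    (hε.tendstoInDistribution_noiseScore hR) ?_ fun n =>
    (measurable_score_gls (hx.measurable_vol hε hg hnull n).1
      (hx.measurable_vol hε hg hnull n).2).aemeasurable
  refine tendstoInMeasure_pi (c := fun _ => 0) fun i => ?_
  obtain ⟨C, hC⟩ := hg.exists_sum_ratio_sub_one_sq_le ((i : ℕ) + 1)
  have h1 := hB.tendstoInMeasure_score_sub hε ha i rfl
  have h2 := hε.tendstoInMeasure_weighted_sub (l := (i : ℕ) + 1) (by omega) hC
  have h3 := tendstoInMeasure_add h1 h2
  rw [add_zero] at h3
  convert h3 using 3 with n ω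
  simp only [Pi.sub_apply, noiseScore]
  push_cast
  ring

/-- Slutsky's lemma: the score converges in law and Σ̂⁻¹ in probability, because inversion is
continuous at the non-singular Σ. The limit of the quadratic form is exactly ∑ z_i² under the
standard Gaussian product law. -/
theorem ARCHModel.asympChiSquared (hx : ARCHModel μ a α g ε u x) (hε : Noise μ ε)
    (ha : Stable a) (hg : VolatilityFunction g) (hnull : ∀ i, α i = 0)
    {sigmaHat : ℕ → Ω → Matrix (Fin m) (Fin m) ℝ} (hS : ConsistentSigma μ ε sigmaHat) :
    AsympChiSquared μ m (fun n ω =>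
      qGLS p m n (vol g n) (fun t => x n t ω) (sigmaHat n ω)) := by
  set A := covMatrix m (variance (fun ω => ε 0 ω ^ 2) μ) (∫ ω, ε 0 ω ^ 4 ∂μ) with hA
  have hpd : A.PosDef := posDef_covMatrix hε.variance_sq_pos hε.kurtosis
  obtain ⟨R, hR, hRz⟩ := exists_mul_transpose_eq hpd
  have hscore := hx.tendstoInDistribution_score hε ha hg hnull hR
  -- Convergence in measure is taken for functions `Fin m → Fin m → ℝ`, which carry the sup metric;
  -- this identifies them with matrices.
  have hof : ∀ B : Matrix (Fin m) (Fin m) ℝ, Matrix.of (fun i j => B i j) = B := fun _ => rfl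
  have hSm : TendstoInMeasure μ (fun n ω => (fun i j => sigmaHat n ω i j : Fin m → Fin m → ℝ))
      atTop (fun _ => (fun i j => A i j : Fin m → Fin m → ℝ)) :=
    tendstoInMeasure_pi (c := fun i j => A i j) fun i =>
      tendstoInMeasure_pi (c := fun j => A i j) fun j => hS.consistent i j
  have hinv : TendstoInMeasure μ
      (fun n ω => (fun i j => (sigmaHat n ω)⁻¹ i j : Fin m → Fin m → ℝ)) atTop
      (fun _ => (fun i j => A⁻¹ i j : Fin m → Fin m → ℝ)) := by
    have h := tendstoInMeasure_comp_of_continuousAt hSm (continuousAt_matrix_inv hpd.det_pos.ne')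
    simp only [hof] at h
    exact h
  have hinvm : ∀ n, AEMeasurable
      (fun ω => (fun i j => (sigmaHat n ω)⁻¹ i j : Fin m → Fin m → ℝ)) μ := fun n => by
    refine aemeasurable_pi_lambda _ fun i => aemeasurable_pi_lambda _ fun j => ?_
    have h : AEMeasurable (fun ω => (fun k l => sigmaHat n ω k l : Fin m → Fin m → ℝ)) μ :=
      aemeasurable_pi_lambda _ fun k => aemeasurable_pi_lambda _ fun l => hS.aemeasurable n k l
    have h' := (measurable_matrix_inv_apply i j).comp_aemeasurable h
    simp only [Function.comp_def, hof] at h'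
    exact h'
  have hcont : Continuous (fun q : (Fin m → ℝ) × (Fin m → Fin m → ℝ) =>
      q.1 ⬝ᵥ (Matrix.of q.2).mulVec q.1) :=
    continuous_fst.dotProduct (Continuous.matrix_mulVec continuous_snd continuous_fst)
  have hlim := hscore.continuous_comp_prodMk_of_tendstoInMeasure_const hcont hinv hinvm
  have hsq : ∀ z : Fin m → ℝ, R.mulVec z ⬝ᵥ A⁻¹.mulVec (R.mulVec z) = ∑ i, z i ^ 2 := fun z => by
    rw [hRz z]
    simp only [dotProduct, sq]
  simp only [hof, hsq] at hlim
  refine ⟨hlim.forall_aemeasurable, aemeasurable_id, ?_⟩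
  simpa only [qGLS, chiSquared, Measure.map_id] using hlim.tendsto

theorem ARCHModel.tendstoInMeasure_empMoment (hx : ARCHModel μ a α g ε u x) (hε : Noise μ ε)
    (ha : Stable a) (hg : VolatilityFunction g) (hnull : ∀ i, α i = 0) {k : ℕ}
    (hk : k = 2 ∨ k = 4) :
    TendstoInMeasure μ (fun n ω => empMoment p n k (vol g n) (fun t => x n t ω)) atTop
      (fun _ => ∫ ω, ε 0 ω ^ k ∂μ) := by
  obtain ⟨c, H, hc, hb⟩ := hg.exists_bounds
  exact (hx.boundedVolAR hnull hc hb).tendstoInMeasure_empMoment hε ha hk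

/-- Both variance estimators are φ of the fourth and second empirical moments, with φ(r, s) = r − 1
or r − s². The second moment tends to 1, and there φ equals r − 1, the variance of ε² when r =
E(ε⁴). -/
theorem ARCHModel.consistentSigma_covMatrix (hx : ARCHModel μ a α g ε u x) (hε : Noise μ ε)
    (ha : Stable a) (hg : VolatilityFunction g) (hnull : ∀ i, α i = 0) {φ : ℝ → ℝ → ℝ}
    (hφ : Continuous fun q : ℝ × ℝ => φ q.1 q.2)
    (hφv : ∀ r, φ r 1 = r - 1) :
    ConsistentSigma μ ε (fun n ω => covMatrix m
      (φ (empMoment p n 4 (vol g n) (fun t => x n t ω))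
        (empMoment p n 2 (vol g n) (fun t => x n t ω)))
      (empMoment p n 4 (vol g n) (fun t => x n t ω))) := by
  have hcont : ∀ i j : Fin m, Continuous (fun q : Fin 2 → ℝ =>
      covMatrix m (φ (q 0) (q 1)) (q 0) i j) := by
    intro i j
    have h : Continuous (fun q : Fin 2 → ℝ => φ (q 0) (q 1)) :=
      hφ.comp (g := fun r : ℝ × ℝ => φ r.1 r.2) (f := fun q : Fin 2 → ℝ => (q 0, q 1))
        (by fun_prop)
    simp only [covMatrix, Matrix.of_apply]
    refine (h.div_const 4).mul ?_
    split_ifs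
    exacts [continuous_apply 0, continuous_const]
  refine ⟨fun n i j => ?_, fun i j => ?_⟩
  · have hm := measurable_empMoment (vol g n) (hx.measurable_vol hε hg hnull n).2
    refine ((hcont i j).measurable.comp (f := fun ω => ![
      empMoment p n 4 (vol g n) (fun t => x n t ω),
      empMoment p n 2 (vol g n) (fun t => x n t ω)])
      (measurable_pi_lambda _ fun k => ?_)).aemeasurable
    fin_cases k
    exacts [hm 4, hm 2]
  · have hpair : TendstoInMeasure μ (fun n ω => ![empMoment p n 4 (vol g n) (fun t => x n t ω),
        empMoment p n 2 (vol g n) (fun t => x n t ω)]) atTop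
        (fun _ => ![∫ ω, ε 0 ω ^ 4 ∂μ, ∫ ω, ε 0 ω ^ 2 ∂μ]) := by
      refine tendstoInMeasure_pi fun k => ?_
      fin_cases k
      exacts [hx.tendstoInMeasure_empMoment hε ha hg hnull (Or.inr rfl),
        hx.tendstoInMeasure_empMoment hε ha hg hnull (Or.inl rfl)]
    have h := tendstoInMeasure_comp_of_continuousAt hpair (hcont i j).continuousAt
    simp only [Matrix.cons_val_zero, Matrix.cons_val_one, hε.integral_sq, hφv] at h
    rw [hε.variance_sq]
    exact h

end Limit

end ArchLM

end

theorem proposition2 {Ω : Type*} [MeasurableSpace Ω] (μ : Measure Ω) [IsProbabilityMeasure μ]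
    {p m : ℕ} (hm : 0 < m) (a₀ : Fin p → ℝ) (α₀ : Fin m → ℝ) (g : ℝ → ℝ)
    (ε : ℤ → Ω → ℝ) (u x : ℕ → ℤ → Ω → ℝ)
    (hstable : ArchLM.Stable a₀) (hg : ArchLM.VolatilityFunction g) (hε : ArchLM.Noise μ ε)
    (hmodel : ArchLM.ARCHModel μ a₀ α₀ g ε u x)
    (hnull : ∀ i, α₀ i = 0) :
    (∀ sigmaHat : ℕ → Ω → Matrix (Fin m) (Fin m) ℝ, ArchLM.ConsistentSigma μ ε sigmaHat →
      ArchLM.AsympChiSquared μ m (fun n ω =>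
        ArchLM.qGLS p m n (ArchLM.vol g n) (fun t => x n t ω) (sigmaHat n ω))) ∧
    ArchLM.AsympChiSquared μ m (fun n ω =>
      ArchLM.qGLS p m n (ArchLM.vol g n) (fun t => x n t ω)
        (ArchLM.sigmaHat₁ p m n (ArchLM.vol g n) (fun t => x n t ω))) ∧
    ArchLM.AsympChiSquared μ m (fun n ω =>
      ArchLM.qGLS p m n (ArchLM.vol g n) (fun t => x n t ω)
        (ArchLM.sigmaHat₂ p m n (ArchLM.vol g n) (fun t => x n t ω))) := by
  refine ⟨fun sigmaHat hS => hmodel.asympChiSquared hε hstable hg hnull hS,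
    hmodel.asympChiSquared hε hstable hg hnull ?_, hmodel.asympChiSquared hε hstable hg hnull ?_⟩
  · exact hmodel.consistentSigma_covMatrix hε hstable hg hnull (φ := fun r _ => r - 1)
      (by fun_prop) (fun r => rfl)
  · exact hmodel.consistentSigma_covMatrix hε hstable hg hnull (φ := fun r s => r - s ^ 2)
      (by fun_prop) (fun r => by ring)
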